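/- \textbf{Notation.} For $x\in\mathbb N$ let $\ell(x)=\lceil\log_2(x+1)\rceil$ be the number of binary digits of $x$ (so $\ell(0)=0$), and for $z\in\mathbb Z$ let $\mathsf{sg}(z)=1$ if $z>0$ and $\mathsf{sg}(z)=0$ otherwise. For $\mathbf y\in\mathbb N^p$, the discrete ODE $\frac{\partial f(x,\mathbf y)}{\partial \ell}=u(x,\mathbf y)$ stands for $$f(x+1,\mathbf y)=f(x,\mathbf y)+\big(\ell(x+1)-\ell(x)\big)\cdot u(x,\mathbf y)\qquad\text{for all }x\in\mathbb N,\ \mathbf y\in\mathbb N^p .$$ An $\mathsf{sg}$-polynomial expression is an expression built from variables (terms) and integer constants with $+,-,\times$, the integer division $\div 2$ ($z\div 2=\lfloor z/2\rfloor$) and $\mathsf{sg}$. \textbf{The class $\mathbf{FNC}^1$.} A function $F:\mathbb N^p\to\mathbb N$ is in $\mathbf{FNC}^1$ if there is a $\mathbf{Dlogtime}$-uniform family $(C_n)_{n\in\mathbb N}$ of Boolean circuits with gates $\wedge,\vee,\neg$ (and constants) of fan-in at most two, of size polynomial in $n$ and depth $O(\log n)$, such that $C_n$ outputs $F(\mathbf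 y)$ in binary (leading zeros allowed) for every tuple $\mathbf y\in\mathbb N^p$ of numbers of at most $n$ bits, given as $p$ blocks of $n$ bits. $\mathbf{Dlogtime}$-uniform means that the gates of $C_n$ are named by bit strings of length $O(\log n)$ and that a deterministic Turing machine with a random access tape holding $1^n$ decides, given names $a,b$ and a type $t$, the direct connection language of $C_n$ (for $t\in\{\wedge,\vee,\neg\}$: $a$ is a gate of type $t$ and $b$ is a predecessor of $a$; analogously for constants, input nodes and output nodes) in time $O(\log n+|a|+|b|)$, hence in time $O(\log n)$ on names of gates. \textbf{Lemma (Bounded Concatenation with Simple Calls).} Let $p\in\mathbb N$, and let $g:\mathbb N^p\to\mathbb N$ and $h:\mathbb N^{p+1}\to\mathbb N$ be in $\mathbf{FNC}^1$. Let $K$ be an $\mathsf{sg}$-polynomial expression in the terms $x$, $\mathbf y=(y_1,\dots,y_p)$, $h(x,\mathbf y)$ and $f(x,\mathbf y)$, in which $f(x,\mathbf y)$ occurs only in subexpressions of the form $\mathsf{sg}(f(x,\mathbf y))$. Let $f:\mathbb N^{p+1}\to\mathbb N$ be the solution of the initial value problem $$f(0,\mathbf y)=g(\mathbf y),\qquad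 \frac{\partial f(x,\mathbf y)}{\partial\ell}=f(x,\mathbf y)+K\big(x,\mathbf y,h(x,\mathbf y),f(x,\mathbf y)\big),$$ and suppose that $K\big(x,\mathbf y,h(x,\mathbf y),f(x,\mathbf y)\big)\in\{0,1\}$ for all $x\in\mathbb N$ and $\mathbf y\in\mathbb N^p$. Then $f$ is in $\mathbf{FNC}^1$. -/

import Mathlib

namespace LengthODE

/-! ### Length function, sign function and derivation along the length -/

/-- The number of binary digits of `x`, with `len 0 = 0`; equivalently `⌈log₂ (x + 1)⌉`. -/
def len (x : ℕ) : ℕ := Nat.size x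

/-- The sign function on `ℤ`: `1` for positive arguments and `0` otherwise. -/
def sg (z : ℤ) : ℤ := if 0 < z then 1 else 0

/-- `f` solves the discrete ODE `∂f(x, y)/∂ℓ = rhs(x, y)`, where `∂f/∂ℓ = rhs` stands for
`f(x+1, y) = f(x, y) + (ℓ(x+1) - ℓ(x)) * rhs(x, y)`. The equation is one between integers. -/
def SolvesLengthODE {p : ℕ} (f : ℕ → (Fin p → ℕ) → ℕ) (rhs : ℕ → (Fin p → ℕ) → ℤ) : Prop :=
  ∀ x y, (f (x + 1) y : ℤ) = (f x y : ℤ) + ((len (x + 1) : ℤ) - (len x : ℤ)) * rhs x y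

/-! ### `sg`-polynomial expressions -/

/-- Expressions over the signature `{+, -, ÷2, ×, sg}` with integer constants and with
variables from `X`. -/
inductive SgPoly (X : Type) : Type
  | var (v : X) : SgPoly X
  | const (c : ℤ) : SgPoly X
  | add (P Q : SgPoly X) : SgPoly X
  | sub (P Q : SgPoly X) : SgPoly X
  | mul (P Q : SgPoly X) : SgPoly X
  | half (P : SgPoly X) : SgPoly X
  | sign (P : SgPoly X) : SgPoly X

/-- Value of an expression; the division by two of integers rounds down. -/
def SgPoly.eval {X : Type} (ρ : X → ℤ) : SgPoly X → ℤ
  | .var v => ρ v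
  | .const c => c
  | .add P Q => P.eval ρ + Q.eval ρ
  | .sub P Q => P.eval ρ - Q.eval ρ
  | .mul P Q => P.eval ρ * Q.eval ρ
  | .half P => P.eval ρ / 2
  | .sign P => sg (P.eval ρ)

/-- The terms which may occur in the right-hand side of the schema:
`x`, `y₁, …, y_p`, `h(x, y)` and `f(x, y)`. -/
inductive Term (p : ℕ) : Type
  | x : Term p
  | y (j : Fin p) : Term p
  | h : Term p
  | f : Term p

/-- The values of these terms. -/
def Term.val {p : ℕ} (x : ℕ) (y : Fin p → ℕ) (hv fv : ℕ) : Term p → ℤ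
  | .x => x
  | .y j => y j
  | .h => hv
  | .f => fv

/-- The value `K(x, y, h(x, y), f(x, y))`, where `hv = h(x, y)` and `fv = f(x, y)`. -/
def SgPoly.value {p : ℕ} (K : SgPoly (Term p)) (x : ℕ) (y : Fin p → ℕ) (hv fv : ℕ) : ℤ :=
  K.eval (Term.val x y hv fv)

/-- The expression has only simple calls: `f(x, y)` occurs in it only in subexpressions of the
form `sg(f(x, y))`. -/
def SgPoly.SimpleCalls {p : ℕ} : SgPoly (Term p) → Prop
  | .var .f => False
  | .var _ => True
  | .const _ => True
  | .add P Q => P.SimpleCalls ∧ Q.SimpleCalls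
  | .sub P Q => P.SimpleCalls ∧ Q.SimpleCalls
  | .mul P Q => P.SimpleCalls ∧ Q.SimpleCalls
  | .half P => P.SimpleCalls
  | .sign (.var .f) => True
  | .sign P => P.SimpleCalls

/-! ### Boolean circuits of bounded fan-in -/

/-- Names (numbers) of gates: bit strings. -/
abbrev Name := List Bool

/-- Labels of the nodes of a circuit whose input consists of `p` numbers of `n` bits:
`input j i` reads the bit of weight `2 ^ i` of the `j`-th number. -/
inductive Label (p n : ℕ) : Type
  | and : Label p n
  | or : Label p n
  | not : Label p n
  | const (c : Bool) : Label p n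
  | input (j : Fin p) (i : Fin n) : Label p n

/-- A Boolean circuit over `∧, ∨, ¬` (and the constants) of fan-in at most two, for `p` input
numbers of `n` bits each, with `numOut` outputs. That the graph is acyclic is part of
`DepthLE` below. -/
structure Circuit (p n : ℕ) where
  gates : Finset Name
  label : Name → Label p n
  pred : Name → Finset Name
  numOut : ℕ
  out : Fin numOut → Name
  pred_subset : ∀ a ∈ gates, pred a ⊆ gates
  out_mem : ∀ i, out i ∈ gates
  card_and : ∀ a ∈ gates, label a = .and → (pred a).card = 1 ∨ (pred a).card = 2
  card_or : ∀ a ∈ gates, label a = .or → (pred a).card = 1 ∨ (pred a).card = 2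
  card_not : ∀ a ∈ gates, label a = .not → (pred a).card = 1
  card_const : ∀ a ∈ gates, ∀ c, label a = .const c → pred a = ∅
  card_input : ∀ a ∈ gates, ∀ j i, label a = .input j i → pred a = ∅

/-- The size: the number of gates and outputs. -/
def Circuit.size {p n : ℕ} (C : Circuit p n) : ℕ := C.gates.card + C.numOut

/-- The circuit is acyclic and its depth, i.e. the number of edges on a longest path, is at
most `d`; it is stated through a levelling of the gates. See `Circuit.depthLE_iff_path`. -/
def Circuit.DepthLE {p n : ℕ} (C : Circuit p n) (d : ℕ) : Prop :=
  ∃ level : Name → ℕ, ∀ a ∈ C.gates, level a ≤ d ∧ ∀ b ∈ C.pred a, level b < level a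

/-- The levelling in `DepthLE` expresses exactly that every path in the circuit (a list of gates,
each followed by one of its predecessors) has at most `d` edges. -/
theorem Circuit.depthLE_iff_path {p n : ℕ} (C : Circuit p n) (d : ℕ) :
    C.DepthLE d ↔ ∀ l : List Name, l.IsChain (fun a b => b ∈ C.pred a) →
      (∀ a ∈ l, a ∈ C.gates) → l.length ≤ d + 1 := by
  constructor
  · rintro ⟨level, hl⟩ l hc hg
    have key : ∀ (l : List Name) (a : Name), (a :: l).IsChain (fun a b => b ∈ C.pred a) →
        (∀ b ∈ a :: l, b ∈ C.gates) → l.length ≤ level a := by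
      intro l
      induction l with
      | nil => intro a _ _; simp
      | cons b l ih =>
        intro a hc hg
        rw [List.isChain_cons_cons] at hc
        have h1 := ih b hc.2 (fun x hx => hg x (List.mem_cons_of_mem _ hx))
        have h2 := (hl a (hg a (by simp))).2 b hc.1
        simp only [List.length_cons]
        omega
    cases l with
    | nil => simp
    | cons a l =>
      have h1 := key l a hc hg
      have h2 := (hl a (hg a (by simp))).1
      simp only [List.length_cons]
      omega
  · intro H
    let S : Name → Set ℕ := fun a => {k | ∃ l : List Name,
      (a :: l).IsChain (fun a b => b ∈ C.pred a) ∧ (∀ b ∈ a :: l, b ∈ C.gates) ∧ l.length = k}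
    have hb : ∀ a, ∀ k ∈ S a, k ≤ d := by
      rintro a k ⟨l, hc, hg, rfl⟩
      have := H _ hc hg
      simp only [List.length_cons] at this
      omega
    have hbd : ∀ a, BddAbove (S a) := fun a => ⟨d, fun k hk => hb a k hk⟩
    have hne : ∀ a ∈ C.gates, (S a).Nonempty := fun a ha =>
      ⟨0, [], by simp, by simpa using ha, rfl⟩
    refine ⟨fun a => sSup (S a), fun a ha => ⟨csSup_le (hne a ha) (hb a), fun b hba => ?_⟩⟩
    obtain ⟨l, hc, hg, hk⟩ := Nat.sSup_mem (hne b (C.pred_subset a ha hba)) (hbd b)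
    have : sSup (S b) + 1 ∈ S a := by
      refine ⟨b :: l, List.isChain_cons_cons.2 ⟨hba, hc⟩, ?_, by simp [hk]⟩
      intro x hx
      rcases List.mem_cons.1 hx with rfl | hx
      · exact ha
      · exact hg x hx
    exact Nat.lt_of_succ_le (le_csSup (hbd a) this)

/-- `v` assigns to every gate the value which it computes on the input `y`.
In an acyclic circuit there is exactly one such assignment of values to the gates. -/
def Circuit.IsValuation {p n : ℕ} (C : Circuit p n) (y : Fin p → ℕ) (v : Name → Bool) : Prop :=
  ∀ a ∈ C.gates,
    match C.label a with
    | .and => (v a = true ↔ ∀ b ∈ C.pred a, v b = true)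
    | .or => (v a = true ↔ ∃ b ∈ C.pred a, v b = true)
    | .not => (v a = true ↔ ∀ b ∈ C.pred a, v b = false)
    | .const c => v a = c
    | .input j i => v a = (y j).testBit i

/-- On the input `y`, the circuit outputs the number `z` in binary (possibly with leading
zeros), the `i`-th output being the bit of weight `2 ^ i`. -/
def Circuit.Outputs {p n : ℕ} (C : Circuit p n) (y : Fin p → ℕ) (z : ℕ) : Prop :=
  ∃ v, C.IsValuation y v ∧ z = ∑ i : Fin C.numOut, 2 ^ (i : ℕ) * (v (C.out i)).toNat

/-- The types `t` about which the direct connection language can be asked. -/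
inductive ConnType (p : ℕ) : Type
  | and : ConnType p
  | or : ConnType p
  | not : ConnType p
  | const (c : Bool) : ConnType p
  | input (j : Fin p) : ConnType p
  | output : ConnType p

/-- The direct connection language of a circuit. For `t ∈ {∧, ∨, ¬}`: the gate `a` is of type
`t` and `b` is a predecessor of `a`. For the other types: `a` is a constant node; `a` is the
input node for bit number `b` of the `j`-th input number; `a` is output number `b`. In the
last two cases `b` is a number in binary, least significant bit first. -/
def Circuit.Conn {p n : ℕ} (C : Circuit p n) (t : ConnType p) (a b : Name) : Prop :=
  a ∈ C.gates ∧
    match t with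
    | .and => C.label a = .and ∧ b ∈ C.pred a
    | .or => C.label a = .or ∧ b ∈ C.pred a
    | .not => C.label a = .not ∧ b ∈ C.pred a
    | .const c => C.label a = .const c
    | .input j => ∃ i : Fin n, C.label a = .input j i ∧ b = Nat.bits i
    | .output => ∃ i : Fin C.numOut, a = C.out i ∧ b = Nat.bits i

/-! ### Turing machines with a random access tape -/

/-- A one-way infinite tape over the symbols `0`, `1` and blank (`none`): the cells to the left
of the head, nearest first, and the cells from the head on, followed by blanks only. -/
structure Tape where
  left : List (Option Bool)
  right : List (Option Bool)

inductive Move : Type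
  | left | stay | right

/-- The scanned symbol. -/
def Tape.read (T : Tape) : Option Bool := T.right.headD none

def Tape.write (T : Tape) (s : Option Bool) : Tape := ⟨T.left, s :: T.right.tail⟩

/-- Moving the head; a move to the left in the leftmost cell has no effect. -/
def Tape.move (T : Tape) : Move → Tape
  | .left =>
    match T.left with
    | [] => T
    | s :: l => ⟨l, s :: T.right⟩
  | .stay => T
  | .right => ⟨T.read :: T.left, T.right.tail⟩

/-- The tape with a bit string written from the leftmost cell on, the head in that cell. -/
def Tape.init (w : List Bool) : Tape := ⟨[], w.map some⟩

/-- The number written in binary on the tape: the bits from the leftmost cell up to the first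
blank, least significant bit first. -/
def Tape.address (T : Tape) : ℕ :=
  Nat.ofDigits 2 (((T.left.reverse ++ T.right).takeWhile Option.isSome).reduceOption.map
    Bool.toNat)

/-- The tapes of a machine: two for the arguments `a` and `b`, the index tape through which the
random access tape is read, and further work tapes. -/
inductive TapeId (ι : Type) : Type
  | argA : TapeId ι
  | argB : TapeId ι
  | index : TapeId ι
  | work (i : ι) : TapeId ι

/-- A deterministic multi-tape Turing machine with a random access tape. The random access tape
holds `1ⁿ`; in every step the machine sees the symbol in that one of its cells whose address is
written on the index tape (`true` if it holds a `1`, `false` if it is blank). The argument `t`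
of the finite type `I` is given through the initial state; `halt q = some r` means that `q` is
a halting state with answer `r`. -/
structure Machine (I : Type) where
  Q : Type
  ι : Type
  finite_Q : Finite Q
  finite_ι : Finite ι
  start : I → Q
  halt : Q → Option Bool
  trans : Q → (TapeId ι → Option Bool) → Bool → Q × (TapeId ι → Option Bool × Move)

structure Machine.Config {I : Type} (M : Machine I) where
  state : M.Q
  tape : TapeId M.ι → Tape

def Machine.init {I : Type} (M : Machine I) (t : I) (a b : List Bool) : M.Config where
  state := M.start t
  tape
    | .argA => Tape.init a
    | .argB => Tape.init b
    | .index => Tape.init []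
    | .work _ => Tape.init []

/-- One step of the machine, with `1ⁿ` on the random access tape. -/
def Machine.step {I : Type} (M : Machine I) (n : ℕ) (c : M.Config) : M.Config :=
  match M.halt c.state with
  | some _ => c
  | none =>
    let r := M.trans c.state (fun i => (c.tape i).read) (decide ((c.tape .index).address < n))
    ⟨r.1, fun i => ((c.tape i).write (r.2 i).1).move (r.2 i).2⟩

/-- Started with `1ⁿ` on the random access tape and with the arguments `t, a, b`, the machine
halts within `s` steps, and it accepts if and only if `A` holds. -/
def Machine.DecidesWithin {I : Type} (M : Machine I) (n : ℕ) (t : I) (a b : List Bool)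
    (s : ℕ) (A : Prop) : Prop :=
  ∃ r : Bool, M.halt ((M.step n)^[s] (M.init t a b)).state = some r ∧ (r = true ↔ A)

/-- A family of circuits is Dlogtime-uniform: the names of the gates have `O(log n)` bits, and
some machine decides, given `1ⁿ, t, a, b`, the direct connection language of the `n`-th circuit
in time linear in `log n` and the lengths of the names `a, b`; so in time `O(log n)` on names
of `O(log n)` bits. -/
def DlogtimeUniform {p : ℕ} (C : (n : ℕ) → Circuit p n) : Prop :=
  (∃ c : ℕ, ∀ n, ∀ a ∈ (C n).gates, a.length ≤ c * (len n + 1)) ∧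
  ∃ (M : Machine (ConnType p)) (c : ℕ), ∀ n t a b,
    M.DecidesWithin n t a b (c * (len n + a.length + b.length + 1)) ((C n).Conn t a b)

/-- The class `FNC¹`: functions `F : ℕ^p → ℕ` which are computed by a Dlogtime-uniform family of
Boolean circuits of bounded fan-in, of polynomial size and depth `O(log n)`. The `n`-th circuit
computes `F` on all tuples of numbers of at most `n` bits. -/
def FNC1 {p : ℕ} (F : (Fin p → ℕ) → ℕ) : Prop :=
  ∃ C : (n : ℕ) → Circuit p n,
    DlogtimeUniform C ∧
    (∃ c : ℕ, ∀ n, (C n).size ≤ c * (n + 1) ^ c) ∧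
    (∃ c : ℕ, ∀ n, (C n).DepthLE (c * (len n + 1))) ∧
    ∀ n, ∀ y : Fin p → ℕ, (∀ j, len (y j) ≤ n) → (C n).Outputs y (F y)

end LengthODE

/-! The length of `x` changes only in passing from `2 ^ k - 1` to `2 ^ k`, so `f x y` depends on `x`
through `len x` alone, and `G k = f (2 ^ k - 1) y` satisfies `G (k + 1) = 2 * G k + K_k` with `K_k ∈
{0, 1}`: every step appends one bit on the right. The binary expansion of `f x y` is that of `g y`
followed by `K_0, …, K_(len x - 1)`. Since `K_k` depends on `G k` only through its sign, both
candidates for `K_k`, one for each sign, can be computed for all `k` in parallel. The sign of `G k`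
needs no recursion either: as long as `G` vanishes, the candidate for sign `0` is the true one, so
`G k` is positive iff `g y` is, or this candidate is positive for some `j < k`. Hence a bit of `f`
is a Boolean combination, with one bounded quantifier, of values of `K` at known arguments
(`testBit_solution`).

It remains to evaluate `K` in logarithmic depth. Positions of bits are numbers below `2 ^ N` with
`N` proportional to `len n + 1`. A quantifier over such numbers costs depth `O(N)`, as its witness
is guessed bit by bit (`Comp.ex`). Sums are computed by carry look-ahead (`zbit_add`), products by a
tree of carry-save adders with `N` levels (`bitSum_carrySaveTree`, `CompZ.mul`), and halving and
`sg` by inspecting bits in two's complement. All intermediate values have fewer than `2 ^ N` bits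
(`SgPoly.abs_eval_le`).

Uniformity is built in by naming gates with words of length `N` over a finite alphabet, such that
the kind of a gate and the graphs of the predecessor maps are recognised by finite automata
(`RegFun`, `AutFun`, `Net`). The basic closure property is `Comp.recursion`: a predicate of words
given by finitely many Boolean expressions in its values at words of smaller level is again computed
by such a network, if the level is `O(N)`. It yields the connectives, the quantifiers and the
carry-save trees.

The functions `g` and `h` enter through copies of their circuits, one for each call; the argument `2
^ k - 1` of `h` is hard-wired, since its bit `i` is `i < k`. A question about the connections of the
assembled circuit is then answered by a finite automaton and at most one query, either to the
connection language of a given circuit or about a comparison with `n` (`Calls.classifier`,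
`Calls.accepts_classifier`). A machine with random access to `1 ^ n` measures `len n`, runs the
automaton as a transducer which also writes down the arguments of the query, and then runs the
machine for the query, all in time `O(log n)` (`Transducer.decidableInLogtime`). `Calls.fnc1`
combines these facts. -/

namespace LengthODE

/-! ### Tapes as head position and cell contents -/

/-- A tape up to trailing blanks: the position of the head and the contents of all cells. -/
structure ATape where
  pos : ℕ
  cell : ℕ → Option Bool

namespace ATape

def read (T : ATape) : Option Bool := T.cell T.pos

def write (T : ATape) (s : Option Bool) : ATape := ⟨T.pos, Function.update T.cell T.pos s⟩

def move (T : ATape) : Move → ATape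
  | .left => ⟨T.pos - 1, T.cell⟩
  | .stay => T
  | .right => ⟨T.pos + 1, T.cell⟩

def ofList (w : List Bool) : ATape := ⟨0, fun i => w[i]?⟩

open Classical in
/-- The number written on the cells before the first blank one. -/
noncomputable def addr (cell : ℕ → Option Bool) : ℕ :=
  if h : ∃ k, cell k = none then
    Nat.ofDigits 2 ((List.range (Nat.find h)).map (fun i => ((cell i).getD false).toNat))
  else 0

/-- The hypothesis includes the cell number `l.length`, where `l[i]?` is `none`: this is the blank
which ends the address. Later cells are irrelevant. -/
theorem addr_of_list (cell : ℕ → Option Bool) (l : List Bool)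
    (hl : ∀ i ≤ l.length, cell i = l[i]?) : addr cell = Nat.ofDigits 2 (l.map Bool.toNat) := by
  have hex : ∃ k, cell k = none := ⟨l.length, by rw [hl _ le_rfl]; simp⟩
  classical
  have hfind : Nat.find hex = l.length := by
    rw [Nat.find_eq_iff]
    refine ⟨by rw [hl _ le_rfl]; simp, fun m hm => ?_⟩
    rw [hl _ hm.le]; simp [hm]
  unfold addr
  rw [dif_pos hex]
  congr 1
  apply List.ext_getElem
  · simp only [List.length_map, List.length_range]
    convert hfind
  · intro i h1 h2
    simp only [List.length_map] at h2
    simp [hl i h2.le, h2]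

end ATape

/-- Brings the word before the first blank into the form which `ATape.addr_of_list` expects, with
the terminating blank recorded through `i ≤ l.length`. -/
theorem List.exists_takeWhile_isSome (L : List (Option Bool)) :
    ∃ l : List Bool, (L.takeWhile Option.isSome).reduceOption = l ∧
      ∀ i ≤ l.length, L.getD i none = l[i]? := by
  induction L with
  | nil => exact ⟨[], by simp⟩
  | cons x L ih =>
    obtain ⟨l, h1, h2⟩ := ih
    cases x with
    | none =>
      refine ⟨[], by simp, ?_⟩
      intro i hi
      simp only [List.length_nil, Nat.le_zero] at hi
      subst hi; simp
    | some b =>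
      refine ⟨b :: l, by simp [h1], ?_⟩
      intro i hi
      cases i with
      | zero => simp
      | succ i =>
        simp only [List.length_cons, Nat.add_le_add_iff_right] at hi
        simpa using h2 i hi

/-- Forgetting trailing blanks. -/
def Tape.abs (T : Tape) : ATape := ⟨T.left.length, fun i => (T.left.reverse ++ T.right).getD i none⟩

theorem Tape.read_abs (T : Tape) : T.read = T.abs.read := by
  rcases T with ⟨l, r⟩
  simp only [Tape.read, Tape.abs, ATape.read]
  cases r <;> simp

theorem Tape.abs_write (T : Tape) (s : Option Bool) : (T.write s).abs = T.abs.write s := by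
  rcases T with ⟨l, r⟩
  simp only [Tape.write, Tape.abs, ATape.write, ATape.mk.injEq, true_and]
  funext i
  rcases lt_trichotomy i l.length with h | h | h
  · rw [Function.update_of_ne h.ne, List.getD_append _ _ _ _ (by simpa using h),
      List.getD_append _ _ _ _ (by simpa using h)]
  · subst h
    simp
  · rw [Function.update_of_ne h.ne', List.getD_append_right _ _ _ _ (by simpa using h.le),
      List.getD_append_right _ _ _ _ (by simpa using h.le)]
    obtain ⟨k, rfl⟩ := Nat.exists_eq_add_of_lt h
    simp only [List.length_reverse]
    rw [show l.length + k + 1 - l.length = k + 1 by omega]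
    cases r <;> simp

/-- The truncated `pos - 1` reproduces the convention for a left move in the leftmost cell. A right
move past the end stores an explicit blank, which the function of cell contents does not see. -/
theorem Tape.abs_move (T : Tape) (m : Move) : (T.move m).abs = T.abs.move m := by
  rcases T with ⟨l, r⟩
  cases m with
  | left =>
    cases l with
    | nil => simp [Tape.move, Tape.abs, ATape.move]
    | cons x l => simp [Tape.move, Tape.abs, ATape.move]
  | stay => rfl
  | right =>
    simp only [Tape.move, Tape.abs, ATape.move, List.length_cons, ATape.mk.injEq, true_and]
    funext i
    cases r with
    | nil =>
      simp only [Tape.read, List.headD_nil, List.reverse_cons, List.tail_nil, List.append_nil]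
      rcases lt_or_ge i l.length with h | h
      · rw [List.getD_append _ _ _ _ (by simpa using h)]
      · rw [List.getD_append_right _ _ _ _ (by simpa using h)]
        rw [List.getD_eq_default (l := l.reverse) _ (by simpa using h)]
        rcases h.eq_or_lt with h | h
        · subst h; simp
        · rw [List.getD_eq_default _ _ (by simp; omega)]
    | cons x r => simp [Tape.read]

theorem Tape.address_abs (T : Tape) : T.address = ATape.addr T.abs.cell := by
  obtain ⟨l, h1, h2⟩ := List.exists_takeWhile_isSome (T.left.reverse ++ T.right)
  rw [ATape.addr_of_list T.abs.cell l h2, Tape.address, h1]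

theorem Tape.abs_init (w : List Bool) : (Tape.init w).abs = ATape.ofList w := by
  simp only [Tape.init, Tape.abs, ATape.ofList, List.length_nil, List.reverse_nil, List.nil_append,
    ATape.mk.injEq, true_and]
  funext i
  simp only [List.getD_eq_getElem?_getD, List.getElem?_map]
  cases w[i]? <;> simp

/-! ### Machines on such tapes -/

@[ext] structure AConfig {I : Type} (M : Machine I) where
  state : M.Q
  tape : TapeId M.ι → ATape

namespace Machine

variable {I : Type} (M : Machine I)

/-- The effect of a step on a tape. -/
def _root_.LengthODE.ATape.act (T : ATape) (r : Option Bool × Move) : ATape :=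
  (T.write r.1).move r.2

noncomputable def astep (n : ℕ) (c : AConfig M) : AConfig M :=
  match M.halt c.state with
  | some _ => c
  | none =>
    let r := M.trans c.state (fun i => (c.tape i).read)
      (decide (ATape.addr (c.tape .index).cell < n))
    ⟨r.1, fun i => (c.tape i).act (r.2 i)⟩

def ainit (t : I) (a b : List Bool) : AConfig M where
  state := M.start t
  tape
    | .argA => ATape.ofList a
    | .argB => ATape.ofList b
    | _ => ATape.ofList []

def Config.abs {M : Machine I} (c : M.Config) : AConfig M := ⟨c.state, fun i => (c.tape i).abs⟩

theorem abs_step (n : ℕ) (c : M.Config) : (M.step n c).abs = M.astep n c.abs := by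
  unfold step astep
  simp only [Config.abs]
  cases h : M.halt c.state with
  | some r => rfl
  | none =>
    simp only [ATape.act, Tape.read_abs, Tape.address_abs, Tape.abs_move, Tape.abs_write]
    rfl

theorem abs_iterate (n k : ℕ) (c : M.Config) :
    ((M.step n)^[k] c).abs = (M.astep n)^[k] c.abs := by
  induction k generalizing c with
  | zero => rfl
  | succ k ih => rw [Function.iterate_succ_apply, Function.iterate_succ_apply, ih, abs_step]

theorem abs_init (t : I) (a b : List Bool) : (M.init t a b).abs = M.ainit t a b := by
  simp only [Machine.init, Config.abs, ainit, AConfig.mk.injEq, true_and]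
  funext i
  cases i <;> simp [Tape.abs_init]

/-- Forgetting trailing blanks keeps the state and commutes with steps, so runs can be analysed on
tapes given as functions of the cell number. -/
theorem decidesWithin_iff (n : ℕ) (t : I) (a b : List Bool) (s : ℕ) (A : Prop) :
    M.DecidesWithin n t a b s A ↔
      ∃ r : Bool, M.halt ((M.astep n)^[s] (M.ainit t a b)).state = some r ∧ (r = true ↔ A) := by
  rw [← abs_init, ← abs_iterate]
  rfl

theorem astep_of_halt {n : ℕ} {c : AConfig M} {r : Bool} (h : M.halt c.state = some r) (k : ℕ) :
    (M.astep n)^[k] c = c := by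
  induction k with
  | zero => rfl
  | succ k ih => rw [Function.iterate_succ_apply', ih, astep, h]

theorem halt_mono {n : ℕ} {c : AConfig M} {r : Bool} {k l : ℕ} (hkl : k ≤ l)
    (h : M.halt ((M.astep n)^[k] c).state = some r) :
    M.halt ((M.astep n)^[l] c).state = some r := by
  obtain ⟨d, rfl⟩ := Nat.exists_eq_add_of_le hkl
  rw [Nat.add_comm, Function.iterate_add_apply, astep_of_halt M h, h]

theorem DecidesWithin.mono {M : Machine I} {n : ℕ} {t : I} {a b : List Bool} {s s' : ℕ} {A : Prop}
    (h : M.DecidesWithin n t a b s A) (hs : s ≤ s') : M.DecidesWithin n t a b s' A := by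
  rw [decidesWithin_iff] at h ⊢
  obtain ⟨r, h1, h2⟩ := h
  exact ⟨r, halt_mono M hs h1, h2⟩

end Machine

/-- The predicate is decided by a machine with random access to `1ⁿ` in time linear in the
length of `n` and of the arguments. -/
def DecidableInLogtime {I : Type} (Θ : ℕ → I → List Bool → List Bool → Prop) : Prop :=
  ∃ (M : Machine I) (c : ℕ), ∀ n t a b,
    M.DecidesWithin n t a b (c * (len n + a.length + b.length + 1)) (Θ n t a b)

/-! ### Finite families of machines -/

section Sigma

variable {κ : Type} [Finite κ] {I : κ → Type} (M : ∀ q, Machine (I q))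

/-- The machines share the argument tapes and the index tape, while each one has work tapes of its
own. -/
def TapeId.sigma {ι : κ → Type} (q : κ) : TapeId (ι q) → TapeId (Σ q, ι q)
  | .argA => .argA
  | .argB => .argB
  | .index => .index
  | .work i => .work ⟨q, i⟩

/-- The machine which runs the `q`-th machine on arguments `⟨q, t⟩`. -/
noncomputable def Machine.sigma : Machine (Σ q, I q) where
  Q := Σ q, (M q).Q
  ι := Σ q, (M q).ι
  finite_Q := have := fun q => (M q).finite_Q; inferInstance
  finite_ι := have := fun q => (M q).finite_ι; inferInstance
  start t := ⟨t.1, (M t.1).start t.2⟩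
  halt s := (M s.1).halt s.2
  trans s r b :=
    let res := (M s.1).trans s.2 (fun i => r (TapeId.sigma s.1 i)) b
    (⟨s.1, res.1⟩, open Classical in fun
      | .argA => res.2 .argA
      | .argB => res.2 .argB
      | .index => res.2 .index
      | .work j => if h : j.1 = s.1 then res.2 (.work (h ▸ j.2)) else (r (.work j), .stay))

theorem Machine.sigma_astep (n : ℕ) (q : κ) (c : AConfig (M q)) (C : AConfig (Machine.sigma M))
    (hs : C.state = ⟨q, c.state⟩) (ht : ∀ i, C.tape (TapeId.sigma q i) = c.tape i) :
    ((Machine.sigma M).astep n C).state = ⟨q, ((M q).astep n c).state⟩ ∧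
      ∀ i, ((Machine.sigma M).astep n C).tape (TapeId.sigma q i) = ((M q).astep n c).tape i := by
  rcases C with ⟨S, T⟩
  simp only at hs ht
  subst hs
  unfold Machine.astep
  have hh : (Machine.sigma M).halt (⟨q, c.state⟩ : Σ q, (M q).Q) = (M q).halt c.state := rfl
  simp only [hh]
  cases h : (M q).halt c.state with
  | some r => exact ⟨rfl, ht⟩
  | none =>
    have hI := ht .index
    simp only [TapeId.sigma] at hI
    have hr : (fun i => (T (TapeId.sigma q i)).read) = fun i => (c.tape i).read := by
      funext i; rw [ht]
    simp only [Machine.sigma]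
    rw [hr]
    simp only [hI]
    refine ⟨trivial, fun i => ?_⟩
    rw [ht]
    cases i <;> simp [TapeId.sigma]

theorem Machine.sigma_iterate (n k : ℕ) (q : κ) (c : AConfig (M q))
    (C : AConfig (Machine.sigma M))
    (hs : C.state = ⟨q, c.state⟩) (ht : ∀ i, C.tape (TapeId.sigma q i) = c.tape i) :
    (((Machine.sigma M).astep n)^[k] C).state = ⟨q, (((M q).astep n)^[k] c).state⟩ := by
  induction k generalizing c C with
  | zero => exact hs
  | succ k ih =>
    obtain ⟨h1, h2⟩ := Machine.sigma_astep M n q c C hs ht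
    exact ih _ _ h1 h2

/-- The `q`-th summand of the state space simulates the `q`-th machine step by step; the sum of the
finitely many time constants serves for all of them. -/
theorem DecidableInLogtime.sigma {Θ : ∀ q, ℕ → I q → List Bool → List Bool → Prop}
    (h : ∀ q, DecidableInLogtime (Θ q)) :
    DecidableInLogtime (fun n (t : Σ q, I q) a b => Θ t.1 n t.2 a b) := by
  choose M c hM using h
  have : Fintype κ := Fintype.ofFinite κ
  refine ⟨Machine.sigma M, ∑ q, c q, fun n t a b => ?_⟩
  have h1 := (hM t.1 n t.2 a b).mono (s' := (∑ q, c q) * (len n + a.length + b.length + 1))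
    (Nat.mul_le_mul_right _ (Finset.single_le_sum (f := c) (fun _ _ => Nat.zero_le _)
      (Finset.mem_univ t.1)))
  rw [Machine.decidesWithin_iff] at h1 ⊢
  obtain ⟨r, h2, h3⟩ := h1
  refine ⟨r, ?_, h3⟩
  rw [Machine.sigma_iterate M n _ t.1 ((M t.1).ainit t.2 a b) _ rfl ?_]
  · exact h2
  · intro i
    cases i <;> rfl

end Sigma

/-! ### Comparison of a number with the length of the random access tape -/

/-- The machine which copies its first argument to the index tape. -/
def Machine.below : Machine Unit where
  Q := Option Bool
  ι := Empty
  finite_Q := inferInstance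
  finite_ι := inferInstance
  start _ := none
  halt q := q
  trans _ r b :=
    match r .argA with
    | none => (some b, fun i => (r i, .stay))
    | some x => (none, fun
      | .argA => (some x, .right)
      | .index => (some x, .right)
      | i => (r i, .stay))

@[simp] theorem ATape.act_read_stay (T : ATape) : T.act (T.read, .stay) = T := by
  simp [ATape.act, ATape.write, ATape.move, ATape.read]

theorem ATape.act_read (T : ATape) (m : Move) : T.act (T.read, m) = T.move m := by
  simp [ATape.act, ATape.write, ATape.read]

theorem Machine.below_iterate (n : ℕ) (a b : List Bool) (k : ℕ) (hk : k ≤ a.length) :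
    (Machine.below.astep n)^[k] (Machine.below.ainit () a b) = ⟨none, fun
      | .argA => ⟨k, fun i => a[i]?⟩
      | .index => ⟨k, fun i => (a.take k)[i]?⟩
      | .argB => ATape.ofList b⟩ := by
  induction k with
  | zero =>
    refine AConfig.ext rfl (funext fun i => ?_)
    rcases i with _ | _ | _ | i <;> simp [ATape.ofList, Machine.ainit]
    exact i.elim
  | succ k ih =>
    rw [Function.iterate_succ_apply', ih (by omega)]
    have hk' : k < a.length := hk
    simp only [Machine.astep, Machine.below, ATape.read, AConfig.mk.injEq]
    simp only [List.getElem?_eq_getElem hk']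
    refine ⟨trivial, ?_⟩
    funext i
    rcases i with _ | _ | _ | i
    · simp only [ATape.act, ATape.write, ATape.move, ATape.mk.injEq, true_and]
      funext i
      by_cases h : i = k
      · subst h; simp [hk']
      · simp [Function.update_of_ne h]
    · exact ATape.act_read_stay _
    · simp only [ATape.act, ATape.write, ATape.move, ATape.mk.injEq, true_and]
      funext i
      by_cases h : i = k
      · subst h; simp [hk']
      · rw [Function.update_of_ne h]
        simp only [List.getElem?_take]
        rcases lt_trichotomy i k with h' | h' | h'
        · simp [h', h'.trans (Nat.lt_succ_self k)]
        · exact absurd h' h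
        · rw [if_neg (by omega), if_neg (by omega)]
    · exact i.elim

/-- Once `a` has been copied to the index tape, the symbol seen on the random access tape is the
answer; it is taken when the blank after `a` is met. -/
theorem DecidableInLogtime.below :
    DecidableInLogtime (fun n (_ : Unit) a _ => Nat.ofDigits 2 (a.map Bool.toNat) < n) := by
  refine ⟨Machine.below, 1, fun n t a b => ?_⟩
  rw [Machine.decidesWithin_iff]
  refine ⟨decide (Nat.ofDigits 2 (a.map Bool.toNat) < n), ?_, by simp⟩
  refine Machine.halt_mono _ (k := a.length + 1) (by omega) ?_
  rw [Function.iterate_succ_apply', Machine.below_iterate n a b _ le_rfl]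
  simp only [Machine.astep, Machine.below, ATape.read]
  simp only [List.getElem?_eq_none le_rfl, Option.some.injEq, decide_eq_decide]
  rw [ATape.addr_of_list _ a (by simp)]

/-! ### Finite transducers -/

/-- A finite transducer with two input heads. The first head moves in every step, the second one
as told by `adv`; at the end it gives an answer or asks a query about the two outputs. -/
structure Transducer (I I' S : Type) where
  start : I → S
  δ : S → Option Bool → Option Bool → S
  adv : S → Bool
  outA : S → Option Bool → Option Bool → Option Bool
  outB : S → Option Bool → Option Bool → Option Bool
  fin : S → Option Bool → Option Bool → Bool ⊕ (I' × Bool)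

namespace Transducer

variable {I I' S : Type} (X : Transducer I I' S)

structure RunState (S : Type) where
  state : S
  posB : ℕ
  outA : List Bool
  outB : List Bool

def next (x y : Option Bool) (r : RunState S) : RunState S where
  state := X.δ r.state x y
  posB := r.posB + (X.adv r.state).toNat
  outA := r.outA ++ (X.outA r.state x y).toList
  outB := r.outB ++ (X.outB r.state x y).toList

/-- The first `k` steps. -/
def run (a b : List Bool) (t : I) : ℕ → RunState S
  | 0 => ⟨X.start t, 0, [], []⟩
  | k + 1 => X.next a[k]? b[(run a b t k).posB]? (run a b t k)

/-- The Boolean attached to a query is the answer that leads to acceptance, so that negated queries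
are possible. -/
def Accepts (Θ : ℕ → I' → List Bool → List Bool → Prop) (n T : ℕ) (t : I) (a b : List Bool) :
    Prop :=
  match X.fin (X.run a b t T).state a[T]? b[(X.run a b t T).posB]? with
  | .inl r => r = true
  | .inr q => (Θ n q.1 (X.run a b t T).outA (X.run a b t T).outB ↔ q.2 = true)

theorem outA_length_le (a b : List Bool) (t : I) (k : ℕ) :
    (X.run a b t k).outA.length ≤ k := by
  induction k with
  | zero => simp [run]
  | succ k ih =>
    simp only [run, next, List.length_append]
    have : (X.outA (X.run a b t k).state a[k]? b[(X.run a b t k).posB]?).toList.length ≤ 1 := by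
      cases X.outA (X.run a b t k).state a[k]? b[(X.run a b t k).posB]? <;> simp
    omega

theorem outB_length_le (a b : List Bool) (t : I) (k : ℕ) :
    (X.run a b t k).outB.length ≤ k := by
  induction k with
  | zero => simp [run]
  | succ k ih =>
    simp only [run, next, List.length_append]
    have : (X.outB (X.run a b t k).state a[k]? b[(X.run a b t k).posB]?).toList.length ≤ 1 := by
      cases X.outB (X.run a b t k).state a[k]? b[(X.run a b t k).posB]? <;> simp
    omega

/-! ### The machine of a transducer -/

/-- The phases of the run. In `scan k s`, `k` counts the steps already charged to the current mark;
in `back` and `run`, `g` is the answer to the query which leads to acceptance. -/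
inductive State (I I' S : Type) (W : ℕ) (Q : Type) : Type
  | init (t : I)
  | build (t : I)
  | scan (k : Fin W) (s : S)
  | back (t : I') (g : Bool)
  | run (g : Bool) (q : Q)
  | done (r : Bool)

instance {W : ℕ} {Q : Type} [Finite I] [Finite I'] [Finite S] [Finite Q] :
    Finite (State I I' S W Q) := by
  let φ : State I I' S W Q → I ⊕ I ⊕ (Fin W × S) ⊕ (I' × Bool) ⊕ (Bool × Q) ⊕ Bool
    | .init t => .inl t
    | .build t => .inr (.inl t)
    | .scan k s => .inr (.inr (.inl (k, s)))
    | .back t g => .inr (.inr (.inr (.inl (t, g))))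
    | .run g q => .inr (.inr (.inr (.inr (.inl (g, q)))))
    | .done r => .inr (.inr (.inr (.inr (.inr r))))
  refine Finite.of_injective φ ?_
  intro x y h
  cases x <;> cases y <;> simp_all [φ]

/-- The marks on `unary` limit the length of the scan. The scan leaves one mark per step on `clock`,
which later tells how long the heads have to move back. The leftmost cells of both tapes stay blank
as end markers. -/
inductive WorkTape (ι : Type) : Type
  | unary
  | clock
  | outA
  | outB
  | sub (i : ι)

instance {ι : Type} [Finite ι] : Finite (WorkTape ι) := by
  let φ : WorkTape ι → Fin 4 ⊕ ι
    | .unary => .inl 0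
    | .clock => .inl 1
    | .outA => .inl 2
    | .outB => .inl 3
    | .sub i => .inr i
  refine Finite.of_injective φ ?_
  intro x y h
  cases x <;> cases y <;> simp_all [φ]

/-- The tapes on which the machine answering the queries works. -/
def tapeOf {ι : Type} : TapeId ι → TapeId (WorkTape ι)
  | .argA => .work .outA
  | .argB => .work .outB
  | .index => .index
  | .work i => .work (.sub i)

def emit (r : Option Bool) : Option Bool → Option Bool × Move
  | none => (r, .stay)
  | some x => (some x, .right)

variable (M : Machine I') (W : ℕ) [NeZero W] [Finite I] [Finite I'] [Finite S]

/-- The machine which first writes `len n + 1` marks, then runs the transducer for `W` steps per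
mark, moves the heads on its outputs back and runs `M` on them. -/
def machine : Machine I where
  Q := State I I' S W M.Q
  ι := WorkTape M.ι
  finite_Q := have := M.finite_Q; inferInstance
  finite_ι := have := M.finite_ι; inferInstance
  start t := .init t
  halt
    | .run g q => (M.halt q).map (· == g)
    | .done r => some r
    | _ => none
  trans q r b :=
    match q with
    | .init t => (.build t, fun
      | .work .unary => (none, .right)
      | .work .clock => (none, .right)
      | i => (r i, .stay))
    | .build t =>
      -- With `j` ones on the index tape the address is `2 ^ j - 1`, which is less than `n` exactly
      -- for `j < len n`; so this loop is left after `len n` rounds.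
      if b then (.build t, fun
        | .index => (some true, .right)
        | .work .unary => (some true, .right)
        | i => (r i, .stay))
      else (.scan 0 (X.start t), fun
        | .work .unary => (some true, .stay)
        | i => (r i, .stay))
    | .scan k s =>
      match r (.work .unary) with
      | none =>
        match X.fin s (r .argA) (r .argB) with
        | .inl x => (.done x, fun i => (r i, .stay))
        | .inr (t, g) => (.back t g, fun
          | .work .clock => (r (.work .clock), .left)
          | .work .outA => (r (.work .outA), .left)
          | .work .outB => (r (.work .outB), .left)
          -- The ones left over from measuring `len n` are erased on the way back, because the
          -- machine for the query starts with a blank index tape.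
          | .index => (none, .left)
          | i => (r i, .stay))
      | some _ =>
        (if h : k.1 + 1 < W then .scan ⟨k.1 + 1, h⟩ (X.δ s (r .argA) (r .argB))
          else .scan 0 (X.δ s (r .argA) (r .argB)), fun
          | .work .unary => (r (.work .unary), if k.1 + 1 < W then .stay else .left)
          | .work .clock => (some true, .right)
          | .argA => (r .argA, .right)
          | .argB => (r .argB, if X.adv s then .right else .stay)
          | .work .outA => emit (r (.work .outA)) (X.outA s (r .argA) (r .argB))
          | .work .outB => emit (r (.work .outB)) (X.outB s (r .argA) (r .argB))
          | i => (r i, .stay))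
    | .back t g =>
      match r (.work .clock) with
      | none => (.run g (M.start t), fun i => (r i, .stay))
      | some _ => (.back t g, fun
        | .work .clock => (r (.work .clock), .left)
        | .work .outA => (r (.work .outA), .left)
        | .work .outB => (r (.work .outB), .left)
        | .index => (none, .left)
        | i => (r i, .stay))
    | .run g q =>
      let res := M.trans q (fun i => r (tapeOf i)) b
      (.run g res.1, fun
        | .work .outA => res.2 .argA
        | .work .outB => res.2 .argB
        | .index => res.2 .index
        | .work (.sub i) => res.2 (.work i)
        | i => (r i, .stay))
    | .done x => (.done x, fun i => (r i, .stay))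

theorem machine_run_astep (n : ℕ) (g : Bool) (c : AConfig M) (C : AConfig (X.machine M W))
    (hs : C.state = .run g c.state) (ht : ∀ i, C.tape (tapeOf i) = c.tape i) :
    ((X.machine M W).astep n C).state = .run g (M.astep n c).state ∧
      ∀ i, ((X.machine M W).astep n C).tape (tapeOf i) = (M.astep n c).tape i := by
  rcases C with ⟨s, T⟩
  simp only at hs ht
  subst hs
  unfold Machine.astep
  have hh : (X.machine M W).halt (.run g c.state) = (M.halt c.state).map (· == g) := rfl
  simp only [hh]
  cases h : M.halt c.state with
  | some r => exact ⟨rfl, ht⟩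
  | none =>
    have hI := ht .index
    simp only [tapeOf] at hI
    have hr : (fun i => (T (tapeOf i)).read) = fun i => (c.tape i).read := by
      funext i; rw [ht]
    simp only [machine, Option.map_none]
    rw [hr]
    simp only [hI]
    refine ⟨trivial, fun i => ?_⟩
    rw [ht]
    cases i <;> simp [tapeOf]

theorem machine_run_iterate (n k : ℕ) (g : Bool) (c : AConfig M) (C : AConfig (X.machine M W))
    (hs : C.state = .run g c.state) (ht : ∀ i, C.tape (tapeOf i) = c.tape i) :
    (((X.machine M W).astep n)^[k] C).state = .run g ((M.astep n)^[k] c).state := by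
  induction k generalizing c C with
  | zero => exact hs
  | succ k ih =>
    obtain ⟨h1, h2⟩ := X.machine_run_astep M W n g c C hs ht
    exact ih _ _ h1 h2

end Transducer

/-! ### The run of the machine of a transducer, phase by phase -/

namespace Transducer

variable {I I' S : Type} (X : Transducer I I' S)

/-- All tapes of the machine of a transducer, those of the machine answering queries being blank. -/
def tapes {ι : Type} (A B J U V oA oB : ATape) : TapeId (WorkTape ι) → ATape
  | .argA => A
  | .argB => B
  | .index => J
  | .work .unary => U
  | .work .clock => V
  | .work .outA => oA
  | .work .outB => oB
  | .work (.sub _) => ATape.ofList []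

/-- `m` ones from the leftmost cell on. -/
def ones (m : ℕ) (i : ℕ) : Option Bool := if i < m then some true else none

/-- A blank, followed by `m` ones. -/
def marks (m : ℕ) (i : ℕ) : Option Bool := if 0 < i ∧ i ≤ m then some true else none

theorem addr_ones (m : ℕ) : ATape.addr (ones m) = 2 ^ m - 1 := by
  rw [ATape.addr_of_list _ (List.replicate m true)]
  · rw [List.map_replicate]
    induction m with
    | zero => rfl
    | succ m ih =>
      rw [List.replicate_succ, Nat.ofDigits_cons, ih]
      have := Nat.one_le_two_pow (n := m)
      simp only [Bool.toNat_true]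
      rw [pow_succ]; omega
  · intro i hi
    simp only [List.length_replicate] at hi
    by_cases h : i < m <;> simp [ones, h]

theorem update_ones (m : ℕ) : Function.update (ones m) m (some true) = ones (m + 1) := by
  funext i
  by_cases h : i = m
  · subst h; simp [ones]
  · rw [Function.update_of_ne h]
    simp only [ones]
    congr 1
    simp only [eq_iff_iff]; omega

theorem update_marks (m : ℕ) : Function.update (marks m) (m + 1) (some true) = marks (m + 1) := by
  funext i
  by_cases h : i = m + 1
  · subst h; simp [marks]
  · rw [Function.update_of_ne h]
    simp only [marks]
    congr 1
    simp only [eq_iff_iff]; omega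

theorem update_ones_none (m : ℕ) : Function.update (ones (m + 1)) m none = ones m := by
  funext i
  by_cases h : i = m
  · subst h; simp [ones]
  · rw [Function.update_of_ne h]
    simp only [ones]
    congr 1
    simp only [eq_iff_iff]; omega

theorem act_emit (l : List Bool) (o : Option Bool) :
    (⟨l.length, fun i => l[i]?⟩ : ATape).act (emit (l[l.length]?) o)
      = ⟨(l ++ o.toList).length, fun i => (l ++ o.toList)[i]?⟩ := by
  cases o with
  | none =>
    simp only [emit, Option.toList_none, List.append_nil]
    exact ATape.act_read_stay ⟨l.length, fun i => l[i]?⟩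
  | some x =>
    simp only [emit, Option.toList_some, ATape.act, ATape.write, ATape.move, List.length_append,
      List.length_cons, List.length_nil, Nat.zero_add, ATape.mk.injEq, true_and]
    funext i
    by_cases h : i = l.length
    · subst h; simp
    · rw [Function.update_of_ne h]
      rcases lt_or_gt_of_ne h with h' | h'
      · rw [List.getElem?_append_left h']
      · rw [List.getElem?_eq_none h'.le, List.getElem?_eq_none]
        simp only [List.length_append, List.length_cons, List.length_nil]; omega

variable (M : Machine I') (W : ℕ) [NeZero W] [Finite I] [Finite I'] [Finite S]

theorem astep_of_halt_none {I : Type} (M : Machine I) (n : ℕ) (c : AConfig M)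
    (h : M.halt c.state = none) : M.astep n c =
      ⟨(M.trans c.state (fun i => (c.tape i).read)
          (decide (ATape.addr (c.tape .index).cell < n))).1,
        fun i => (c.tape i).act ((M.trans c.state (fun i => (c.tape i).read)
          (decide (ATape.addr (c.tape .index).cell < n))).2 i)⟩ := by
  unfold Machine.astep
  rw [h]

theorem machine_init_step (n : ℕ) (t : I) (a b : List Bool) :
    (X.machine M W).astep n ((X.machine M W).ainit t a b) = ⟨.build t,
      tapes (ATape.ofList a) (ATape.ofList b) ⟨0, ones 0⟩ ⟨1, marks 0⟩ ⟨1, marks 0⟩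
        (ATape.ofList []) (ATape.ofList [])⟩ := by
  rw [astep_of_halt_none _ _ _ rfl]
  refine AConfig.ext rfl (funext fun i => ?_)
  have h0 : Function.update (fun i => ([] : List Bool)[i]?) 0 none = marks 0 := by
    funext i
    by_cases h : i = 0
    · subst h; simp [marks]
    · rw [Function.update_of_ne h]
      simp [marks, Nat.pos_iff_ne_zero]
  rcases i with _ | _ | _ | (_ | _ | _ | _ | i)
  · exact ATape.act_read_stay _
  · exact ATape.act_read_stay _
  · refine (ATape.act_read_stay _).trans ?_
    simp only [Machine.ainit, ATape.ofList, tapes, ATape.mk.injEq, true_and]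
    funext i
    simp [ones]
  · simp only [Machine.ainit, ATape.ofList, tapes, machine, ATape.act, ATape.write, ATape.move, h0]
  · simp only [Machine.ainit, ATape.ofList, tapes, machine, ATape.act, ATape.write, ATape.move, h0]
  · exact ATape.act_read_stay _
  · exact ATape.act_read_stay _
  · exact ATape.act_read_stay _

theorem machine_build_step (n : ℕ) (t : I) (A B V oA oB : ATape) (j : ℕ) (hj : j < len n) :
    (X.machine M W).astep n ⟨.build t, tapes A B ⟨j, ones j⟩ ⟨j + 1, marks j⟩ V oA oB⟩ =
      ⟨.build t, tapes A B ⟨j + 1, ones (j + 1)⟩ ⟨j + 2, marks (j + 1)⟩ V oA oB⟩ := by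
  have hb : ATape.addr (ones j) < n := by
    rw [addr_ones]
    have := Nat.lt_size.1 hj
    have := Nat.one_le_two_pow (n := j)
    omega
  rw [astep_of_halt_none _ _ _ rfl]
  simp only [machine, tapes]
  simp only [hb, decide_true, if_true]
  refine AConfig.ext rfl (funext fun i => ?_)
  rcases i with _ | _ | _ | (_ | _ | _ | _ | i)
  · exact ATape.act_read_stay _
  · exact ATape.act_read_stay _
  · simp only [tapes, ATape.act, ATape.write, ATape.move, update_ones]
  · simp only [tapes, ATape.act, ATape.write, ATape.move, update_marks]
  · exact ATape.act_read_stay _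
  · exact ATape.act_read_stay _
  · exact ATape.act_read_stay _
  · exact ATape.act_read_stay _

theorem machine_build_last (n : ℕ) (t : I) (A B V oA oB : ATape) :
    (X.machine M W).astep n ⟨.build t, tapes A B ⟨len n, ones (len n)⟩
        ⟨len n + 1, marks (len n)⟩ V oA oB⟩ =
      ⟨.scan 0 (X.start t), tapes A B ⟨len n, ones (len n)⟩
        ⟨len n + 1, marks (len n + 1)⟩ V oA oB⟩ := by
  have hb : ¬ ATape.addr (ones (len n)) < n := by
    rw [addr_ones]
    have := Nat.lt_size_self n
    simp only [len]
    omega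
  rw [astep_of_halt_none _ _ _ rfl]
  simp only [machine, tapes]
  simp only [hb, decide_false]
  refine AConfig.ext rfl (funext fun i => ?_)
  rcases i with _ | _ | _ | (_ | _ | _ | _ | i)
  · exact ATape.act_read_stay _
  · exact ATape.act_read_stay _
  · exact ATape.act_read_stay _
  · simp [tapes, ATape.act, ATape.write, ATape.move, update_marks]
  · exact ATape.act_read_stay _
  · exact ATape.act_read_stay _
  · exact ATape.act_read_stay _
  · exact ATape.act_read_stay _

/-- The configuration after `j` steps of the scan, with `m` marks left, `k` steps of the current
mark being done. -/
def scanConfig (n : ℕ) (t : I) (a b : List Bool) (m : ℕ) (k : Fin W) (j : ℕ) :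
    AConfig (X.machine M W) :=
  ⟨.scan k (X.run a b t j).state,
    tapes ⟨j, fun i => a[i]?⟩ ⟨(X.run a b t j).posB, fun i => b[i]?⟩ ⟨len n, ones (len n)⟩
      ⟨m, marks (len n + 1)⟩ ⟨j + 1, marks j⟩
      ⟨(X.run a b t j).outA.length, fun i => (X.run a b t j).outA[i]?⟩
      ⟨(X.run a b t j).outB.length, fun i => (X.run a b t j).outB[i]?⟩⟩

theorem machine_build_iterate (n : ℕ) (t : I) (a b : List Bool) (j : ℕ) (hj : j ≤ len n) :
    ((X.machine M W).astep n)^[j + 1] ((X.machine M W).ainit t a b) = ⟨.build t,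
      tapes (ATape.ofList a) (ATape.ofList b) ⟨j, ones j⟩ ⟨j + 1, marks j⟩ ⟨1, marks 0⟩
        (ATape.ofList []) (ATape.ofList [])⟩ := by
  induction j with
  | zero =>
    rw [Function.iterate_succ_apply, machine_init_step]
    rfl
  | succ j ih =>
    rw [Function.iterate_succ_apply', ih (by omega), machine_build_step _ _ _ _ _ _ _ _ _ _ _ hj]

theorem machine_scan_start (n : ℕ) (t : I) (a b : List Bool) :
    ((X.machine M W).astep n)^[len n + 2] ((X.machine M W).ainit t a b) =
      X.scanConfig M W n t a b (len n + 1) 0 0 := by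
  rw [Function.iterate_succ_apply', machine_build_iterate _ _ _ _ _ _ _ _ le_rfl,
    machine_build_last]
  rfl

theorem machine_scan_step (n : ℕ) (t : I) (a b : List Bool) (m : ℕ) (k : Fin W) (j : ℕ)
    (hm : m + 1 ≤ len n + 1) :
    (X.machine M W).astep n (X.scanConfig M W n t a b (m + 1) k j) =
      if h : k.1 + 1 < W then X.scanConfig M W n t a b (m + 1) ⟨k.1 + 1, h⟩ (j + 1)
      else X.scanConfig M W n t a b m 0 (j + 1) := by
  rw [astep_of_halt_none _ _ _ rfl]
  have hU : marks (len n + 1) (m + 1) = some true := by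
    simp [marks]; omega
  by_cases h : k.1 + 1 < W
  all_goals
    simp only [h, dif_pos, dif_neg, not_false_eq_true]
    simp only [scanConfig, machine, tapes, ATape.read]
    simp only [hU, h, dif_pos, dif_neg, if_true, if_false, not_false_eq_true]
    refine AConfig.ext rfl (funext fun i => ?_)
    rcases i with _ | _ | _ | (_ | _ | _ | _ | i)
    · exact ATape.act_read ⟨j, fun i => a[i]?⟩ .right
    · simp only [tapes, run, next]
      refine (ATape.act_read ⟨_, _⟩ _).trans ?_
      cases X.adv (X.run a b t j).state <;> simp [ATape.move]
    · exact ATape.act_read_stay _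
    · simp only [tapes]
      rw [← hU]
      refine (ATape.act_read ⟨_, _⟩ _).trans ?_
      simp [ATape.move]
    · simp only [tapes, ATape.act, ATape.write, ATape.move, update_marks]
    · exact act_emit _ _
    · exact act_emit _ _
    · exact ATape.act_read_stay _

/-- Every mark pays for `W` steps, so the steps done plus those paid for by the remaining marks stay
constant up to the `k` steps by which the current mark has been used; this is the displayed
equation, and it forces `m = k = 0` at the end. -/
theorem machine_scan_iterate (n : ℕ) (t : I) (a b : List Bool) (j : ℕ) (hj : j ≤ W * (len n + 1)) :
    ∃ (m : ℕ) (k : Fin W), m ≤ len n + 1 ∧ j + W * m = W * (len n + 1) + k ∧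
      ((X.machine M W).astep n)^[len n + 2 + j] ((X.machine M W).ainit t a b) =
        X.scanConfig M W n t a b m k j := by
  induction j with
  | zero => exact ⟨len n + 1, 0, le_rfl, by simp, machine_scan_start _ _ _ _ _ _ _⟩
  | succ j ih =>
    obtain ⟨m, k, hm, h1, h2⟩ := ih (by omega)
    cases m with
    | zero => omega
    | succ m =>
      rw [← Nat.add_assoc, Function.iterate_succ_apply', h2, machine_scan_step _ _ _ _ _ _ _ _ _ _ hm]
      rw [Nat.mul_succ] at h1
      split_ifs with h
      · exact ⟨m + 1, ⟨k.1 + 1, h⟩, hm, by rw [Nat.mul_succ]; simp only; omega, rfl⟩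
      · refine ⟨m, 0, by omega, ?_, rfl⟩
        have := k.2
        simp only [Fin.val_zero]
        omega

theorem machine_scan_end (n : ℕ) (t : I) (a b : List Bool) :
    ((X.machine M W).astep n)^[len n + 2 + W * (len n + 1)] ((X.machine M W).ainit t a b) =
        X.scanConfig M W n t a b 0 0 (W * (len n + 1)) := by
  obtain ⟨m, k, hm, h1, h2⟩ := X.machine_scan_iterate M W n t a b _ le_rfl
  have hk := k.2
  have hm0 : m = 0 := by
    by_contra h
    have : W * 1 ≤ W * m := Nat.mul_le_mul_left _ (by omega)
    omega
  subst hm0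
  have hk0 : k = 0 := by
    apply Fin.ext
    simp only [Fin.val_zero]; omega
  rw [h2, hk0]

/-- The configuration while moving the heads on the outputs back. -/
def backConfig (n : ℕ) (t' : I') (g : Bool) (A B U : ATape) (oA oB : List Bool) (T j : ℕ) :
    AConfig (X.machine M W) :=
  ⟨.back t' g, tapes A B ⟨len n - (j + 1), ones (len n - j)⟩ U
      ⟨T - j, marks T⟩
      ⟨oA.length - (j + 1), fun i => oA[i]?⟩ ⟨oB.length - (j + 1), fun i => oB[i]?⟩⟩

/-- Truncated subtraction covers both phases: erasing the last one, and, when no ones are left,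
resting in cell `0` and writing a blank over a blank. -/
theorem act_erase_step (m j : ℕ) :
    (⟨m - (j + 1), ones (m - j)⟩ : ATape).act (none, .left)
      = ⟨m - (j + 1 + 1), ones (m - (j + 1))⟩ := by
  simp only [ATape.act, ATape.write, ATape.move, ATape.mk.injEq]
  refine ⟨by omega, ?_⟩
  by_cases h : j < m
  · obtain ⟨d, hd⟩ : ∃ d, m - j = d + 1 := ⟨m - j - 1, by omega⟩
    rw [show m - (j + 1) = d by omega, hd, update_ones_none]
  · rw [show m - (j + 1) = 0 by omega, show m - j = 0 by omega]
    funext i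
    by_cases h : i = 0
    · subst h; simp [ones]
    · rw [Function.update_of_ne h]

theorem machine_back_start (n : ℕ) (t : I) (a b : List Bool) (t' : I') (g : Bool) (T : ℕ)
    (hfin : X.fin (X.run a b t T).state a[T]? b[(X.run a b t T).posB]? = .inr (t', g)) :
    (X.machine M W).astep n (X.scanConfig M W n t a b 0 0 T) =
      X.backConfig M W n t' g ⟨T, fun i => a[i]?⟩ ⟨(X.run a b t T).posB, fun i => b[i]?⟩
        ⟨0, marks (len n + 1)⟩ (X.run a b t T).outA (X.run a b t T).outB T 0 := by
  rw [astep_of_halt_none _ _ _ rfl]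
  have hU : marks (len n + 1) 0 = none := by simp [marks]
  simp only [scanConfig, machine, tapes, ATape.read]
  simp only [hU, hfin]
  refine AConfig.ext rfl (funext fun i => ?_)
  rcases i with _ | _ | _ | (_ | _ | _ | _ | i)
  · exact ATape.act_read_stay _
  · exact ATape.act_read_stay _
  · simp only [tapes, ATape.act, ATape.write, ATape.move, backConfig, Nat.zero_add, Nat.sub_zero,
      ATape.mk.injEq, true_and]
    funext i
    by_cases h : i = len n
    · subst h; simp [ones]
    · rw [Function.update_of_ne h]
  · exact ATape.act_read_stay _
  · exact ATape.act_read ⟨T + 1, marks T⟩ .left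
  · exact ATape.act_read ⟨_, fun i => (X.run a b t T).outA[i]?⟩ .left
  · exact ATape.act_read ⟨_, fun i => (X.run a b t T).outB[i]?⟩ .left
  · exact ATape.act_read_stay _

theorem machine_back_step (n : ℕ) (t' : I') (g : Bool) (A B U : ATape) (oA oB : List Bool)
    (T j : ℕ) (hj : j < T) :
    (X.machine M W).astep n (X.backConfig M W n t' g A B U oA oB T j) =
      X.backConfig M W n t' g A B U oA oB T (j + 1) := by
  rw [astep_of_halt_none _ _ _ rfl]
  have hV : marks T (T - j) = some true := by simp [marks]; omega
  simp only [backConfig, machine, tapes, ATape.read]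
  simp only [hV]
  refine AConfig.ext rfl (funext fun i => ?_)
  rcases i with _ | _ | _ | (_ | _ | _ | _ | i)
  · exact ATape.act_read_stay _
  · exact ATape.act_read_stay _
  · exact act_erase_step _ _
  · exact ATape.act_read_stay _
  · simp only [tapes]
    rw [← hV]
    exact ATape.act_read _ _
  · exact ATape.act_read ⟨_, fun i => oA[i]?⟩ .left
  · exact ATape.act_read ⟨_, fun i => oB[i]?⟩ .left
  · exact ATape.act_read_stay _

theorem machine_back_iterate (n : ℕ) (t' : I') (g : Bool) (A B U : ATape) (oA oB : List Bool)
    (T j : ℕ) (hj : j ≤ T) :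
    ((X.machine M W).astep n)^[j] (X.backConfig M W n t' g A B U oA oB T 0) =
      X.backConfig M W n t' g A B U oA oB T j := by
  induction j with
  | zero => rfl
  | succ j ih =>
    rw [Function.iterate_succ_apply', ih (by omega), machine_back_step _ _ _ _ _ _ _ _ _ _ _ _ _ hj]

/-- `T` moves to the left bring all heads home because neither the index word nor an output is
longer than `T`; this is what the three bounds are for. -/
theorem machine_back_end (n : ℕ) (t' : I') (g : Bool) (A B U : ATape) (oA oB : List Bool)
    (T : ℕ) (hn : len n ≤ T) (hA : oA.length ≤ T) (hB : oB.length ≤ T) :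
    (X.machine M W).astep n (X.backConfig M W n t' g A B U oA oB T T) =
      ⟨.run g (M.start t'), tapes A B (ATape.ofList []) U ⟨0, marks T⟩ (ATape.ofList oA)
        (ATape.ofList oB)⟩ := by
  rw [astep_of_halt_none _ _ _ rfl]
  have hV : marks T (T - T) = none := by simp [marks]
  simp only [backConfig, machine, tapes, ATape.read]
  simp only [hV]
  refine AConfig.ext rfl (funext fun i => ?_)
  rcases i with _ | _ | _ | (_ | _ | _ | _ | i)
  · exact ATape.act_read_stay _
  · exact ATape.act_read_stay _
  · refine (ATape.act_read_stay _).trans ?_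
    simp only [tapes, ATape.ofList, ATape.mk.injEq]
    refine ⟨by omega, ?_⟩
    rw [show len n - T = 0 by omega]
    funext i; simp [ones]
  · exact ATape.act_read_stay _
  · refine (ATape.act_read_stay ⟨T - T, marks T⟩).trans ?_
    simp [tapes]
  · refine (ATape.act_read_stay _).trans ?_
    simp only [tapes, ATape.ofList, ATape.mk.injEq, and_true]
    omega
  · refine (ATape.act_read_stay _).trans ?_
    simp only [tapes, ATape.ofList, ATape.mk.injEq, and_true]
    omega
  · exact ATape.act_read_stay _

/-- The language of a transducer with queries to a predicate decidable in logarithmic time is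
decidable in logarithmic time. -/
theorem decidableInLogtime {Θ : ℕ → I' → List Bool → List Bool → Prop}
    (hΘ : DecidableInLogtime Θ) :
    DecidableInLogtime (fun n t a b => X.Accepts Θ n (W * (len n + 1)) t a b) := by
  obtain ⟨M, c, hM⟩ := hΘ
  -- `2 + W` pays for the marks and the scan, `1 + W + 1` for moving back and starting `M`, and `c *
  -- (2 * W + 1)` for the run of `M` on two outputs of length at most `W * (len n + 1)` each.
  refine ⟨X.machine M W, (2 + W) + (1 + W + 1 + c * (2 * W + 1)), fun n t a b => ?_⟩
  beta_reduce
  set T := W * (len n + 1) with hT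
  have hTn : len n ≤ T := by
    have : 1 * (len n + 1) ≤ W * (len n + 1) := Nat.mul_le_mul_right _ (NeZero.one_le)
    omega
  refine Machine.DecidesWithin.mono (s := (1 + (T + (1 +
    c * (len n + (X.run a b t T).outA.length + (X.run a b t T).outB.length + 1)))) +
      (len n + 2 + T)) ?_ ?_
  · rw [Machine.decidesWithin_iff]
    rw [Function.iterate_add_apply _ _ (len n + 2 + T), hT, machine_scan_end, ← hT]
    unfold Accepts
    cases hfin : X.fin (X.run a b t T).state a[T]? b[(X.run a b t T).posB]? with
    | inl r =>
      refine ⟨r, Machine.halt_mono _ (k := 1) (by omega) ?_, Iff.rfl⟩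
      rw [Function.iterate_one, astep_of_halt_none _ _ _ rfl]
      have hU : marks (len n + 1) 0 = none := by simp [marks]
      simp only [scanConfig, machine, tapes, ATape.read]
      simp only [hU, hfin]
    | inr q =>
      obtain ⟨t', g⟩ := q
      have h := hM n t' (X.run a b t T).outA (X.run a b t T).outB
      rw [Machine.decidesWithin_iff] at h
      obtain ⟨r, h1, h2⟩ := h
      refine ⟨r == g, ?_, ?_⟩
      · rw [Nat.add_comm 1, Function.iterate_succ_apply,
          machine_back_start _ _ _ _ _ _ _ _ _ _ hfin, Nat.add_comm T, Function.iterate_add_apply,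
          machine_back_iterate _ _ _ _ _ _ _ _ _ _ _ _ _ le_rfl, Nat.add_comm 1,
          Function.iterate_succ_apply, machine_back_end _ _ _ _ _ _ _ _ _ _ _ _ hTn
            (outA_length_le _ _ _ _ _) (outB_length_le _ _ _ _ _)]
        rw [X.machine_run_iterate M W n _ g
          (M.ainit t' (X.run a b t T).outA (X.run a b t T).outB) _ rfl]
        · show (M.halt _).map (· == g) = _
          rw [h1]; rfl
        · intro i
          cases i <;> rfl
      · simp only [← h2]
        cases r <;> cases g <;> simp
  · have h1 := X.outA_length_le a b t T
    have h2 := X.outB_length_le a b t T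
    have h3 : c * (len n + (X.run a b t T).outA.length + (X.run a b t T).outB.length + 1)
        ≤ c * ((2 * W + 1) * (len n + 1)) := by
      apply Nat.mul_le_mul_left
      rw [Nat.add_mul, Nat.one_mul, Nat.mul_assoc, ← hT]
      omega
    calc _ ≤ (1 + (T + (1 + c * ((2 * W + 1) * (len n + 1))))) + (len n + 2 + T) := by omega
      _ ≤ ((2 + W) + (1 + W + 1 + c * (2 * W + 1))) * (len n + 1) := by
        rw [hT]; ring_nf; omega
      _ ≤ _ := Nat.mul_le_mul_left _ (by omega)

end Transducer

/-! ### Regular functions of words -/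

def wordRun {B σ : Type} (δ : σ → B → σ) (s : σ) : ∀ N, (Fin N → B) → σ
  | 0, _ => s
  | N + 1, u => wordRun δ (δ s (u 0)) N (Fin.tail u)

theorem wordRun_eq_foldl {B σ : Type} (δ : σ → B → σ) (s : σ) (N : ℕ) (u : Fin N → B) :
    wordRun δ s N u = (List.ofFn u).foldl δ s := by
  induction N generalizing s with
  | zero => simp [wordRun]
  | succ N ih => rw [wordRun, ih, List.ofFn_succ, List.foldl_cons]; rfl

/-- A function of words is regular if it is a function of the state which a finite automaton
reaches on the word. -/
def RegFun {B τ : Type} (f : ∀ N, (Fin N → B) → τ) : Prop :=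
  ∃ (σ : Type) (_ : Finite σ) (s : σ) (δ : σ → B → σ) (F : σ → τ),
    ∀ N u, f N u = F (wordRun δ s N u)

namespace RegFun

variable {B B' τ τ' τ'' : Type}

theorem congr {f g : ∀ N, (Fin N → B) → τ} (hf : RegFun f) (h : ∀ N u, g N u = f N u) :
    RegFun g := by
  have : g = f := by funext N u; exact h N u
  rwa [this]

theorem congr_iff {f g : ∀ N, (Fin N → B) → Prop} (hf : RegFun f) (h : ∀ N u, g N u ↔ f N u) :
    RegFun g := hf.congr fun N u => propext (h N u)

theorem const (x : τ) : RegFun (fun N (_ : Fin N → B) => x) :=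
  ⟨Unit, inferInstance, (), fun _ _ => (), fun _ => x, fun _ _ => rfl⟩

theorem map {f : ∀ N, (Fin N → B) → τ} (hf : RegFun f) (g : τ → τ') :
    RegFun (fun N u => g (f N u)) := by
  obtain ⟨σ, hσ, s, δ, F, h⟩ := hf
  exact ⟨σ, hσ, s, δ, fun x => g (F x), fun N u => congrArg g (h N u)⟩

theorem wordRun_pi {ι : Type} {σ : ι → Type} (δ : ∀ i, σ i → B → σ i) (s : ∀ i, σ i) (N : ℕ)
    (u : Fin N → B) :
    wordRun (fun (x : ∀ i, σ i) b i => δ i (x i) b) s N u = fun i => wordRun (δ i) (s i) N u := by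
  induction N generalizing s with
  | zero => rfl
  | succ N ih => rw [wordRun, ih]; rfl

theorem pi {ι : Type} [Finite ι] {ρ : ι → Type} {f : ∀ i, ∀ N, (Fin N → B) → ρ i}
    (hf : ∀ i, RegFun (f i)) : RegFun (fun N u i => f i N u) := by
  choose σ hσ s δ F h using hf
  refine ⟨∀ i, σ i, inferInstance, s, fun x b i => δ i (x i) b, fun x i => F i (x i), ?_⟩
  intro N u
  rw [wordRun_pi]
  funext i
  exact h i N u

theorem map₂ {f : ∀ N, (Fin N → B) → τ} {g : ∀ N, (Fin N → B) → τ'} (hf : RegFun f)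
    (hg : RegFun g) (op : τ → τ' → τ'') : RegFun (fun N u => op (f N u) (g N u)) := by
  have := (pi (ι := Bool) (ρ := fun b => cond b τ τ')
    (f := fun b => match b with | true => f | false => g)
    (fun b => match b with | true => hf | false => hg)).map (fun x => op (x true) (x false))
  exact this

/-- The value of a regular function may select one of finitely many regular functions. -/
theorem bind {κ : Type} [Finite κ] {c : ∀ N, (Fin N → B) → κ} (hc : RegFun c)
    {f : κ → ∀ N, (Fin N → B) → τ} (hf : ∀ x, RegFun (f x)) :
    RegFun (fun N u => f (c N u) N u) :=
  hc.map₂ (pi hf) (fun x g => g x)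

theorem comap {f : ∀ N, (Fin N → B) → τ} (hf : RegFun f) (φ : B' → B) :
    RegFun (fun N (u : Fin N → B') => f N (fun t => φ (u t))) := by
  obtain ⟨σ, hσ, s, δ, F, h⟩ := hf
  refine ⟨σ, hσ, s, fun x b => δ x (φ b), F, fun N u => ?_⟩
  refine (h N _).trans (congrArg F ?_)
  clear h
  induction N generalizing s with
  | zero => rfl
  | succ N ih => rw [wordRun, wordRun, ← ih]; rfl

theorem and {f g : ∀ N, (Fin N → B) → Prop} (hf : RegFun f) (hg : RegFun g) :
    RegFun (fun N u => f N u ∧ g N u) := hf.map₂ hg And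

theorem or {f g : ∀ N, (Fin N → B) → Prop} (hf : RegFun f) (hg : RegFun g) :
    RegFun (fun N u => f N u ∨ g N u) := hf.map₂ hg Or

theorem not {f : ∀ N, (Fin N → B) → Prop} (hf : RegFun f) : RegFun (fun N u => ¬ f N u) :=
  hf.map Not

/-- `Prop` itself is the finite set of states; the state says whether all letters so far satisfy
`p`. -/
theorem forall_letter (p : B → Prop) : RegFun (fun N (u : Fin N → B) => ∀ t, p (u t)) := by
  refine ⟨Prop, inferInstance, True, fun s b => s ∧ p b, id, fun N u => propext ?_⟩
  suffices h : ∀ q : Prop, (q ∧ ∀ t, p (u t)) ↔ wordRun (fun s b => s ∧ p b) q N u by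
    simpa using h True
  induction N with
  | zero => intro q; simp [wordRun]
  | succ N ih =>
    intro q
    rw [wordRun, ← ih, Fin.forall_fin_succ, and_assoc]
    rfl

theorem exists_letter (p : B → Prop) : RegFun (fun N (u : Fin N → B) => ∃ t, p (u t)) :=
  (forall_letter (fun b => ¬ p b)).not.congr_iff fun _ _ => by push Not; rfl

/-- Two letterwise images of the word agree. -/
theorem eq_tracks {D : Type} (g h : B → D) :
    RegFun (fun N (u : Fin N → B) => (fun t => g (u t)) = fun t => h (u t)) :=
  (forall_letter (fun b => g b = h b)).congr_iff fun _ _ => funext_iff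

end RegFun

/-- A map from words to words of the same length is automatic if its graph is regular. -/
def AutFun {A B : Type} (φ : ∀ N, (Fin N → A) → (Fin N → B)) : Prop :=
  RegFun (fun N (w : Fin N → A × B) => φ N (fun t => (w t).1) = fun t => (w t).2)

namespace AutFun

variable {A A' B C : Type}

theorem letters (g : A → B) : AutFun (fun N (u : Fin N → A) t => g (u t)) :=
  RegFun.eq_tracks (fun w : A × B => g w.1) (fun w => w.2)

theorem id : AutFun (fun N (u : Fin N → A) => u) := letters (fun a => a)

/-- The graph relation between two letterwise images of a word. -/
theorem graph {φ : ∀ N, (Fin N → A) → (Fin N → B)} (hφ : AutFun φ) (g : C → A) (h : C → B) :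
    RegFun (fun N (u : Fin N → C) => φ N (fun t => g (u t)) = fun t => h (u t)) :=
  RegFun.comap hφ (fun c => (g c, h c))

theorem pre {φ : ∀ N, (Fin N → A) → (Fin N → B)} (hφ : AutFun φ) (g : A' → A) :
    AutFun (fun N (u : Fin N → A') => φ N (fun t => g (u t))) :=
  hφ.graph (fun w : A' × B => g w.1) (fun w => w.2)

/-- By injectivity a letter of the second track in the range of `g` determines the letter of `B`
which it comes from, so the graph of `φ` can be tested on the pulled-back track. Without injectivity
that letter would have to be guessed. -/
theorem post {φ : ∀ N, (Fin N → A) → (Fin N → B)} (hφ : AutFun φ) {g : B → C}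
    (hg : Function.Injective g) : AutFun (fun N (u : Fin N → A) t => g (φ N u t)) := by
  by_cases hB : Nonempty B
  · have h1 := hφ.graph (C := A × C) Prod.fst (fun w => Function.invFun g w.2)
    have h2 := RegFun.forall_letter (B := A × C) (fun w => w.2 ∈ Set.range g)
    refine (h1.and h2).congr_iff fun N w => ?_
    constructor
    · intro h
      rw [funext_iff] at h
      refine ⟨?_, fun t => ⟨_, h t⟩⟩
      funext t
      rw [← h t, Function.leftInverse_invFun hg]
    · rintro ⟨h1, h2⟩
      funext t
      beta_reduce
      rw [h1]
      exact Function.invFun_eq (h2 t)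
  · refine (RegFun.const True).congr_iff fun N w => ?_
    simp only [iff_true]
    funext t
    exact absurd ⟨φ N (fun t => (w t).1) t⟩ hB

theorem pair {φ : ∀ N, (Fin N → A) → (Fin N → B)} {ψ : ∀ N, (Fin N → A) → (Fin N → C)}
    (hφ : AutFun φ) (hψ : AutFun ψ) : AutFun (fun N u t => (φ N u t, ψ N u t)) := by
  have h1 := hφ.graph (C := A × B × C) Prod.fst (fun w => w.2.1)
  have h2 := hψ.graph (C := A × B × C) Prod.fst (fun w => w.2.2)
  refine (h1.and h2).congr_iff fun N w => ?_
  simp only [funext_iff, Prod.ext_iff, forall_and]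

theorem bind {κ : Type} [Finite κ] {c : ∀ N, (Fin N → A) → κ} (hc : RegFun c)
    {φ : κ → ∀ N, (Fin N → A) → (Fin N → B)} (hφ : ∀ x, AutFun (φ x)) :
    AutFun (fun N u => φ (c N u) N u) :=
  RegFun.bind (hc.comap Prod.fst) hφ

end AutFun

/-! ### Languages of encoded words -/

section Encoding

variable {Γ : Type} {w : ℕ} (enc : Γ → Fin w → Bool)

/-- The encoding of a word, `w` bits per letter. -/
def encodeWord {N : ℕ} (u : Fin N → Γ) : List Bool :=
  (List.ofFn fun t => List.ofFn (enc (u t))).flatten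

open Classical in
/-- The letter with the given code. -/
noncomputable def decodeLetter (l : List (Option Bool)) : Option Γ :=
  if h : ∃ g, l = List.ofFn (fun i => some (enc g i)) then some h.choose else none

theorem decodeLetter_enc (henc : Function.Injective enc) (g : Γ) :
    decodeLetter enc (List.ofFn (fun i => some (enc g i))) = some g := by
  have h : ∃ g', List.ofFn (fun i => some (enc g i)) = List.ofFn (fun i => some (enc g' i)) :=
    ⟨g, rfl⟩
  unfold decodeLetter
  rw [dif_pos h]
  have h' := List.ofFn_injective h.choose_spec
  congr 1
  apply henc
  funext i
  exact (Option.some_injective _ (congrFun h' i)).symm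

theorem eq_of_decodeLetter {l : List (Option Bool)} {g : Γ} (h : decodeLetter enc l = some g) :
    l = List.ofFn (fun i => some (enc g i)) := by
  unfold decodeLetter at h
  split_ifs at h with h'
  have := h'.choose_spec
  rwa [Option.some_injective _ h] at this

/-- The `s`-th block of `w` bits. -/
def block (w : ℕ) (a : List Bool) (s : ℕ) : List (Option Bool) :=
  List.ofFn fun i : Fin w => a[w * s + i]?

theorem encodeWord_length {N : ℕ} (u : Fin N → Γ) : (encodeWord enc u).length = w * N := by
  simp [encodeWord, List.length_flatten, List.map_ofFn, Function.comp_def,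
    Nat.mul_comm]

theorem encodeWord_succ {N : ℕ} (u : Fin (N + 1) → Γ) :
    encodeWord enc u = List.ofFn (enc (u 0)) ++ encodeWord enc (Fin.tail u) := by
  simp only [encodeWord, List.ofFn_succ, List.flatten_cons]
  rfl

theorem encodeWord_getElem? {N : ℕ} (u : Fin N → Γ) (s : Fin N) (i : Fin w) :
    (encodeWord enc u)[w * s + i]? = some (enc (u s) i) := by
  induction N with
  | zero => exact s.elim0
  | succ N ih =>
    rw [encodeWord_succ]
    refine Fin.cases ?_ (fun s => ?_) s
    · rw [List.getElem?_append_left (by simp)]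
      simp
    · rw [List.getElem?_append_right (by
        simp only [List.length_ofFn, Fin.val_succ, Nat.mul_succ]; omega)]
      refine Eq.trans ?_ (ih (Fin.tail u) s)
      congr 1
      simp only [List.length_ofFn, Fin.val_succ, Nat.mul_succ]; omega

theorem block_encodeWord {N : ℕ} (u : Fin N → Γ) (s : Fin N) :
    block w (encodeWord enc u) s = List.ofFn (fun i => some (enc (u s) i)) := by
  unfold block
  congr 1
  funext i
  exact encodeWord_getElem? enc u s i

/-- An upper bound for the length is enough: the conditions on the blocks already force all bits
below `w * N` to be present. -/
theorem eq_encodeWord_iff [NeZero w] {N : ℕ} (u : Fin N → Γ) (a : List Bool) :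
    a = encodeWord enc u ↔ a.length ≤ w * N ∧
      ∀ s : Fin N, block w a s = List.ofFn (fun i => some (enc (u s) i)) := by
  constructor
  · rintro rfl
    exact ⟨(encodeWord_length enc u).le, block_encodeWord enc u⟩
  · rintro ⟨h1, h2⟩
    apply List.ext_getElem?
    intro j
    by_cases hj : j < w * N
    · have hs : j / w < N := Nat.div_lt_of_lt_mul hj
      have hi : j % w < w := Nat.mod_lt _ (NeZero.pos w)
      have h3 := congrFun (List.ofFn_injective (h2 ⟨j / w, hs⟩)) ⟨j % w, hi⟩
      have h4 := encodeWord_getElem? enc u ⟨j / w, hs⟩ ⟨j % w, hi⟩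
      simp only [Nat.div_add_mod] at h3 h4
      rw [h3, h4]
    · rw [List.getElem?_eq_none (by omega), List.getElem?_eq_none (by
        rw [encodeWord_length]; omega)]

theorem encodeWord_injective [NeZero w] (henc : Function.Injective enc) (N : ℕ) :
    Function.Injective (encodeWord enc : (Fin N → Γ) → List Bool) := by
  intro u v h
  funext s
  have h1 := block_encodeWord enc u s
  rw [h, block_encodeWord] at h1
  apply henc
  funext i
  exact (Option.some_injective _ (congrFun (List.ofFn_injective h1) i)).symm

/-- The second argument as read along with the letters of the first: a letter each (`fast`) or one
bit each. -/
noncomputable def argLetter (fast : Bool) (b : List Bool) (s : ℕ) : Option Γ × Option Bool :=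
  if fast then (decodeLetter enc (block w b s), none) else (none, b[s]?)

/-- The letters read along with the first argument cover only an initial part of `b`; this excludes
further bits. -/
def argFits (w : ℕ) (fast : Bool) (b : List Bool) (N : ℕ) : Prop :=
  b.length ≤ if fast then w * N else N

end Encoding

/-- A predicate on pairs of words, decided by a finite automaton and at most one query. -/
structure Classifier (I I' Γ : Type) where
  fast : I → Bool
  cls : I → ∀ N, (Fin N → Γ × (Option Γ × Option Bool)) → Prop → Bool ⊕ (I' × Bool)
  outA : I → Γ × (Option Γ × Option Bool) → Option Bool
  outB : I → Γ × (Option Γ × Option Bool) → Option Bool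
  regular : ∀ t, RegFun (cls t)

namespace Classifier

variable {I I' Γ : Type} (X : Classifier I I' Γ) {w : ℕ} (enc : Γ → Fin w → Bool)

def AcceptsWord (Θ : ℕ → I' → List Bool → List Bool → Prop) (n : ℕ) (t : I) {N : ℕ}
    (v : Fin N → Γ × (Option Γ × Option Bool)) (fits : Prop) : Prop :=
  match X.cls t N v fits with
  | .inl r => r = true
  | .inr q => (Θ n q.1 (List.ofFn fun s => X.outA t (v s)).reduceOption
      (List.ofFn fun s => X.outB t (v s)).reduceOption ↔ q.2 = true)

/-- The language of the classifier on encoded words. -/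
def Accepts (Θ : ℕ → I' → List Bool → List Bool → Prop) (n N : ℕ) (t : I) (a b : List Bool) :
    Prop :=
  ∃ u : Fin N → Γ, a = encodeWord enc u ∧
    X.AcceptsWord Θ n t (fun s => (u s, argLetter enc (X.fast t) b s)) (argFits w (X.fast t) b N)

abbrev Buffer (w : ℕ) : Type := {l : List (Option Bool × Option Bool) // l.length < w}

/-- If the second argument is read one bit per letter, its head moves on only after the first step
of a block, so the bit belonging to the letter is in the first entry of the buffer. -/
noncomputable def bufLetter (fast : Bool) (l : List (Option Bool × Option Bool)) :
    Option Γ × Option Bool :=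
  if fast then (decodeLetter enc (l.map Prod.snd), none) else (none, l.head?.bind Prod.snd)

variable {σ : Type} (s₀ : σ) (δ : σ → Γ × (Option Γ × Option Bool) → σ)
  (F : σ → I → Prop → Bool ⊕ (I' × Bool))

/-- The transducer of a classifier, which collects the letters bit by bit. -/
noncomputable def transducer [NeZero w] :
    Transducer I I' (I × Option σ × Buffer w) where
  start t := (t, some s₀, ⟨[], NeZero.pos w⟩)
  δ s x y :=
    let l := s.2.2.1 ++ [(x, y)]
    if h : l.length < w then (s.1, s.2.1, ⟨l, h⟩)
    else (s.1, s.2.1.bind fun q => (decodeLetter enc (l.map Prod.fst)).map fun g =>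
      δ q (g, bufLetter enc (X.fast s.1) l), ⟨[], NeZero.pos w⟩)
  adv s := X.fast s.1 || s.2.2.1.isEmpty
  outA s x y :=
    let l := s.2.2.1 ++ [(x, y)]
    if l.length < w then none
    else (decodeLetter enc (l.map Prod.fst)).bind fun g =>
      X.outA s.1 (g, bufLetter enc (X.fast s.1) l)
  outB s x y :=
    let l := s.2.2.1 ++ [(x, y)]
    if l.length < w then none
    else (decodeLetter enc (l.map Prod.fst)).bind fun g =>
      X.outB s.1 (g, bufLetter enc (X.fast s.1) l)
  fin s x y :=
    match s.2.1, x with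
    | some q, none => F q s.1 (y = none)
    | _, _ => .inl false

variable [NeZero w]

/-- The transducer after `s` letters. -/
noncomputable def stateAfter (t : I) (a b : List Bool) : ℕ → Option σ
  | 0 => some s₀
  | s + 1 => (stateAfter t a b s).bind fun q => (decodeLetter enc (block w a s)).map fun g =>
      δ q (g, argLetter enc (X.fast t) b s)

noncomputable def outAfter (out : I → Γ × (Option Γ × Option Bool) → Option Bool) (t : I)
    (a b : List Bool) : ℕ → List Bool
  | 0 => []
  | s + 1 => outAfter out t a b s ++ ((decodeLetter enc (block w a s)).bind fun g =>
      out t (g, argLetter enc (X.fast t) b s)).toList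

def posAfter (w : ℕ) (fast : Bool) (s k : ℕ) : ℕ := if fast then w * s + k else s + min k 1

def bufAfter (w : ℕ) (fast : Bool) (a b : List Bool) (s k : ℕ) :
    List (Option Bool × Option Bool) :=
  (List.range k).map fun i => (a[w * s + i]?, b[posAfter w fast s i]?)

omit [NeZero w] in
theorem bufAfter_map_fst (fast : Bool) (a b : List Bool) (s : ℕ) :
    (bufAfter w fast a b s w).map Prod.fst = block w a s := by
  simp only [bufAfter, block, List.map_map, Function.comp_def]
  apply List.ext_getElem <;> simp

theorem bufLetter_bufAfter (fast : Bool) (a b : List Bool) (s : ℕ) :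
    bufLetter enc fast (bufAfter w fast a b s w) = argLetter enc fast b s := by
  unfold bufLetter argLetter
  cases fast with
  | true =>
    simp only [if_true]
    congr 2
    simp only [bufAfter, block, List.map_map, Function.comp_def, posAfter, if_true]
    apply List.ext_getElem <;> simp
  | false =>
    simp only [Bool.false_eq_true, if_false]
    congr 1
    obtain ⟨d, hd⟩ : ∃ d, w = d + 1 := Nat.exists_eq_succ_of_ne_zero (NeZero.ne w)
    simp [bufAfter, hd, List.range_succ_eq_map, posAfter]

theorem transducer_run_aux (t : I) (a b : List Bool) (s : ℕ)
    (hs : (X.transducer enc s₀ δ F).run a b t (w * s) =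
      ⟨(t, X.stateAfter enc s₀ δ t a b s, ⟨[], NeZero.pos w⟩), posAfter w (X.fast t) s 0,
        X.outAfter enc X.outA t a b s, X.outAfter enc X.outB t a b s⟩) (k : ℕ) (hk : k < w) :
    (X.transducer enc s₀ δ F).run a b t (w * s + k) =
      ⟨(t, X.stateAfter enc s₀ δ t a b s, ⟨bufAfter w (X.fast t) a b s k, by simpa [bufAfter]⟩),
        posAfter w (X.fast t) s k,
        X.outAfter enc X.outA t a b s, X.outAfter enc X.outB t a b s⟩ := by
  induction k with
  | zero => exact hs
  | succ k ih =>
    have hb : bufAfter w (X.fast t) a b s k ++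
        [(a[w * s + k]?, b[posAfter w (X.fast t) s k]?)] = bufAfter w (X.fast t) a b s (k + 1) := by
      simp [bufAfter, List.range_succ]
    have hl : (bufAfter w (X.fast t) a b s (k + 1)).length < w := by simpa [bufAfter] using hk
    rw [← Nat.add_assoc, Transducer.run, ih (by omega)]
    simp only [Transducer.next, transducer, hb, hl, dif_pos, if_true, Option.toList_none,
      List.append_nil]
    congr 1
    unfold posAfter
    cases X.fast t with
    | true => simp; omega
    | false =>
      cases k with
      | zero => simp [bufAfter]
      | succ k => simp [bufAfter, List.range_succ]

theorem transducer_run (t : I) (a b : List Bool) (s : ℕ) :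
    (X.transducer enc s₀ δ F).run a b t (w * s) =
      ⟨(t, X.stateAfter enc s₀ δ t a b s, ⟨[], NeZero.pos w⟩), posAfter w (X.fast t) s 0,
        X.outAfter enc X.outA t a b s, X.outAfter enc X.outB t a b s⟩ := by
  induction s with
  | zero =>
    simp [Transducer.run, transducer, stateAfter, outAfter, posAfter]
  | succ s ih =>
    obtain ⟨d, hd⟩ : ∃ d, w = d + 1 := Nat.exists_eq_succ_of_ne_zero (NeZero.ne w)
    have h1 := X.transducer_run_aux enc s₀ δ F t a b s ih d (by omega)
    have hb : bufAfter w (X.fast t) a b s d ++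
        [(a[w * s + d]?, b[posAfter w (X.fast t) s d]?)] = bufAfter w (X.fast t) a b s w := by
      conv_rhs => rw [hd]
      simp [bufAfter, List.range_succ, hd]
    have hl : ¬ (bufAfter w (X.fast t) a b s w).length < w := by simp [bufAfter]
    rw [show w * (s + 1) = w * s + d + 1 by rw [Nat.mul_succ]; omega, Transducer.run, h1]
    simp only [Transducer.next, transducer, hb, hl, dif_neg, if_false, not_false_eq_true,
      bufAfter_map_fst, bufLetter_bufAfter]
    congr 1
    unfold posAfter
    cases X.fast t with
    | true => simp [Nat.mul_succ]; omega
    | false =>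
      cases d with
      | zero => simp [bufAfter]
      | succ k => simp [bufAfter, List.range_succ]

omit [NeZero w] in
theorem stateAfter_of_decode {t : I} {a b : List Bool} (L : ℕ → Γ × (Option Γ × Option Bool))
    (N : ℕ) (hL : ∀ s < N, decodeLetter enc (block w a s) = some (L s).1 ∧
      (L s).2 = argLetter enc (X.fast t) b s) :
    X.stateAfter enc s₀ δ t a b N = some (((List.range N).map L).foldl δ s₀) := by
  induction N with
  | zero => rfl
  | succ N ih =>
    rw [stateAfter, ih (fun s hs => hL s (by omega)), (hL N (by omega)).1, ← (hL N (by omega)).2,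
      List.range_succ, List.map_append, List.foldl_append]
    rfl

omit [NeZero w] in
theorem outAfter_of_decode (out : I → Γ × (Option Γ × Option Bool) → Option Bool)
    {t : I} {a b : List Bool} (L : ℕ → Γ × (Option Γ × Option Bool))
    (N : ℕ) (hL : ∀ s < N, decodeLetter enc (block w a s) = some (L s).1 ∧
      (L s).2 = argLetter enc (X.fast t) b s) :
    X.outAfter enc out t a b N = ((List.range N).map fun s => out t (L s)).reduceOption := by
  induction N with
  | zero => rfl
  | succ N ih =>
    rw [outAfter, ih (fun s hs => hL s (by omega)), (hL N (by omega)).1, ← (hL N (by omega)).2,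
      List.range_succ, List.map_append, List.reduceOption_append]
    congr 1

omit [NeZero w] in
theorem decode_of_stateAfter {t : I} {a b : List Bool} (N : ℕ)
    (h : X.stateAfter enc s₀ δ t a b N ≠ none) :
    ∀ s < N, ∃ g, decodeLetter enc (block w a s) = some g := by
  induction N with
  | zero => intro s hs; omega
  | succ N ih =>
    intro s hs
    rw [stateAfter] at h
    rcases Nat.lt_succ_iff_lt_or_eq.1 hs with hs | rfl
    · refine ih (fun h0 => h ?_) s hs
      rw [h0]; rfl
    · by_contra h0
      push Not at h0
      rw [Option.eq_none_iff_forall_ne_some.2 h0] at h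
      apply h
      cases X.stateAfter enc s₀ δ t a b s <;> rfl

/-- The language of a classifier is decidable in logarithmic time. -/
theorem decidableInLogtime [Finite I] [Finite I'] [Finite Γ] (henc : Function.Injective enc)
    {Θ : ℕ → I' → List Bool → List Bool → Prop} (hΘ : DecidableInLogtime Θ)
    (c : ℕ) [NeZero c] :
    DecidableInLogtime (fun n t a b => X.Accepts enc Θ n (c * (len n + 1)) t a b) := by
  -- A single automaton handles all types `t` and both values of `fits`; these are needed only when
  -- the final state is evaluated.
  obtain ⟨σ, hσ, s₀, δ, F, hF⟩ := RegFun.pi X.regular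
  have hfin : Finite (Buffer w) := by
    have := List.finite_length_lt (Option Bool × Option Bool) w
    exact this
  have hmain := (X.transducer enc s₀ δ F).decidableInLogtime (w * c) hΘ
  obtain ⟨M, C, hM⟩ := hmain
  refine ⟨M, C, fun n t a b => ?_⟩
  convert hM n t a b using 1
  beta_reduce
  set N := c * (len n + 1) with hN
  have hNpos : 0 < N := Nat.mul_pos (NeZero.pos c) (by omega)
  rw [Nat.mul_assoc, ← hN]
  simp only [Transducer.Accepts, transducer_run]
  have hfits : (b[posAfter w (X.fast t) N 0]? = none) = argFits w (X.fast t) b N := by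
    rw [List.getElem?_eq_none_iff, argFits, posAfter]
    cases X.fast t <;> simp
  by_cases ha : ∃ u : Fin N → Γ, a = encodeWord enc u
  · obtain ⟨u, rfl⟩ := ha
    set v : Fin N → Γ × (Option Γ × Option Bool) :=
      fun s => (u s, argLetter enc (X.fast t) b s) with hv
    let L : ℕ → Γ × (Option Γ × Option Bool) := fun s =>
      if h : s < N then v ⟨s, h⟩ else v ⟨0, hNpos⟩
    have hL : ∀ s < N, decodeLetter enc (block w (encodeWord enc u) s) = some (L s).1 ∧
        (L s).2 = argLetter enc (X.fast t) b s := by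
      intro s hs
      have := block_encodeWord enc u ⟨s, hs⟩
      simp only at this
      rw [this, decodeLetter_enc enc henc]
      simp [L, hs, hv]
    have hofFn : ∀ {D : Type} (f : Γ × (Option Γ × Option Bool) → D),
        (List.range N).map (fun s => f (L s)) = List.ofFn (fun s => f (v s)) := by
      intro D f
      apply List.ext_getElem
      · simp
      · intro i h1 h2
        simp only [List.length_ofFn] at h2
        simp [L, h2]
    rw [X.stateAfter_of_decode enc s₀ δ L N hL, X.outAfter_of_decode enc X.outA L N hL,
      X.outAfter_of_decode enc X.outB L N hL, hofFn, hofFn]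
    have h1 := hofFn id
    simp only [id] at h1
    have ha : (encodeWord enc u)[w * N]? = none :=
      List.getElem?_eq_none (encodeWord_length enc u).le
    rw [ha]
    simp only [transducer]
    simp only [h1]
    rw [← wordRun_eq_foldl, hfits, ← congrFun (hF N v) t]
    have h2 : X.Accepts enc Θ n N t (encodeWord enc u) b ↔
        X.AcceptsWord Θ n t v (argFits w (X.fast t) b N) := by
      constructor
      · rintro ⟨u', h3, h4⟩
        rw [← encodeWord_injective enc henc N h3] at h4
        exact h4
      · intro h
        exact ⟨u, rfl, h⟩
    rw [h2]
    unfold AcceptsWord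
    rfl
  · have hnot : ¬ X.Accepts enc Θ n N t a b := fun ⟨u, h, _⟩ => ha ⟨u, h⟩
    -- A string which encodes no word of length `N` has a block that does not decode or a bit beyond
    -- `w * N`; in both cases the transducer rejects without a query.
    have hq : X.stateAfter enc s₀ δ t a b N = none ∨ a[w * N]? ≠ none := by
      by_contra! h
      apply ha
      choose u hu using X.decode_of_stateAfter enc s₀ δ N h.1
      refine ⟨fun s => u s s.2, (eq_encodeWord_iff enc _ _).2 ⟨by simpa using h.2, fun s => ?_⟩⟩
      exact eq_of_decodeLetter enc (hu s s.2)
    have hr : (X.transducer enc s₀ δ F).fin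
        (t, X.stateAfter enc s₀ δ t a b N, ⟨[], NeZero.pos w⟩) a[w * N]?
          b[posAfter w (X.fast t) N 0]? = .inl false := by
      simp only [transducer]
      rcases hq with h | h
      · rw [h]
      · cases h1 : a[w * N]? with
        | none => exact absurd h1 h
        | some x => cases X.stateAfter enc s₀ δ t a b N <;> rfl
    rw [hr]
    simp [hnot]

end Classifier

/-! ### Partial letter maps and constant words -/

open Classical in
/-- The letterwise image under a partial map, if it is defined on all letters. -/
noncomputable def mapOpt {C A : Type} (p : C → Option A) {N : ℕ} (w : Fin N → C) :
    Option (Fin N → A) :=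
  if h : ∀ t, (p (w t)).isSome then some (fun t => (p (w t)).get (h t)) else none

theorem mapOpt_eq_some_iff {C A : Type} {p : C → Option A} {N : ℕ} {w : Fin N → C}
    {v : Fin N → A} : mapOpt p w = some v ↔ ∀ t, p (w t) = some (v t) := by
  unfold mapOpt
  split_ifs with h
  · rw [Option.some_inj, funext_iff]
    refine forall_congr' fun t => ?_
    rw [← Option.some_inj, Option.some_get]
  · simp only [false_iff]
    exact fun h' => h fun t => by rw [h' t]; rfl

theorem mapOpt_eq_none_iff {C A : Type} {p : C → Option A} {N : ℕ} {w : Fin N → C} :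
    mapOpt p w = none ↔ ∃ t, p (w t) = none := by
  unfold mapOpt
  split_ifs with h
  · simp only [false_iff, not_exists]
    intro t ht
    have := h t
    rw [ht] at this
    simp at this
  · simp only [true_iff]
    push Not at h
    obtain ⟨t, ht⟩ := h
    exact ⟨t, by simpa using ht⟩

/-- An additional state `none` absorbs the run as soon as `p` is undefined at a letter. -/
theorem RegFun.mapOpt {A C τ : Type} {f : ∀ N, (Fin N → A) → τ} (hf : RegFun f)
    (p : C → Option A) : RegFun (fun N (w : Fin N → C) => (mapOpt p w).map (f N)) := by
  obtain ⟨σ, hσ, s, δ, F, h⟩ := hf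
  refine ⟨Option σ, inferInstance, some s,
    fun x c => x.bind fun q => (p c).map fun a => δ q a, fun x => x.map F, fun N w => ?_⟩
  have hnone : ∀ (N : ℕ) (w : Fin N → C), wordRun
      (fun (x : Option σ) c => x.bind fun q => (p c).map fun a => δ q a) none N w = none := by
    intro N
    induction N with
    | zero => intro w; rfl
    | succ N ih => intro w; exact ih _
  have key : ∀ (N : ℕ) (w : Fin N → C) (s : σ), wordRun
      (fun (x : Option σ) c => x.bind fun q => (p c).map fun a => δ q a) (some s) N w =
        (LengthODE.mapOpt p w).map (wordRun δ s N) := by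
    intro N
    induction N with
    | zero =>
      intro w s
      have : LengthODE.mapOpt p w = some (fun t => t.elim0) := by
        rw [mapOpt_eq_some_iff]; exact fun t => t.elim0
      rw [this]; rfl
    | succ N ih =>
      intro w s
      rw [wordRun]
      cases hp : p (w 0) with
      | none =>
        have : LengthODE.mapOpt p w = none := mapOpt_eq_none_iff.2 ⟨0, hp⟩
        rw [this]
        simp only [Option.bind_some, Option.map_none]
        exact hnone _ _
      | some a =>
        simp only [Option.bind_some, Option.map_some]
        rw [ih]
        cases hv : LengthODE.mapOpt p (Fin.tail w) with
        | none =>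
          obtain ⟨t, ht⟩ := mapOpt_eq_none_iff.1 hv
          have : LengthODE.mapOpt p w = none := mapOpt_eq_none_iff.2 ⟨t.succ, ht⟩
          rw [this]; rfl
        | some v =>
          have : LengthODE.mapOpt p w = some (Fin.cons a v) := by
            rw [mapOpt_eq_some_iff] at hv ⊢
            exact Fin.cases hp hv
          rw [this]
          simp [wordRun]
  rw [key]
  beta_reduce
  cases LengthODE.mapOpt p w with
  | none => rfl
  | some v => exact congrArg some (h N v)

/-- Definition by cases for automatic maps. The graph of `φ` is pulled back along `p` acting on the
first track only, and the graph of `χ` takes over when this is undefined. -/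
theorem AutFun.mapOpt {A C D : Type} {φ : ∀ N, (Fin N → A) → (Fin N → D)} (hφ : AutFun φ)
    (p : C → Option A) {χ : ∀ N, (Fin N → C) → (Fin N → D)} (hχ : AutFun χ) :
    AutFun (fun N w => ((mapOpt p w).map (φ N)).getD (χ N w)) := by
  have h1 := RegFun.mapOpt hφ (fun c : C × D => (p c.1).map fun a => (a, c.2))
  refine (h1.map₂ hχ (fun x y => x.getD y)).congr fun N z => ?_
  cases hv : LengthODE.mapOpt p (fun t => (z t).1) with
  | none =>
    have : LengthODE.mapOpt (fun c : C × D => (p c.1).map fun a => (a, c.2)) z = none := by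
      rw [mapOpt_eq_none_iff] at hv ⊢
      obtain ⟨t, ht⟩ := hv
      exact ⟨t, by simp [ht]⟩
    simp [this, hv]
  | some v =>
    have : LengthODE.mapOpt (fun c : C × D => (p c.1).map fun a => (a, c.2)) z =
        some (fun t => (v t, (z t).2)) := by
      rw [mapOpt_eq_some_iff] at hv ⊢
      intro t
      simp [hv t]
    simp [this, hv]

open Classical in
/-- The letter of a constant nonempty word. -/
noncomputable def constTag {T : Type} {N : ℕ} (u : Fin N → T) : Option T :=
  if h : ∃ x, 0 < N ∧ ∀ t, u t = x then some h.choose else none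

theorem constTag_const {T : Type} {N : ℕ} (hN : 0 < N) (x : T) :
    constTag (fun _ : Fin N => x) = some x := by
  have h : ∃ y, 0 < N ∧ ∀ t : Fin N, (fun _ : Fin N => x) t = y := ⟨x, hN, fun _ => rfl⟩
  unfold constTag
  rw [dif_pos h]
  exact congrArg some (h.choose_spec.2 ⟨0, hN⟩).symm

theorem eq_of_constTag {T : Type} {N : ℕ} {u : Fin N → T} {x : T} (h : constTag u = some x) :
    u = fun _ => x := by
  unfold constTag at h
  split_ifs at h with h'
  have := h'.choose_spec.2
  rw [Option.some_inj.1 h] at this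
  exact funext this

theorem RegFun.nonempty {B : Type} : RegFun (fun N (_ : Fin N → B) => 0 < N) :=
  (exists_letter (fun _ : B => True)).congr_iff fun _ _ =>
    ⟨fun h => ⟨⟨0, h⟩, trivial⟩, fun ⟨t, _⟩ => t.pos⟩

theorem RegFun.constTag {T : Type} [Finite T] :
    RegFun (fun N (u : Fin N → T) => constTag u) := by
  classical
  have h := RegFun.pi (fun x : T => RegFun.nonempty.and (RegFun.forall_letter (fun y : T => y = x)))
  refine (h.map (fun f : T → Prop => if h : ∃ x, f x then some h.choose else none)).congr ?_
  intro N u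
  rfl

/-! ### Networks of gates named by words -/

inductive Kind (BS : Type) : Type
  | const (c : Bool)
  | not
  | and
  | or
  | base (s : BS)

/-- Whether a gate has the first (`false`) or second (`true`) predecessor. -/
def Kind.Uses {BS : Type} : Kind BS → Bool → Prop
  | .not, i => i = false
  | .and, _ => True
  | .or, _ => True
  | _, _ => False

/-- The value of a gate, from those of its predecessors and of the base. -/
def Kind.value {BS : Type} (k : Kind BS) (x : Bool → Prop) (b : BS → Prop) : Prop :=
  match k with
  | .const c => c = true
  | .not => ¬ x false
  | .and => x false ∧ x true
  | .or => x false ∨ x true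
  | .base s => b s

theorem Kind.value_congr {BS : Type} {k : Kind BS} {x x' : Bool → Prop} {b : BS → Prop}
    (h : ∀ i, k.Uses i → (x i ↔ x' i)) : k.value x b ↔ k.value x' b := by
  cases k <;> simp only [Kind.value, Kind.Uses, forall_const, Bool.forall_bool] at h ⊢
  · rw [h.1]
  · rw [h.1, h.2]
  · rw [h.1, h.2]

/-- A family of networks of gates of fan-in at most two, whose gates are named by words and whose
connections are regular. Gates of kind `base s` take a value from outside. -/
structure Net (BS A₀ : Type) where
  A : Type
  finite_A : Finite A
  kind : ∀ N, (Fin N → A) → Kind BS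
  ch : Bool → ∀ N, (Fin N → A) → (Fin N → A)
  bs : ∀ N, (Fin N → A) → (Fin N → A₀)
  reg_kind : RegFun kind
  aut_ch : ∀ i, AutFun (ch i)
  aut_bs : AutFun bs
  level : ∀ N, (Fin N → A) → ℕ
  depth : ℕ
  level_le : ∀ N u, level N u ≤ depth * (N + 1)
  level_lt : ∀ N u i, (kind N u).Uses i → level N (ch i N u) < level N u

def Net.IsVal {BS A₀ : Type} (𝒩 : Net BS A₀) {N : ℕ} (β : BS → (Fin N → A₀) → Prop)
    (V : (Fin N → 𝒩.A) → Prop) : Prop :=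
  ∀ u, V u ↔ (𝒩.kind N u).value (fun i => V (𝒩.ch i N u)) (fun s => β s (𝒩.bs N u))

/-- Gates added to a network. -/
structure Net.Ext {BS A₀ : Type} (𝒩 : Net BS A₀) where
  B : Type
  finite_B : Finite B
  kind : ∀ N, (Fin N → B) → Kind BS
  ch : Bool → ∀ N, (Fin N → B) → (Fin N → 𝒩.A ⊕ B)
  bs : ∀ N, (Fin N → B) → (Fin N → A₀)
  reg_kind : RegFun kind
  aut_ch : ∀ i, AutFun (ch i)
  aut_bs : AutFun bs
  level : ∀ N, (Fin N → B) → ℕ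
  depth : ℕ
  level_le : ∀ N u, level N u ≤ depth * (N + 1)
  level_lt : ∀ N u i, (kind N u).Uses i → ∀ v, (∀ t, ch i N u t = .inr (v t)) →
    level N v < level N u

namespace Net

section Sides

variable {A B : Type} {N : ℕ}

noncomputable def left (w : Fin N → A ⊕ B) : Option (Fin N → A) := mapOpt Sum.getLeft? w

noncomputable def right (w : Fin N → A ⊕ B) : Option (Fin N → B) := mapOpt Sum.getRight? w

theorem left_eq_some {w : Fin N → A ⊕ B} {v : Fin N → A} :
    left w = some v ↔ ∀ t, w t = .inl (v t) := by
  rw [left, mapOpt_eq_some_iff]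
  exact forall_congr' fun t => Sum.getLeft?_eq_some_iff

theorem right_eq_some {w : Fin N → A ⊕ B} {v : Fin N → B} :
    right w = some v ↔ ∀ t, w t = .inr (v t) := by
  rw [right, mapOpt_eq_some_iff]
  exact forall_congr' fun t => Sum.getRight?_eq_some_iff

theorem left_inl (v : Fin N → A) : left (fun t => (.inl (v t) : A ⊕ B)) = some v :=
  left_eq_some.2 fun _ => rfl

theorem right_inr (v : Fin N → B) : right (fun t => (.inr (v t) : A ⊕ B)) = some v :=
  right_eq_some.2 fun _ => rfl

theorem left_inr (hN : 0 < N) (v : Fin N → B) : left (fun t => (.inr (v t) : A ⊕ B)) = none :=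
  mapOpt_eq_none_iff.2 ⟨⟨0, hN⟩, rfl⟩

end Sides

variable {BS A₀ : Type} {𝒩 : Net BS A₀} (X : 𝒩.Ext)

namespace Ext

/-- A word mixing letters of both alphabets names no gate of either part and becomes a constant. In
`level'` the new gates lie above all old ones, so edges into the old network need no check. -/
noncomputable def kind' (N : ℕ) (w : Fin N → 𝒩.A ⊕ X.B) : Kind BS :=
  ((left w).map (𝒩.kind N)).getD (((right w).map (X.kind N)).getD (.const false))

noncomputable def ch' (i : Bool) (N : ℕ) (w : Fin N → 𝒩.A ⊕ X.B) : Fin N → 𝒩.A ⊕ X.B :=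
  ((left w).map (fun v t => .inl (𝒩.ch i N v t))).getD (((right w).map (X.ch i N)).getD w)

noncomputable def level' (N : ℕ) (w : Fin N → 𝒩.A ⊕ X.B) : ℕ :=
  ((left w).map (𝒩.level N)).getD
    (((right w).map (fun v => 𝒩.depth * (N + 1) + 1 + X.level N v)).getD 0)

def val {N : ℕ} (V : (Fin N → 𝒩.A) → Prop) (W : (Fin N → X.B) → Prop)
    (w : Fin N → 𝒩.A ⊕ X.B) : Prop :=
  ((left w).map V).getD (((right w).map W).getD False)

/-- A default letter is available only if `A₀` is nonempty. Otherwise any two words of the same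
length over `A₀` agree and there is nothing to prove. -/
theorem aut_bs' : ∃ bs' : ∀ N, (Fin N → 𝒩.A ⊕ X.B) → (Fin N → A₀), AutFun bs' ∧
    (∀ N w v, left w = some v → bs' N w = 𝒩.bs N v) ∧
    (∀ N w v, left w = none → right w = some v → bs' N w = X.bs N v) := by
  classical
  by_cases hA : Nonempty A₀
  · obtain ⟨a⟩ := hA
    refine ⟨_, 𝒩.aut_bs.mapOpt Sum.getLeft?
      (X.aut_bs.mapOpt Sum.getRight? (AutFun.letters fun _ => a)), ?_, ?_⟩
    · intro N w v h
      rw [left] at h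
      rw [h]; rfl
    · intro N w v h h'
      rw [left] at h
      rw [right] at h'
      rw [h, h']; rfl
  · have hempty : ∀ N (x y : Fin N → A₀), x = y := fun N x y =>
      funext fun t => absurd ⟨x t⟩ hA
    have hbs : ∀ N (w : Fin N → 𝒩.A ⊕ X.B), Nonempty (Fin N → A₀) := by
      intro N w
      refine ⟨fun t => ?_⟩
      match w t with
      | .inl a => exact 𝒩.bs 1 (fun _ => a) 0
      | .inr b => exact X.bs 1 (fun _ => b) 0
    refine ⟨fun N w => (hbs N w).some, ?_, fun N w v _ => hempty _ _ _,
      fun N w v _ _ => hempty _ _ _⟩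
    exact (RegFun.const True).congr_iff fun N w => by simp [hempty N _ (fun t => (w t).2)]

/-- The extended network. -/
noncomputable def toNet : Net BS A₀ where
  A := 𝒩.A ⊕ X.B
  finite_A := have := 𝒩.finite_A; have := X.finite_B; inferInstance
  kind := X.kind'
  ch := X.ch'
  bs := X.aut_bs'.choose
  reg_kind := (𝒩.reg_kind.mapOpt Sum.getLeft?).map₂ (X.reg_kind.mapOpt Sum.getRight?)
    (fun x y => x.getD (y.getD (.const false)))
  aut_ch i := ((𝒩.aut_ch i).post Sum.inl_injective).mapOpt Sum.getLeft?
    ((X.aut_ch i).mapOpt Sum.getRight? AutFun.id)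
  aut_bs := X.aut_bs'.choose_spec.1
  level := X.level'
  depth := 𝒩.depth + X.depth + 1
  level_le N w := by
    unfold level'
    have : (𝒩.depth + X.depth + 1) * (N + 1)
        = 𝒩.depth * (N + 1) + X.depth * (N + 1) + (N + 1) := by ring
    rw [this]
    cases left w with
    | some v =>
      simp only [Option.map_some, Option.getD_some]
      have := 𝒩.level_le N v
      omega
    | none =>
      cases right w with
      | some v =>
        simp only [Option.map_some, Option.map_none, Option.getD_none, Option.getD_some]
        have := X.level_le N v
        omega
      | none => simp
  level_lt N w i hu := by
    unfold kind' at hu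
    unfold ch'
    cases hl : left w with
    | some v =>
      simp only [hl, Option.map_some, Option.getD_some] at hu ⊢
      unfold level'
      rw [left_inl, hl]
      exact 𝒩.level_lt N v i hu
    | none =>
      cases hr : right w with
      | some v =>
        simp only [hl, hr, Option.map_some, Option.getD_some, Option.map_none,
          Option.getD_none] at hu ⊢
        unfold level'
        simp only [hl, hr, Option.map_some, Option.getD_some, Option.map_none, Option.getD_none]
        cases hl' : left (X.ch i N v) with
        | some v' =>
          simp only [Option.map_some, Option.getD_some]
          have := 𝒩.level_le N v'
          omega
        | none =>
          cases hr' : right (X.ch i N v) with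
          | some v' =>
            simp only [Option.map_some, Option.getD_some, Option.map_none, Option.getD_none]
            have := X.level_lt N v i hu v' (right_eq_some.1 hr')
            omega
          | none => simp
      | none => simp [hl, hr, Kind.Uses] at hu

variable {X}

theorem isVal_toNet {N : ℕ} {β : BS → (Fin N → A₀) → Prop}
    {V : (Fin N → 𝒩.A) → Prop} (hV : 𝒩.IsVal β V) {W : (Fin N → X.B) → Prop}
    (hW : ∀ u, W u ↔ (X.kind N u).value (fun i => X.val V W (X.ch i N u))
      (fun s => β s (X.bs N u))) :
    X.toNet.IsVal β (X.val V W) := by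
  intro w
  show X.val V W w ↔ (X.kind' N w).value (fun i => X.val V W (X.ch' i N w))
    (fun s => β s (X.aut_bs'.choose N w))
  obtain ⟨h1, h2⟩ := X.aut_bs'.choose_spec.2
  unfold kind' ch'
  conv_lhs => unfold val
  cases hl : left w with
  | some v =>
    simp only [Option.map_some, Option.getD_some]
    rw [hV v, h1 N w v hl]
    unfold val
    simp only [left_inl, Option.map_some, Option.getD_some]
  | none =>
    cases hr : right w with
    | some v =>
      simp only [Option.map_some, Option.getD_some, Option.map_none, Option.getD_none]
      rw [hW v, h2 N w v hl hr]
      rfl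
    | none => simp [Kind.value]

theorem val_inl {N : ℕ} {V : (Fin N → 𝒩.A) → Prop} {W : (Fin N → X.B) → Prop}
    (v : Fin N → 𝒩.A) : X.val V W (fun t => .inl (v t)) ↔ V v := by
  unfold val
  simp [left_inl]

theorem val_inr {N : ℕ} (hN : 0 < N) {V : (Fin N → 𝒩.A) → Prop} {W : (Fin N → X.B) → Prop}
    (v : Fin N → X.B) : X.val V W (fun t => .inr (v t)) ↔ W v := by
  unfold val
  simp [left_inr hN, right_inr]

end Ext

/-- The disjoint union of two networks, as an extension of the first. -/
def join (𝒩 𝒩' : Net BS A₀) : 𝒩.Ext where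
  B := 𝒩'.A
  finite_B := 𝒩'.finite_A
  kind := 𝒩'.kind
  ch i N u t := .inr (𝒩'.ch i N u t)
  bs := 𝒩'.bs
  reg_kind := 𝒩'.reg_kind
  aut_ch i := (𝒩'.aut_ch i).post Sum.inr_injective
  aut_bs := 𝒩'.aut_bs
  level := 𝒩'.level
  depth := 𝒩'.depth
  level_le := 𝒩'.level_le
  level_lt N u i hu v hv := by
    have : v = 𝒩'.ch i N u := funext fun t => (Sum.inr_injective (hv t)).symm
    rw [this]
    exact 𝒩'.level_lt N u i hu

end Net

/-! ### Boolean expressions -/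

/-- Boolean expressions over atoms `own l` and `ext m`. -/
inductive BExpr (L M : Type) : Type
  | const (c : Bool)
  | own (l : L)
  | ext (m : M)
  | not (a : BExpr L M)
  | and (a b : BExpr L M)
  | or (a b : BExpr L M)

namespace BExpr

variable {L M : Type}

def eval (x : L → Prop) (y : M → Prop) : BExpr L M → Prop
  | .const c => c = true
  | .own l => x l
  | .ext m => y m
  | .not a => ¬ a.eval x y
  | .and a b => a.eval x y ∧ b.eval x y
  | .or a b => a.eval x y ∨ b.eval x y

def size : BExpr L M → ℕ
  | .const _ => 0
  | .own _ => 0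
  | .ext _ => 0
  | .not a => a.size + 1
  | .and a b => a.size + b.size + 1
  | .or a b => a.size + b.size + 1

/-- The subexpressions. -/
def subs : BExpr L M → Set (BExpr L M)
  | .const c => {.const c}
  | .own l => {.own l}
  | .ext m => {.ext m}
  | .not a => insert (.not a) a.subs
  | .and a b => insert (.and a b) (a.subs ∪ b.subs)
  | .or a b => insert (.or a b) (a.subs ∪ b.subs)

theorem finite_subs (a : BExpr L M) : a.subs.Finite := by
  induction a with
  | const | own | ext => exact Set.finite_singleton _
  | not a ih => exact ih.insert _
  | and a b iha ihb => exact (iha.union ihb).insert _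
  | or a b iha ihb => exact (iha.union ihb).insert _

theorem self_mem_subs (a : BExpr L M) : a ∈ a.subs := by
  cases a <;> simp [subs]

theorem subs_subset {a b : BExpr L M} (h : a ∈ b.subs) : a.subs ⊆ b.subs := by
  induction b with
  | const | own | ext => rw [Set.mem_singleton_iff.1 h]
  | not b ih =>
    rcases h with rfl | h
    · exact subset_rfl
    · exact (ih h).trans (Set.subset_insert _ _)
  | and b c ihb ihc =>
    rcases h with rfl | h | h
    · exact subset_rfl
    · exact (ihb h).trans (Set.subset_union_left.trans (Set.subset_insert _ _))
    · exact (ihc h).trans (Set.subset_union_right.trans (Set.subset_insert _ _))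
  | or b c ihb ihc =>
    rcases h with rfl | h | h
    · exact subset_rfl
    · exact (ihb h).trans (Set.subset_union_left.trans (Set.subset_insert _ _))
    · exact (ihc h).trans (Set.subset_union_right.trans (Set.subset_insert _ _))

theorem size_le_of_mem_subs {a b : BExpr L M} (h : a ∈ b.subs) : a.size ≤ b.size := by
  induction b with
  | const | own | ext => rw [Set.mem_singleton_iff.1 h]
  | not b ih =>
    rcases h with rfl | h
    · exact le_rfl
    · simp only [size]; have := ih h; omega
  | and b c ihb ihc =>
    rcases h with rfl | h | h
    · exact le_rfl
    · simp only [size]; have := ihb h; omega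
    · simp only [size]; have := ihc h; omega
  | or b c ihb ihc =>
    rcases h with rfl | h | h
    · exact le_rfl
    · simp only [size]; have := ihb h; omega
    · simp only [size]; have := ihc h; omega

theorem eval_congr {x x' : L → Prop} {y : M → Prop} (a : BExpr L M)
    (h : ∀ l, .own l ∈ a.subs → (x l ↔ x' l)) : a.eval x y ↔ a.eval x' y := by
  induction a with
  | const | ext => rfl
  | own l => exact h l rfl
  | not a ih => exact not_congr (ih fun l hl => h l (Set.mem_insert_of_mem _ hl))
  | and a b iha ihb =>
    exact and_congr (iha fun l hl => h l (Set.mem_insert_of_mem _ (.inl hl)))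
      (ihb fun l hl => h l (Set.mem_insert_of_mem _ (.inr hl)))
  | or a b iha ihb =>
    exact or_congr (iha fun l hl => h l (Set.mem_insert_of_mem _ (.inl hl)))
      (ihb fun l hl => h l (Set.mem_insert_of_mem _ (.inr hl)))

end BExpr

section

/-! ### Predicates computed by networks -/

/-- A family of inputs for networks: word lengths and the values at gates of kind `base`. -/
structure Base (BS A₀ : Type) where
  E : Type
  N : E → ℕ
  N_pos : ∀ e, 0 < N e
  β : ∀ e, BS → (Fin (N e) → A₀) → Prop

variable {BS A₀ : Type}

/-- The predicate on words is computed by the gates of a network. -/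
def Comp (𝔅 : Base BS A₀) {B : Type} (Q : ∀ e, (Fin (𝔅.N e) → B) → Prop) : Prop :=
  ∃ (𝒩 : Net BS A₀) (V : ∀ e, (Fin (𝔅.N e) → 𝒩.A) → Prop) (emb : B → 𝒩.A),
    Function.Injective emb ∧ (∀ e, 𝒩.IsVal (𝔅.β e) (V e)) ∧
      ∀ e u, V e (fun t => emb (u t)) ↔ Q e u

namespace Net

open BExpr

variable {L M κ B : Type} (F : κ → BExpr L M)

/-- The subexpressions of finitely many expressions. -/
abbrev Pos : Type := {a : BExpr L M // ∃ k, a ∈ (F k).subs}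

theorem finite_pos [Finite κ] : Finite (Pos F) := by
  have h : (⋃ k, (F k).subs).Finite := Set.finite_iUnion fun k => (F k).finite_subs
  exact (h.subset (t := {a | ∃ k, a ∈ (F k).subs}) fun a ha => Set.mem_iUnion.2 ha).to_subtype

open Classical in
noncomputable def toPos (a : BExpr L M) : Option (Pos F) :=
  if h : ∃ k, a ∈ (F k).subs then some ⟨a, h⟩ else none

variable {F}

theorem toPos_of_mem {a : BExpr L M} (h : ∃ k, a ∈ (F k).subs) : toPos F a = some ⟨a, h⟩ :=
  dif_pos h

variable (F) (A : Type) (kind : ∀ N, (Fin N → B) → κ) (φ : L → ∀ N, (Fin N → B) → (Fin N → B))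
  (ψ : M → ∀ N, (Fin N → B) → (Fin N → A))

/-- The kind of the gate for the subexpression `x` (`none` for the root) at a word of kind `k`. -/
noncomputable def posKind (BS : Type) (k : κ) (x : Option (Pos F)) : Kind BS :=
  open Classical in
  match x with
  | none => .or
  | some ⟨.const c, _⟩ => .const c
  -- A position taken from the expression of another kind need not lead to a word of smaller level;
  -- its gate is not used and is made constant.
  | some ⟨.own l, _⟩ => if .own l ∈ (F k).subs then .or else .const false
  | some ⟨.ext _, _⟩ => .or
  | some ⟨.not _, _⟩ => .not
  | some ⟨.and _ _, _⟩ => .and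
  | some ⟨.or _ _, _⟩ => .or

/-- The root and the atoms are `or` gates whose two predecessors coincide, that is, wires: from the
root to the whole expression, from `own l` to the root gate at the word `φ l u`, from `ext m` to a
gate of the given network. -/
noncomputable def posChild (i : Bool) (k : κ) (x : Option (Pos F)) (N : ℕ)
    (u : Fin N → B) : Fin N → A ⊕ (B × Option (Pos F)) :=
  match x with
  | none => fun t => .inr (u t, toPos F (F k))
  | some ⟨.const _, _⟩ => fun t => .inr (u t, none)
  | some ⟨.own l, _⟩ => fun t => .inr (φ l N u t, none)
  | some ⟨.ext m, _⟩ => fun t => .inl (ψ m N u t)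
  | some ⟨.not a, _⟩ => fun t => .inr (u t, toPos F a)
  | some ⟨.and a b, _⟩ => fun t => .inr (u t, toPos F (cond i b a))
  | some ⟨.or a b, _⟩ => fun t => .inr (u t, toPos F (cond i b a))

theorem aut_posChild (hφ : ∀ l, AutFun (φ l)) (hψ : ∀ m, AutFun (ψ m)) (i : Bool) (k : κ)
    (x : Option (Pos F)) : AutFun (posChild F A φ ψ i k x) := by
  have h : ∀ y : Option (Pos F), Function.Injective
      (fun b : B => (.inr (b, y) : A ⊕ (B × Option (Pos F)))) := by
    intro y b b' h
    simpa using h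
  match x with
  | none => exact AutFun.letters fun b => (.inr (b, toPos F (F k)) : A ⊕ (B × Option (Pos F)))
  | some ⟨.const _, _⟩ => exact AutFun.letters fun b => (.inr (b, none) : A ⊕ (B × Option (Pos F)))
  | some ⟨.own l, _⟩ => exact (hφ l).post (h none)
  | some ⟨.ext m, _⟩ => exact (hψ m).post Sum.inl_injective
  | some ⟨.not a, _⟩ => exact AutFun.letters fun b => (.inr (b, toPos F a) : A ⊕ (B × Option (Pos F)))
  | some ⟨.and a b, _⟩ => exact AutFun.letters fun c => (.inr (c, toPos F (cond i b a)) : A ⊕ (B × Option (Pos F)))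
  | some ⟨.or a b, _⟩ => exact AutFun.letters fun c => (.inr (c, toPos F (cond i b a)) : A ⊕ (B × Option (Pos F)))

def posSize (D : ℕ) : Option (Pos F) → ℕ
  | none => D + 1
  | some a => a.1.size

/-- Gates evaluating the expression `F (kind u)` at every word `u`. -/
noncomputable def evalExt (𝒩 : Net BS A₀) [Finite B] [Finite κ] (F : κ → BExpr L M)
    (kind : ∀ N, (Fin N → B) → κ) (hkind : RegFun kind)
    (φ : L → ∀ N, (Fin N → B) → (Fin N → B)) (hφ : ∀ l, AutFun (φ l))
    (ψ : M → ∀ N, (Fin N → B) → (Fin N → 𝒩.A)) (hψ : ∀ m, AutFun (ψ m))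
    (bs : ∀ N, (Fin N → B) → (Fin N → A₀)) (hbs : AutFun bs)
    (level : ∀ N, (Fin N → B) → ℕ) (depth D : ℕ) (hD : ∀ k, (F k).size ≤ D)
    (level_le : ∀ N u, level N u ≤ depth * (N + 1))
    (level_lt : ∀ N u l, .own l ∈ (F (kind N u)).subs → level N (φ l N u) < level N u) :
    𝒩.Ext where
  B := B × Option (Pos F)
  finite_B := have := finite_pos F; inferInstance
  kind N w := (constTag fun t => (w t).2).elim (.const false)
    (posKind F BS (kind N fun t => (w t).1))
  ch i N w := (constTag fun t => (w t).2).elim (fun t => .inr (w t))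
    (fun x => posChild F 𝒩.A φ ψ i (kind N fun t => (w t).1) x N (fun t => (w t).1))
  bs N w := bs N (fun t => (w t).1)
  reg_kind := by
    have := finite_pos F
    exact (RegFun.constTag.comap Prod.snd).map₂ (hkind.comap Prod.fst)
      (fun x k => x.elim (.const false) (posKind F BS k))
  aut_ch i := by
    have := finite_pos F
    have h : RegFun (fun N (w : Fin N → B × Option (Pos F)) =>
        (constTag (fun t => (w t).2), kind N fun t => (w t).1)) :=
      (RegFun.constTag.comap Prod.snd).map₂ (hkind.comap Prod.fst) Prod.mk
    refine AutFun.bind h (φ := fun c N w => c.1.elim (fun t => .inr (w t))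
      (fun x => posChild F 𝒩.A φ ψ i c.2 x N (fun t => (w t).1))) ?_
    rintro ⟨x, k⟩
    cases x with
    | none => exact AutFun.letters Sum.inr
    | some x => exact (aut_posChild F 𝒩.A φ ψ hφ hψ i k x).pre Prod.fst
  aut_bs := hbs.pre Prod.fst
  -- The order is lexicographic, first by the level of the word and then by the position in the
  -- expression; the factor `D + 2` exceeds every position size, the largest being `D + 1` at the
  -- root.
  level N w := (D + 2) * level N (fun t => (w t).1) +
    (constTag fun t => (w t).2).elim 0 (posSize F D)
  depth := (D + 2) * depth + D + 1
  level_le N w := by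
    have h1 := level_le N fun t => (w t).1
    have h2 : (constTag fun t => (w t).2).elim 0 (posSize F D) ≤ D + 1 := by
      cases constTag fun t => (w t).2 with
      | none => simp
      | some x =>
        match x with
        | none => exact le_rfl
        | some ⟨a, k, ha⟩ => exact (size_le_of_mem_subs ha).trans ((hD k).trans (Nat.le_succ _))
    have h3 := Nat.mul_le_mul_left (D + 2) h1
    have h4 : ((D + 2) * depth + D + 1) * (N + 1)
        = (D + 2) * (depth * (N + 1)) + (D + 1) * N + (D + 1) := by ring
    rw [h4]
    omega
  level_lt N w i hu v hv := by
    cases hx : constTag fun t => (w t).2 with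
    | none => simp [hx, Kind.Uses] at hu
    | some x =>
      have hN : 0 < N := by
        by_contra h0
        unfold constTag at hx
        split_ifs at hx with h
        exact h0 h.choose_spec.1
      simp only [hx, Option.elim_some] at hu hv ⊢
      have key : ∀ (u' : Fin N → B) (y : Option (Pos F)),
          (∀ t, v t = (u' t, y)) → (D + 2) * level N (fun t => (v t).1) +
            (constTag fun t => (v t).2).elim 0 (posSize F D) =
              (D + 2) * level N u' + posSize F D y := by
        intro u' y h
        simp only [h, constTag_const hN, Option.elim_some]
      match x, hu, hv with
      | none, hu, hv =>
        rw [key (fun t => (w t).1) (toPos F (F (kind N fun t => (w t).1)))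
          (fun t => (Sum.inr_injective (hv t)).symm)]
        rw [toPos_of_mem ⟨_, self_mem_subs _⟩]
        have := hD (kind N fun t => (w t).1)
        simp only [posSize]
        omega
      | some ⟨.own l, hk⟩, hu, hv =>
        simp only [posKind] at hu
        split_ifs at hu with hmem
        · rw [key (φ l N fun t => (w t).1) none (fun t => (Sum.inr_injective (hv t)).symm)]
          have h1 := level_lt N (fun t => (w t).1) l hmem
          have h2 := Nat.mul_le_mul_left (D + 2) (Nat.succ_le_of_lt h1)
          rw [Nat.mul_succ] at h2
          simp only [posSize]
          omega
        · exact hu.elim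
      | some ⟨.ext m, hk⟩, hu, hv => exact absurd (hv ⟨0, hN⟩) (by simp [posChild])
      | some ⟨.not a, k, hk⟩, hu, hv =>
        rw [key (fun t => (w t).1) (toPos F a) (fun t => (Sum.inr_injective (hv t)).symm)]
        rw [toPos_of_mem ⟨k, subs_subset hk (Set.mem_insert_of_mem _ (self_mem_subs a))⟩]
        simp only [posSize, size]
        omega
      | some ⟨.and a b, k, hk⟩, hu, hv =>
        rw [key (fun t => (w t).1) (toPos F (cond i b a))
          (fun t => (Sum.inr_injective (hv t)).symm)]
        cases i
        · simp only [cond_false]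
          rw [toPos_of_mem ⟨k, subs_subset hk (Set.mem_insert_of_mem _
            (.inl (self_mem_subs a)))⟩]
          simp only [posSize, size]
          omega
        · simp only [cond_true]
          rw [toPos_of_mem ⟨k, subs_subset hk (Set.mem_insert_of_mem _
            (.inr (self_mem_subs b)))⟩]
          simp only [posSize, size]
          omega
      | some ⟨.or a b, k, hk⟩, hu, hv =>
        rw [key (fun t => (w t).1) (toPos F (cond i b a))
          (fun t => (Sum.inr_injective (hv t)).symm)]
        cases i
        · simp only [cond_false]
          rw [toPos_of_mem ⟨k, subs_subset hk (Set.mem_insert_of_mem _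
            (.inl (self_mem_subs a)))⟩]
          simp only [posSize, size]
          omega
        · simp only [cond_true]
          rw [toPos_of_mem ⟨k, subs_subset hk (Set.mem_insert_of_mem _
            (.inr (self_mem_subs b)))⟩]
          simp only [posSize, size]
          omega

end Net

open BExpr Net in
/-- Recursion of logarithmic depth: a predicate whose value at `u` is given by one of finitely many
Boolean expressions in its values at words of smaller level and in the values at gates of a
network. -/
theorem Comp.recursion [Inhabited A₀] {𝔅 : Base BS A₀} (𝒩 : Net BS A₀) (V : ∀ e, (Fin (𝔅.N e) → 𝒩.A) → Prop)
    (hV : ∀ e, 𝒩.IsVal (𝔅.β e) (V e)) {L M κ B : Type} [Finite B] [Finite κ]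
    (F : κ → BExpr L M)
    (kind : ∀ N, (Fin N → B) → κ) (hkind : RegFun kind)
    (φ : L → ∀ N, (Fin N → B) → (Fin N → B)) (hφ : ∀ l, AutFun (φ l))
    (ψ : M → ∀ N, (Fin N → B) → (Fin N → 𝒩.A)) (hψ : ∀ m, AutFun (ψ m))
    (level : ∀ N, (Fin N → B) → ℕ) (depth : ℕ)
    (level_le : ∀ N u, level N u ≤ depth * (N + 1))
    (level_lt : ∀ N u l, .own l ∈ (F (kind N u)).subs → level N (φ l N u) < level N u)
    (Q : ∀ e, (Fin (𝔅.N e) → B) → Prop)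
    (hQ : ∀ e u, Q e u ↔ (F (kind _ u)).eval (fun l => Q e (φ l _ u)) (fun m => V e (ψ m _ u))) :
    Comp 𝔅 Q := by
  obtain ⟨D, hD⟩ : ∃ D, ∀ k, (F k).size ≤ D := by
    obtain ⟨D, hD⟩ := (Set.finite_range fun k => (F k).size).bddAbove
    exact ⟨D, fun k => hD ⟨k, rfl⟩⟩
  let X := evalExt 𝒩 F kind hkind φ hφ ψ hψ (fun _ _ _ => default)
    (AutFun.letters fun _ => default) level depth D hD level_le level_lt
  -- Atoms `own l` which do not occur in the expression for the kind of `u` count as false, in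
  -- agreement with the constant gates placed there; this does not change the value of the
  -- expression itself.
  let ev : ∀ e (u : Fin (𝔅.N e) → B), BExpr L M → Prop := fun e u a =>
    a.eval (fun l => .own l ∈ (F (kind _ u)).subs ∧ Q e (φ l _ u)) (fun m => V e (ψ m _ u))
  let W : ∀ e, (Fin (𝔅.N e) → X.B) → Prop := fun e w =>
    (constTag fun t => (w t).2).elim False fun x =>
      x.elim (Q e fun t => (w t).1) (fun a => ev e (fun t => (w t).1) a.1)
  have hW0 : ∀ e (u : Fin (𝔅.N e) → B) (x : Option (Pos F)),
      W e (fun t => (u t, x)) ↔ x.elim (Q e u) (fun a => ev e u a.1) := by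
    intro e u x
    simp only [W, constTag_const (𝔅.N_pos e), Option.elim_some]
  have hev : ∀ e u, ev e u (F (kind _ u)) ↔ Q e u := by
    intro e u
    rw [hQ]
    apply eval_congr
    intro l hl
    simp [hl]
  refine ⟨X.toNet, fun e => X.val (V e) (W e), fun b => .inr (b, none), ?_, ?_, ?_⟩
  · intro b b' h
    exact congrArg Prod.fst (Sum.inr_injective h)
  · intro e
    refine Ext.isVal_toNet (hV e) fun w => ?_
    have hin : ∀ v, X.val (V e) (W e) (fun t => .inr (v t)) ↔ W e v :=
      fun v => Ext.val_inr (𝔅.N_pos e) v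
    have hil : ∀ v, X.val (V e) (W e) (fun t => .inl (v t)) ↔ V e v := fun v => Ext.val_inl v
    show W e w ↔ Kind.value ((constTag fun t => (w t).2).elim (.const false)
      (posKind F BS (kind _ fun t => (w t).1))) (fun i => X.val (V e) (W e)
        ((constTag fun t => (w t).2).elim (fun t => .inr (w t))
          (fun x => posChild F 𝒩.A φ ψ i (kind _ fun t => (w t).1) x _ (fun t => (w t).1)))) _
    cases hx : constTag fun t => (w t).2 with
    | none => simp [W, hx, Kind.value]
    | some x =>
      have hw : w = fun t => ((w t).1, x) := by
        have := congrFun (eq_of_constTag hx)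
        funext t
        exact Prod.ext rfl (this t)
      conv_lhs => rw [hw]
      rw [hW0]
      simp only [Option.elim_some]
      generalize (fun t => (w t).1) = u
      set R : (Fin (𝔅.N e) → 𝒩.A ⊕ (B × Option (Pos F))) → Prop := X.val (V e) (W e) with hR
      have hin : ∀ u x, R (fun t => .inr (u t, x)) ↔ x.elim (Q e u) (fun a => ev e u a.1) :=
        fun u x => (hin _).trans (hW0 e u x)
      have hsub : ∀ {a b} (hk : ∃ k, b ∈ (F k).subs), a ∈ b.subs →
          ∀ u, (R (fun t => .inr (u t, toPos F a)) ↔ ev e u a) := by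
        intro a b hk ha u
        obtain ⟨k, hk⟩ := hk
        rw [hin, toPos_of_mem ⟨k, subs_subset hk ha⟩]
        rfl
      match x with
      | none =>
        show Q e u ↔ R (fun t => .inr (u t, toPos F (F (kind _ u)))) ∨
          R (fun t => .inr (u t, toPos F (F (kind _ u))))
        rw [or_self, hin, toPos_of_mem ⟨_, self_mem_subs _⟩]
        exact (hev e u).symm
      | some ⟨.const c, hk⟩ => rfl
      | some ⟨.own l, hk⟩ =>
        show (.own l ∈ (F (kind _ u)).subs ∧ Q e (φ l _ u)) ↔ Kind.value
          (@ite _ (.own l ∈ (F (kind _ u)).subs) (Classical.propDecidable _) .or (.const false))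
          (fun i => R (fun t => .inr (φ l _ u t, none))) _
        split_ifs with hmem
        · simp only [Kind.value, or_self, hmem, true_and]
          exact (hin (φ l _ u) none).symm
        · simp [Kind.value, hmem]
      | some ⟨.ext m, hk⟩ =>
        show V e (ψ m _ u) ↔ R (fun t => .inl (ψ m _ u t)) ∨ R (fun t => .inl (ψ m _ u t))
        rw [or_self]
        exact (hil _).symm
      | some ⟨.not a, hk⟩ =>
        show ¬ ev e u a ↔ ¬ R (fun t => .inr (u t, toPos F a))
        rw [hsub hk (Set.mem_insert_of_mem _ (self_mem_subs a))]
      | some ⟨.and a b, hk⟩ =>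
        show ev e u a ∧ ev e u b ↔
          R (fun t => .inr (u t, toPos F a)) ∧ R (fun t => .inr (u t, toPos F b))
        rw [hsub hk (Set.mem_insert_of_mem _ (.inl (self_mem_subs a))),
          hsub hk (Set.mem_insert_of_mem _ (.inr (self_mem_subs b)))]
      | some ⟨.or a b, hk⟩ =>
        show ev e u a ∨ ev e u b ↔
          R (fun t => .inr (u t, toPos F a)) ∨ R (fun t => .inr (u t, toPos F b))
        rw [hsub hk (Set.mem_insert_of_mem _ (.inl (self_mem_subs a))),
          hsub hk (Set.mem_insert_of_mem _ (.inr (self_mem_subs b)))]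
  · intro e u
    exact (Ext.val_inr (𝔅.N_pos e) _).trans (hW0 e u none)

namespace Comp

variable {𝔅 : Base BS A₀} {B B' C : Type}

theorem congr {Q Q' : ∀ e, (Fin (𝔅.N e) → B) → Prop} (h : Comp 𝔅 Q)
    (h' : ∀ e u, Q' e u ↔ Q e u) : Comp 𝔅 Q' := by
  have : Q' = Q := by funext e u; exact propext (h' e u)
  rwa [this]

/-- The values of the base at automatic images of the word. -/
theorem base [Finite B] (s : BS) {φ : ∀ N, (Fin N → B) → (Fin N → A₀)} (hφ : AutFun φ) :
    Comp 𝔅 (fun e u => 𝔅.β e s (φ _ u)) := by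
  refine ⟨{ A := B, finite_A := inferInstance, kind := fun _ _ => .base s,
            ch := fun _ _ u => u, bs := φ, reg_kind := RegFun.const _, aut_ch := fun _ => AutFun.id,
            aut_bs := hφ, level := fun _ _ => 0, depth := 0, level_le := fun _ _ => Nat.zero_le _
            level_lt := fun _ _ _ h => h.elim }, fun e u => 𝔅.β e s (φ _ u), _root_.id,
            Function.injective_id, fun e u => Iff.rfl, fun e u => Iff.rfl⟩

variable [Inhabited A₀]

/-- A Boolean expression in two computed predicates, at automatic images of the word. -/
theorem combine {C' : Type} [Finite B] {Q : ∀ e, (Fin (𝔅.N e) → C) → Prop} (hQ : Comp 𝔅 Q)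
    {Q' : ∀ e, (Fin (𝔅.N e) → C') → Prop} (hQ' : Comp 𝔅 Q')
    {φ : ∀ N, (Fin N → B) → (Fin N → C)} (hφ : AutFun φ)
    {φ' : ∀ N, (Fin N → B) → (Fin N → C')} (hφ' : AutFun φ')
    {κ : Type} [Finite κ] {kind : ∀ N, (Fin N → B) → κ} (hkind : RegFun kind)
    (F : κ → BExpr Empty Bool) :
    Comp 𝔅 (fun e u => (F (kind _ u)).eval (fun l => l.elim)
      (fun m => cond m (Q' e (φ' _ u)) (Q e (φ _ u)))) := by
  obtain ⟨𝒩, V, emb, h1, h2, h3⟩ := hQ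
  obtain ⟨𝒩', V', emb', h1', h2', h3'⟩ := hQ'
  refine Comp.recursion (𝒩.join 𝒩').toNet (fun e => (𝒩.join 𝒩').val (V e) (V' e)) ?_ F kind hkind
    (fun l => l.elim) (fun l => l.elim)
    (fun m N u t => cond m (.inr (emb' (φ' N u t))) (.inl (emb (φ N u t)))) ?_
    (fun _ _ => 0) 0 (fun _ _ => Nat.zero_le _) (fun _ _ l => l.elim) _ ?_
  · intro e
    refine Net.Ext.isVal_toNet (h2 e) fun u => ?_
    rw [h2' e u]
    exact Kind.value_congr fun i _ => (Net.Ext.val_inr (X := 𝒩.join 𝒩') (𝔅.N_pos e) _).symm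
  · intro m
    cases m
    · exact hφ.post (Sum.inl_injective.comp h1)
    · exact hφ'.post (Sum.inr_injective.comp h1')
  · intro e u
    have ha : (𝒩.join 𝒩').val (V e) (V' e) (fun t => .inl (emb (φ _ u t))) ↔ Q e (φ _ u) :=
      (Net.Ext.val_inl _).trans (h3 e _)
    have hb : (𝒩.join 𝒩').val (V e) (V' e) (fun t => .inr (emb' (φ' _ u t))) ↔ Q' e (φ' _ u) :=
      (Net.Ext.val_inr (X := 𝒩.join 𝒩') (𝔅.N_pos e) _).trans (h3' e _)
    have hm : (fun m : Bool => cond m (Q' e (φ' _ u)) (Q e (φ _ u))) =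
        fun m => (𝒩.join 𝒩').val (V e) (V' e)
          (fun t => cond m (.inr (emb' (φ' _ u t))) (.inl (emb (φ _ u t)))) := by
      funext m
      cases m
      · exact propext ha.symm
      · exact propext hb.symm
    rw [hm]
    exact BExpr.eval_congr _ fun l => l.elim

theorem subst [Finite B] {Q : ∀ e, (Fin (𝔅.N e) → C) → Prop} (hQ : Comp 𝔅 Q)
    {φ : ∀ N, (Fin N → B) → (Fin N → C)} (hφ : AutFun φ) : Comp 𝔅 (fun e u => Q e (φ _ u)) :=
  combine hQ hQ hφ hφ (RegFun.const ()) (fun _ => .ext false)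

theorem comap [Finite B] {Q : ∀ e, (Fin (𝔅.N e) → C) → Prop} (hQ : Comp 𝔅 Q) (g : B → C) :
    Comp 𝔅 (fun e u => Q e (fun t => g (u t))) :=
  hQ.subst (AutFun.letters g)

theorem not [Finite B] {Q : ∀ e, (Fin (𝔅.N e) → B) → Prop} (hQ : Comp 𝔅 Q) :
    Comp 𝔅 (fun e u => ¬ Q e u) :=
  combine hQ hQ AutFun.id AutFun.id (RegFun.const ()) (fun _ => .not (.ext false))

theorem and [Finite B] {Q Q' : ∀ e, (Fin (𝔅.N e) → B) → Prop} (hQ : Comp 𝔅 Q)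
    (hQ' : Comp 𝔅 Q') : Comp 𝔅 (fun e u => Q e u ∧ Q' e u) :=
  combine hQ hQ' AutFun.id AutFun.id (RegFun.const ()) (fun _ => .and (.ext false) (.ext true))

theorem or [Finite B] {Q Q' : ∀ e, (Fin (𝔅.N e) → B) → Prop} (hQ : Comp 𝔅 Q)
    (hQ' : Comp 𝔅 Q') : Comp 𝔅 (fun e u => Q e u ∨ Q' e u) :=
  combine hQ hQ' AutFun.id AutFun.id (RegFun.const ()) (fun _ => .or (.ext false) (.ext true))

/-- The truth value itself serves as the kind of a word, with a constant expression for either kind.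
No atoms occur, so the level can be zero. -/
theorem regular [Finite B] {Q : ∀ N, (Fin N → B) → Prop} (hQ : RegFun Q) :
    Comp 𝔅 (fun _ u => Q _ u) := by
  classical
  refine Comp.recursion (κ := Prop) (L := Empty) (M := Empty) (V := fun _ _ => True)
    { A := Unit, finite_A := inferInstance, kind := fun _ _ => .const true
      ch := fun _ _ u => u, bs := fun _ _ _ => default, reg_kind := RegFun.const _
      aut_ch := fun _ => AutFun.id, aut_bs := AutFun.letters fun _ => default
      level := fun _ _ => 0, depth := 0, level_le := fun _ _ => Nat.zero_le _
      level_lt := fun _ _ _ h => h.elim } ?_ (fun p => .const (decide p)) Q hQ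
    (fun l => l.elim) (fun l => l.elim) (fun m => m.elim) (fun m => m.elim)
    (fun _ _ => 0) 0 (fun _ _ => Nat.zero_le _) (fun _ _ l => l.elim) _ ?_
  · intro e u
    exact iff_of_true trivial rfl
  · intro e u
    exact (decide_eq_true_iff (p := Q _ u)).symm

end Comp

/-! ### Partial assignments -/

/-- Replacing the first blank of a word. -/
def fillFirst (b : Bool) : ∀ N, (Fin N → Option Bool) → (Fin N → Option Bool)
  | 0, u => u
  | N + 1, u => match u 0 with
    | none => Fin.cons (some b) (Fin.tail u)
    | some x => Fin.cons (some x) (fillFirst b N (Fin.tail u))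

/-- The number of blanks of a word. -/
def blanks {N : ℕ} (u : Fin N → Option Bool) : ℕ := ∑ t, if u t = none then 1 else 0

theorem blanks_succ {N : ℕ} (u : Fin (N + 1) → Option Bool) :
    blanks u = (if u 0 = none then 1 else 0) + blanks (Fin.tail u) := Fin.sum_univ_succ _

theorem blanks_le {N : ℕ} (u : Fin N → Option Bool) : blanks u ≤ N := by
  refine (Finset.sum_le_card_nsmul _ _ 1 fun t _ => ?_).trans (by simp)
  split_ifs <;> omega

theorem blanks_eq_zero {N : ℕ} {u : Fin N → Option Bool} : blanks u = 0 ↔ ∀ t, u t ≠ none := by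
  simp [blanks]

theorem blanks_fillFirst (b : Bool) {N : ℕ} (u : Fin N → Option Bool) :
    blanks (fillFirst b N u) = blanks u - 1 := by
  induction N with
  | zero => simp [fillFirst, blanks]
  | succ N ih =>
    rw [blanks_succ, blanks_succ, fillFirst]
    cases h : u 0 with
    | none => simp
    | some x => simp [ih]

/-- The states of the automaton: `some false` while no blank has been met, `some true` once the
blank has been replaced and the rest has to be copied, `none` after a mismatch. -/
theorem aut_fillFirst (b : Bool) : AutFun (fillFirst b) := by
  refine ⟨Option Bool, inferInstance, some false, fun s w => s.bind fun d =>
    if d then (if w.1 = w.2 then some true else none)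
    else match w.1 with
      | none => if w.2 = some b then some true else none
      | some x => if w.2 = some x then some false else none, fun s => s ≠ none, fun N w => ?_⟩
  have hnone : ∀ N (w : Fin N → Option Bool × Option Bool), wordRun (fun (s : Option Bool) w =>
      s.bind fun d =>
      if d then (if w.1 = w.2 then some true else none)
      else match w.1 with
      | none => if w.2 = some b then some true else none
      | some x => if w.2 = some x then some false else none) none N w = none := by
    intro N
    induction N with
    | zero => intro w; rfl
    | succ N ih => intro w; exact ih _
  have htrue : ∀ N (w : Fin N → Option Bool × Option Bool), (wordRun (fun (s : Option Bool) w =>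
      s.bind fun d =>
      if d then (if w.1 = w.2 then some true else none)
      else match w.1 with
      | none => if w.2 = some b then some true else none
      | some x => if w.2 = some x then some false else none) (some true) N w ≠ none) ↔
      (fun t => (w t).1) = fun t => (w t).2 := by
    intro N
    induction N with
    | zero => intro w; simp [wordRun, funext_iff]
    | succ N ih =>
      intro w
      rw [wordRun, funext_iff, Fin.forall_fin_succ, ← funext_iff]
      simp only [Option.bind_some, if_true]
      split_ifs with h
      · rw [ih]; simp [h, Fin.tail, funext_iff]
      · rw [hnone]; simp [h]
  apply propext
  induction N with
  | zero => simp [wordRun, funext_iff]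
  | succ N ih =>
    beta_reduce at ih ⊢
    rw [wordRun, funext_iff, Fin.forall_fin_succ]
    simp only [Option.bind_some, Bool.false_eq_true, if_false, fillFirst]
    cases h : (w 0).1 with
    | none =>
      simp only [Fin.cons_zero, Fin.cons_succ]
      split_ifs with h2
      · rw [htrue]; simp [h2, Fin.tail, funext_iff]
      · rw [hnone]; simp [Ne.symm h2]
    | some x =>
      simp only [Fin.cons_zero, Fin.cons_succ]
      split_ifs with h2
      · rw [← ih]; simp only [h2, true_and, funext_iff]; rfl
      · rw [hnone]; simp [Ne.symm h2]

/-- Completions of a partial assignment. -/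
def Completes {N : ℕ} (v : Fin N → Bool) (u : Fin N → Option Bool) : Prop :=
  ∀ t x, u t = some x → v t = x

theorem completes_iff {N : ℕ} {v : Fin N → Bool} {u : Fin N → Option Bool} (hu : blanks u ≠ 0) :
    Completes v u ↔ Completes v (fillFirst false N u) ∨ Completes v (fillFirst true N u) := by
  induction N with
  | zero => simp [blanks] at hu
  | succ N ih =>
    simp only [Completes, Fin.forall_fin_succ, fillFirst]
    cases h : u 0 with
    | none =>
      simp only [reduceCtorEq, false_imp_iff, implies_true, true_and, Fin.cons_zero, Fin.cons_succ,
        Option.some.injEq, forall_eq', Fin.tail]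
      cases v 0 <;> simp
    | some x =>
      simp only [Fin.cons_zero, Fin.cons_succ, Option.some.injEq, forall_eq']
      have hu' : blanks (Fin.tail u) ≠ 0 := by
        rw [blanks_succ, h] at hu
        simpa using hu
      have := ih (v := Fin.tail v) hu'
      simp only [Completes] at this
      rw [← and_or_left]
      exact and_congr_right fun _ => this

theorem completes_of_full {N : ℕ} {v : Fin N → Bool} {u : Fin N → Option Bool}
    (hu : blanks u = 0) : Completes v u ↔ v = fun t => (u t).getD false := by
  rw [blanks_eq_zero] at hu
  rw [funext_iff]
  refine forall_congr' fun t => ?_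
  cases h : u t with
  | none => exact absurd h (hu t)
  | some x => simp

theorem reg_blanks {B : Type} (g : B → Option Bool) :
    RegFun (fun N (u : Fin N → B) => blanks (fun t => g (u t)) = 0) :=
  (RegFun.forall_letter (fun b => g b ≠ none)).congr_iff fun _ _ => blanks_eq_zero

namespace Comp

variable {𝔅 : Base BS A₀} {B : Type} [Inhabited A₀]

/-- The witness is built up bit by bit: for a partial assignment with a blank, the statement is the
disjunction over the two ways to fill the first blank, and a full assignment is a leaf at which `Q`
is evaluated. The number of blanks is the level; it is at most `N`, so the quantifier costs depth
`O(N)`. -/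
theorem ex [Finite B] {Q : ∀ e, (Fin (𝔅.N e) → B × Bool) → Prop} (hQ : Comp 𝔅 Q) :
    Comp 𝔅 (fun e (u : Fin (𝔅.N e) → B) => ∃ v : Fin (𝔅.N e) → Bool, Q e (fun t => (u t, v t))) := by
  obtain ⟨𝒩, V, emb, h1, h2, h3⟩ := hQ
  have key : Comp 𝔅 (fun e (u : Fin (𝔅.N e) → B × Option Bool) =>
      ∃ v : Fin (𝔅.N e) → Bool, Completes v (fun t => (u t).2) ∧
        Q e (fun t => ((u t).1, v t))) := by
    refine Comp.recursion 𝒩 V h2 (L := Bool) (M := Unit) (κ := Prop)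
      (open Classical in fun p => if p then .ext () else .or (.own false) (.own true))
      (fun N u => blanks (fun t => (u t).2) = 0) (reg_blanks Prod.snd)
      (fun b N u t => ((u t).1, fillFirst b N (fun t => (u t).2) t))
      (fun b => (AutFun.letters Prod.fst).pair ((aut_fillFirst b).pre Prod.snd))
      (fun _ N u t => emb ((u t).1, (u t).2.getD false))
      (fun _ => AutFun.letters fun b : B × Option Bool => emb (b.1, b.2.getD false))
      (fun N u => blanks fun t => (u t).2) 1 (fun N u => ?_) (fun N u l hl => ?_) _ ?_
    · have := blanks_le fun t => (u t).2
      omega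
    · rw [blanks_fillFirst]
      split_ifs at hl with h
      · simp [BExpr.subs] at hl
      · omega
    · intro e u
      by_cases h : blanks (fun t => (u t).2) = 0
      · simp only [h, if_true, BExpr.eval, completes_of_full h, exists_eq_left]
        exact (h3 e _).symm
      · simp only [h, if_false, BExpr.eval]
        rw [← exists_or]
        refine exists_congr fun v => ?_
        rw [completes_iff h, or_and_right]
  refine (key.comap (fun b : B => (b, none))).congr fun e u => ?_
  simp [Completes]

end Comp

end

/-! ### Numbers as words -/

/-- A function of words given by recursion from the right is regular. -/
theorem RegFun.foldr {B τ : Type} [Finite τ] {f : ∀ N, (Fin N → B) → τ} (c : τ)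
    (step : B → τ → τ) (h0 : ∀ u, f 0 u = c)
    (h : ∀ N (u : Fin (N + 1) → B), f (N + 1) u = step (u 0) (f N (Fin.tail u))) : RegFun f := by
  -- The automaton reads from the left while the recursion starts at the right end. The state is
  -- therefore the composite of the steps read so far, a map on the finite type `τ`, and is applied
  -- to `c` at the end.
  refine ⟨τ → τ, inferInstance, _root_.id, fun s b => s ∘ step b, fun s => s c, fun N u => ?_⟩
  suffices H : ∀ (s : τ → τ), s (f N u) = wordRun (fun s b => s ∘ step b) s N u c from H _root_.id
  induction N with
  | zero => intro s; rw [h0]; rfl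
  | succ N ih => intro s; rw [wordRun, ← ih, h]; rfl

theorem ofBits_eq_tail {N : ℕ} (u : Fin (N + 1) → Bool) :
    Nat.ofBits u = 2 * Nat.ofBits (Fin.tail u) + (u 0).toNat := Nat.ofBits_succ _

/-- The word of length `N` for the number `m` (modulo `2 ^ N`), least significant bit first. -/
def wordOf (N m : ℕ) : Fin N → Bool := fun t => m.testBit t

theorem ofBits_wordOf {N m : ℕ} (h : m < 2 ^ N) : Nat.ofBits (wordOf N m) = m := by
  show Nat.ofBits (fun t : Fin N => m.testBit t) = m
  rw [Nat.ofBits_testBit, Nat.mod_eq_of_lt h]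

theorem wordOf_ofBits {N : ℕ} (u : Fin N → Bool) : wordOf N (Nat.ofBits u) = u := by
  funext t
  simp [wordOf]

theorem ofBits_const_false (N : ℕ) : Nat.ofBits (fun _ : Fin N => false) = 0 := by
  induction N with
  | zero => rfl
  | succ N ih =>
    rw [ofBits_eq_tail, show Fin.tail (fun _ : Fin (N + 1) => false) = fun _ => false from rfl, ih]
    rfl

/-- The recursion computes, for each incoming carry `d < 3`, whether the equation holds. Three
carries suffice because `(1 + 1 + 2) / 2 = 2`; a nonzero carry at the end means that the sum does
not fit and the equation fails. -/
theorem RegFun.add {c : ℕ} (hc : c ≤ 2) : RegFun (fun N (u : Fin N → Bool × Bool × Bool) =>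
    Nat.ofBits (fun t => (u t).1) + Nat.ofBits (fun t => (u t).2.1) + c =
      Nat.ofBits (fun t => (u t).2.2)) := by
  have h : RegFun (fun N (u : Fin N → Bool × Bool × Bool) (d : Fin 3) =>
      Nat.ofBits (fun t => (u t).1) + Nat.ofBits (fun t => (u t).2.1) + d =
        Nat.ofBits (fun t => (u t).2.2)) := by
    refine RegFun.foldr (fun d => d = 0) (fun b s d =>
      (b.1.toNat + b.2.1.toNat + d) % 2 = b.2.2.toNat ∧
        s ⟨(b.1.toNat + b.2.1.toNat + d) / 2, by
          have := Bool.toNat_le b.1; have := Bool.toNat_le b.2.1; omega⟩) ?_ ?_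
    · intro u
      funext d
      simp only [Nat.ofBits_zero, Nat.zero_add, Fin.ext_iff, Fin.val_zero]
    · intro N u
      funext d
      simp only [ofBits_eq_tail]
      have := Bool.toNat_le (u 0).2.2
      apply propext
      have e : ∀ g : Bool × Bool × Bool → Bool,
        Fin.tail (fun t => g (u t)) = fun t => g (Fin.tail u t) := fun _ => rfl
      rw [e Prod.fst, e (fun x => x.2.1), e (fun x => x.2.2)]
      omega
  exact h.map (fun s => s ⟨c, by omega⟩)

/-- The lowest digits decide whether the higher ones have to satisfy `<` or `≤`; hence the
generalisation by a summand `c` on the right. -/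
theorem RegFun.lt : RegFun (fun N (u : Fin N → Bool × Bool) =>
    Nat.ofBits (fun t => (u t).1) < Nat.ofBits (fun t => (u t).2)) := by
  have h : RegFun (fun N (u : Fin N → Bool × Bool) (c : Bool) =>
      Nat.ofBits (fun t => (u t).1) < Nat.ofBits (fun t => (u t).2) + c.toNat) := by
    refine RegFun.foldr (fun c => c = true)
      (fun b s c => s (decide (b.1.toNat < b.2.toNat + c.toNat))) ?_ ?_
    · intro u
      funext c
      cases c <;> simp
    · intro N u
      funext c
      simp only [ofBits_eq_tail]
      have := Bool.toNat_le (u 0).1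
      have := Bool.toNat_le (u 0).2
      have := Bool.toNat_le c
      apply propext
      have e : ∀ g : Bool × Bool → Bool,
        Fin.tail (fun t => g (u t)) = fun t => g (Fin.tail u t) := fun _ => rfl
      rw [e Prod.fst, e Prod.snd]
      by_cases h : (u 0).1.toNat < (u 0).2.toNat + c.toNat
      · simp only [h, decide_true, Bool.toNat_true]; omega
      · simp only [h, decide_false, Bool.toNat_false]; omega
  exact (h.map (fun s => s false)).congr_iff fun N u => by simp

/-- A word for the truncated difference is recognised by adding `d` back, or, if the number is less
than `d`, by being zero. -/
theorem AutFun.sub {d : ℕ} (hd : d ≤ 2) :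
    AutFun (fun N (u : Fin N → Bool) => wordOf N (Nat.ofBits u - d)) := by
  have h1 := (RegFun.add hd).comap (fun w : Bool × Bool => (w.2, false, w.1))
  have h2 := (RegFun.lt).comap (fun w : Bool × Bool => (false, w.2))
  have h3 : RegFun (fun N (u : Fin N → Bool) => Nat.ofBits u < d) := by
    have h : RegFun (fun N (u : Fin N → Bool) => (⟨min (Nat.ofBits u) 2, by omega⟩ : Fin 3)) := by
      refine RegFun.foldr ⟨0, by omega⟩ (fun b x => ⟨min (2 * x + b.toNat) 2, by omega⟩) ?_ ?_
      · intro u; rfl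
      · intro N u
        simp only [ofBits_eq_tail, Fin.mk.injEq]
        omega
    exact (h.map (fun x => (x : ℕ) < d)).congr_iff fun N u => by
      show _ ↔ min (Nat.ofBits u) 2 < d
      omega
  refine (h1.or ((h3.comap Prod.fst).and h2.not)).congr_iff fun N w => ?_
  simp only [ofBits_const_false]
  have hlt := Nat.ofBits_lt_two_pow fun t => (w t).1
  have : (wordOf N (Nat.ofBits (fun t => (w t).1) - d) = fun t => (w t).2) ↔
      Nat.ofBits (fun t => (w t).1) - d = Nat.ofBits (fun t => (w t).2) := by
    constructor
    · intro h
      rw [← h, ofBits_wordOf (by omega)]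
    · intro h
      rw [h, wordOf_ofBits]
  rw [this]
  omega

/-! ### Predicates of numbers -/

/-- A predicate on tuples of numbers below `2 ^ N e` is computed by a network. -/
def CompN {BS A₀ : Type} (𝔅 : Base BS A₀) {ι : Type} (Q : 𝔅.E → (ι → ℕ) → Prop) : Prop :=
  Comp 𝔅 (fun e (u : Fin (𝔅.N e) → ι → Bool) => Q e (fun x => Nat.ofBits fun t => u t x))

namespace CompN

variable {BS A₀ : Type} {𝔅 : Base BS A₀} {ι ι' : Type}

theorem congr {Q Q' : 𝔅.E → (ι → ℕ) → Prop} (h : CompN 𝔅 Q)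
    (h' : ∀ e v, (∀ x, v x < 2 ^ 𝔅.N e) → (Q' e v ↔ Q e v)) : CompN 𝔅 Q' :=
  Comp.congr h fun e _ => h' e _ fun _ => Nat.ofBits_lt_two_pow _

variable [Inhabited A₀] [Finite ι]

theorem not {Q : 𝔅.E → (ι → ℕ) → Prop} (h : CompN 𝔅 Q) : CompN 𝔅 (fun e v => ¬ Q e v) :=
  Comp.not h

theorem and {Q Q' : 𝔅.E → (ι → ℕ) → Prop} (h : CompN 𝔅 Q) (h' : CompN 𝔅 Q') :
    CompN 𝔅 (fun e v => Q e v ∧ Q' e v) := Comp.and h h'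

theorem or {Q Q' : 𝔅.E → (ι → ℕ) → Prop} (h : CompN 𝔅 Q) (h' : CompN 𝔅 Q') :
    CompN 𝔅 (fun e v => Q e v ∨ Q' e v) := Comp.or h h'

theorem imp {Q Q' : 𝔅.E → (ι → ℕ) → Prop} (h : CompN 𝔅 Q) (h' : CompN 𝔅 Q') :
    CompN 𝔅 (fun e v => Q e v → Q' e v) :=
  (h.not.or h').congr fun _ _ _ => imp_iff_not_or

theorem iff {Q Q' : 𝔅.E → (ι → ℕ) → Prop} (h : CompN 𝔅 Q) (h' : CompN 𝔅 Q') :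
    CompN 𝔅 (fun e v => Q e v ↔ Q' e v) :=
  ((h.imp h').and (h'.imp h)).congr fun _ _ _ => iff_iff_implies_and_implies

theorem rename {Q : 𝔅.E → (ι' → ℕ) → Prop} (h : CompN 𝔅 Q) (σ : ι' → ι) :
    CompN 𝔅 (fun e v => Q e (fun x => v (σ x))) :=
  Comp.comap h (fun b : ι → Bool => fun x => b (σ x))

theorem ex {Q : 𝔅.E → ℕ → (ι → ℕ) → Prop}
    (h : CompN 𝔅 (fun e (v : Option ι → ℕ) => Q e (v none) (fun x => v (some x)))) :
    CompN 𝔅 (fun e v => ∃ m, m < 2 ^ 𝔅.N e ∧ Q e m v) := by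
  refine (Comp.ex (Comp.comap h (fun b : (ι → Bool) × Bool => fun o => o.elim b.2 b.1))).congr
    fun e u => ?_
  constructor
  · rintro ⟨m, hm, h⟩
    refine ⟨wordOf _ m, ?_⟩
    simpa only [Option.elim_none, Option.elim_some, ofBits_wordOf hm] using h
  · rintro ⟨v, h⟩
    exact ⟨_, Nat.ofBits_lt_two_pow v, h⟩

theorem all {Q : 𝔅.E → ℕ → (ι → ℕ) → Prop}
    (h : CompN 𝔅 (fun e (v : Option ι → ℕ) => Q e (v none) (fun x => v (some x)))) :
    CompN 𝔅 (fun e v => ∀ m, m < 2 ^ 𝔅.N e → Q e m v) :=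
  (CompN.ex (Q := fun e m v => ¬ Q e m v) h.not).not.congr fun e v _ => by push Not; rfl

theorem lt (x y : ι) : CompN 𝔅 (fun _ v => v x < v y) :=
  Comp.regular (RegFun.lt.comap fun b : ι → Bool => (b x, b y))

theorem add (x y z : ι) : CompN 𝔅 (fun _ v => v x + v y = v z) :=
  Comp.regular ((RegFun.add (c := 0) (by omega)).comap fun b : ι → Bool => (b x, b y, b z))

theorem succ (x y : ι) : CompN 𝔅 (fun _ v => v x + 1 = v y) :=
  (Comp.regular ((RegFun.add (c := 1) (by omega)).comap
    fun b : ι → Bool => (b x, false, b y))).congr fun e u => by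
      simp only [ofBits_const_false, Nat.add_zero]

theorem zero (x : ι) : CompN 𝔅 (fun _ v => v x = 0) :=
  (CompN.ex (Q := fun _ m v => m < v x) (lt none (some x))).not.congr fun e v h => by
    push Not
    constructor
    · intro h m _; omega
    · intro h'; have := h' 0 (by positivity); omega

theorem const (p : Prop) : CompN 𝔅 (fun _ (_ : ι → ℕ) => p) :=
  Comp.regular (RegFun.const p)

end CompN

/-! ### Bits of integers -/

/-- Bit number `i` of `z` in two's complement. -/
def ZBit (z : ℤ) (i : ℕ) : Prop := z / 2 ^ i % 2 = 1

theorem zbit_natCast (m i : ℕ) : ZBit m i ↔ m.testBit i = true := by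
  rw [Nat.testBit_eq_decide_div_mod_eq, decide_eq_true_iff, ZBit]
  norm_cast

theorem ediv_two_pow_succ (z : ℤ) (i : ℕ) : z / 2 ^ (i + 1) = z / 2 ^ i / 2 := by
  rw [pow_succ, Int.ediv_ediv_of_nonneg (by positivity)]

/-- The carry into position `i` of the sum of two numbers with the given bits. -/
def Carry (p q : ℕ → Prop) (i : ℕ) : Prop :=
  ∃ j, j < i ∧ (p j ∧ q j) ∧ ∀ k, k < i → j < k → p k ∨ q k

theorem carry_succ (p q : ℕ → Prop) (i : ℕ) :
    Carry p q (i + 1) ↔ (p i ∧ q i) ∨ (Carry p q i ∧ (p i ∨ q i)) := by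
  constructor
  · rintro ⟨j, hj, h, hk⟩
    rcases Nat.lt_succ_iff_lt_or_eq.1 hj with hj | rfl
    · exact .inr ⟨⟨j, hj, h, fun k hk' => hk k (by omega)⟩, hk i (by omega) hj⟩
    · exact .inl h
  · rintro (h | ⟨⟨j, hj, h, hk⟩, hi⟩)
    · exact ⟨i, by omega, h, fun k h1 h2 => by omega⟩
    · refine ⟨j, by omega, h, fun k h1 h2 => ?_⟩
      rcases Nat.lt_succ_iff_lt_or_eq.1 h1 with h1 | rfl
      · exact hk k h1 h2
      · exact hi

-- The carry is generated at some position `j` and propagated by all later ones. Describing it by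
-- two quantifiers (`Carry`) instead of a recursion along the positions makes the depth logarithmic.
open Classical in
theorem add_ediv_two_pow (z w : ℤ) (i : ℕ) : (z + w) / 2 ^ i =
    z / 2 ^ i + w / 2 ^ i + if Carry (ZBit z) (ZBit w) i then 1 else 0 := by
  induction i with
  | zero => simp [Carry]
  | succ i ih =>
    rw [ediv_two_pow_succ, ih, ediv_two_pow_succ z, ediv_two_pow_succ w]
    simp only [carry_succ]
    by_cases h : Carry (ZBit z) (ZBit w) i
    · simp only [h, if_true, true_and, ZBit]
      split_ifs <;> omega
    · simp only [h, if_false, false_and, or_false, ZBit]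
      split_ifs <;> omega

theorem zbit_add (z w : ℤ) (i : ℕ) :
    ZBit (z + w) i ↔ ((ZBit z i ↔ ZBit w i) ↔ Carry (ZBit z) (ZBit w) i) := by
  classical
  rw [ZBit, add_ediv_two_pow]
  by_cases h : Carry (ZBit z) (ZBit w) i
  · rw [if_pos h]; simp only [h, iff_true, ZBit]; omega
  · rw [if_neg h]; simp only [h, iff_false, ZBit]; omega

theorem neg_sub_one_ediv (z : ℤ) (i : ℕ) : (-z - 1) / 2 ^ i = -(z / 2 ^ i) - 1 := by
  induction i with
  | zero => simp
  | succ i ih => rw [ediv_two_pow_succ, ih, ediv_two_pow_succ]; omega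

theorem zbit_compl (z : ℤ) (i : ℕ) : ZBit (-z - 1) i ↔ ¬ ZBit z i := by
  rw [ZBit, ZBit, neg_sub_one_ediv]; omega

theorem zbit_half (z : ℤ) (i : ℕ) : ZBit (z / 2) i ↔ ZBit z (i + 1) := by
  rw [ZBit, ZBit, pow_succ', Int.ediv_ediv_of_nonneg (by norm_num)]

theorem zbit_indicator (p : Prop) [Decidable p] (i : ℕ) :
    ZBit (if p then 1 else 0) i ↔ i = 0 ∧ p := by
  split_ifs with h
  · simp only [h, and_true, ZBit]
    cases i with
    | zero => simp
    | succ i =>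
      have : (1 : ℤ) / 2 ^ (i + 1) = 0 := by
        apply Int.ediv_eq_zero_of_lt (by norm_num)
        exact one_lt_pow₀ (by norm_num) (by omega)
      simp [this]
  · simp [ZBit, h]

/-- The number with the bits `p i`, `i < m`. -/
noncomputable def bitSum (m : ℕ) (p : ℕ → Prop) : ℕ :=
  open Classical in ∑ i ∈ Finset.range m, if p i then 2 ^ i else 0

@[simp] theorem bitSum_zero (p : ℕ → Prop) : bitSum 0 p = 0 := rfl

open Classical in
theorem bitSum_succ (m : ℕ) (p : ℕ → Prop) :
    bitSum (m + 1) p = bitSum m p + if p m then 2 ^ m else 0 := Finset.sum_range_succ _ _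

open Classical in
theorem bitSum_zbit (z : ℤ) (m : ℕ) : (bitSum m (ZBit z) : ℤ) + 2 ^ m * (z / 2 ^ m) = z := by
  induction m with
  | zero => simp
  | succ m ih =>
    rw [bitSum_succ, ediv_two_pow_succ, pow_succ]
    push_cast
    by_cases hz : ZBit z m
    · have h : z / 2 ^ m = 2 * (z / 2 ^ m / 2) + 1 := by rw [ZBit] at hz; omega
      rw [h] at ih
      rw [if_pos hz]
      linarith
    · have h : z / 2 ^ m = 2 * (z / 2 ^ m / 2) := by rw [ZBit] at hz; omega
      rw [h] at ih
      rw [if_neg hz]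
      linarith

theorem bitSum_congr {m : ℕ} {p q : ℕ → Prop} (h : ∀ i, i < m → (p i ↔ q i)) :
    bitSum m p = bitSum m q := by
  classical
  exact Finset.sum_congr rfl fun i hi => if_congr (h i (Finset.mem_range.1 hi)) rfl rfl

theorem bitSum_lt (m : ℕ) (p : ℕ → Prop) : bitSum m p < 2 ^ m := by
  induction m with
  | zero => simp
  | succ m ih =>
    rw [bitSum_succ, pow_succ]
    split_ifs <;> omega

open Classical in
theorem testBit_bitSum (m : ℕ) (p : ℕ → Prop) (i : ℕ) :
    (bitSum m p).testBit i = true ↔ i < m ∧ p i := by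
  induction m with
  | zero => simp
  | succ m ih =>
    have hlt := bitSum_lt m p
    rw [bitSum_succ]
    rcases lt_trichotomy i m with h | rfl | h
    · have : (bitSum m p + if p m then 2 ^ m else 0).testBit i = (bitSum m p).testBit i := by
        split_ifs
        · rw [Nat.add_comm, Nat.testBit_two_pow_add_gt h]
        · rfl
      rw [this, ih]
      simp [h, h.le]
    · have h0 : (bitSum i p).testBit i = false := Nat.testBit_lt_two_pow hlt
      split_ifs with hp
      · rw [Nat.add_comm, Nat.testBit_two_pow_add_eq]
        simp [h0, hp]
      · simp [h0, hp]
    · have : (bitSum m p + if p m then 2 ^ m else 0) < 2 ^ i := by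
        have : 2 ^ (m + 1) ≤ 2 ^ i := Nat.pow_le_pow_right (by norm_num) h
        rw [pow_succ] at this
        split_ifs <;> omega
      rw [Nat.testBit_lt_two_pow this]
      simp; omega

theorem zbit_eq_of_modEq {m : ℕ} {z w : ℤ} (h : z ≡ w [ZMOD 2 ^ m]) {i : ℕ} (hi : i < m) :
    ZBit z i ↔ ZBit w i := by
  obtain ⟨c, hc⟩ := h.dvd
  obtain ⟨d, rfl⟩ := Nat.exists_eq_add_of_lt hi
  have : w = z + 2 ^ i * (2 * (2 ^ d * c)) := by
    rw [eq_add_of_sub_eq' hc]; ring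
  rw [ZBit, ZBit, this, Int.add_mul_ediv_left _ _ (by positivity)]
  omega

/-- The bits of an integer which depends on a number below `2 ^ N e`, in positions below `2 ^ N e`,
are computed by a network. -/
def CompZ {BS A₀ : Type} (𝔅 : Base BS A₀) (z : 𝔅.E → ℕ → ℤ) : Prop :=
  CompN 𝔅 (fun e (v : Bool → ℕ) => ZBit (z e (v false)) (v true))

namespace CompZ

variable {BS A₀ : Type} {𝔅 : Base BS A₀} {ι : Type} {z w : 𝔅.E → ℕ → ℤ}

/-- Only the first `2 ^ N` bits are observed, so integers need to be known only modulo `2 ^ 2 ^ N`.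
This lets products be computed with overflow. -/
theorem congr_modEq (hz : CompZ 𝔅 z)
    (h : ∀ e k, k < 2 ^ 𝔅.N e → w e k ≡ z e k [ZMOD 2 ^ 2 ^ 𝔅.N e]) : CompZ 𝔅 w :=
  CompN.congr hz fun e _ hv => zbit_eq_of_modEq (h e _ (hv false)) (hv true)

theorem congr (hz : CompZ 𝔅 z) (h : ∀ e k, k < 2 ^ 𝔅.N e → w e k = z e k) : CompZ 𝔅 w :=
  hz.congr_modEq fun e k hk => by rw [h e k hk]

variable [Inhabited A₀]

theorem bit [Finite ι] (hz : CompZ 𝔅 z) (x y : ι) :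
    CompN 𝔅 (fun e v => ZBit (z e (v x)) (v y)) :=
  (CompN.rename hz fun b => cond b y x).congr fun _ _ _ => Iff.rfl

theorem add (hz : CompZ 𝔅 z) (hw : CompZ 𝔅 w) : CompZ 𝔅 (fun e k => z e k + w e k) := by
  have h : CompN 𝔅 (fun e (v : Bool → ℕ) =>
      Carry (ZBit (z e (v false))) (ZBit (w e (v false))) (v true)) := by
    have h1 : CompN 𝔅 (fun e (v : Option Bool → ℕ) => ∀ k, k < 2 ^ 𝔅.N e → k < v (some true) →
        v none < k → ZBit (z e (v (some false))) k ∨ ZBit (w e (v (some false))) k) :=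
      CompN.all (Q := fun e k v => k < v (some true) → v none < k →
          ZBit (z e (v (some false))) k ∨ ZBit (w e (v (some false))) k)
        ((CompN.lt none (some (some true))).imp ((CompN.lt (some none) none).imp
          ((hz.bit (some (some false)) none).or (hw.bit (some (some false)) none))))
    have h2 := CompN.ex (Q := fun e j v => j < v true ∧
        (ZBit (z e (v false)) j ∧ ZBit (w e (v false)) j) ∧
        ∀ k, k < 2 ^ 𝔅.N e → k < v true → j < k → ZBit (z e (v false)) k ∨ ZBit (w e (v false)) k)
      ((CompN.lt none (some true)).and
        (((hz.bit (some false) none).and (hw.bit (some false) none)).and h1))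
    refine h2.congr fun e v hv => ?_
    have := hv true
    constructor
    · rintro ⟨j, hj, h, hk⟩
      exact ⟨j, hj.trans this, hj, h, fun k _ => hk k⟩
    · rintro ⟨j, _, hj, h, hk⟩
      exact ⟨j, hj, h, fun k hk' => hk k (hk'.trans this) hk'⟩
  exact ((CompN.iff hz hw).iff h).congr fun e v _ => zbit_add _ _ _

theorem compl (hz : CompZ 𝔅 z) : CompZ 𝔅 (fun e k => -z e k - 1) :=
  (CompN.not hz).congr fun _ _ _ => zbit_compl _ _

/-- Complementing all bits is `z ↦ -z - 1`, and `z - w` is the complement of the sum of `w` and the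
complement of `z`; so addition suffices. -/
theorem sub (hz : CompZ 𝔅 z) (hw : CompZ 𝔅 w) : CompZ 𝔅 (fun e k => z e k - w e k) :=
  (hz.compl.add hw).compl.congr fun e k _ => by ring

open Classical in
theorem indicator {P : 𝔅.E → ℕ → Prop} (h : CompN 𝔅 (fun e (v : Unit → ℕ) => P e (v ()))) :
    CompZ 𝔅 (fun e k => if P e k then 1 else 0) :=
  ((CompN.zero true).and (h.rename fun _ => false)).congr fun _ _ _ => zbit_indicator _ _

theorem const (c : ℤ) : CompZ 𝔅 (fun _ _ => c) := by
  have h0 : CompZ 𝔅 (fun _ _ => (0 : ℤ)) :=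
    (CompN.const False).congr fun e v _ => by simp [ZBit]
  have h1 : CompZ 𝔅 (fun _ _ => (1 : ℤ)) :=
    (indicator (P := fun _ _ => True) (CompN.const True)).congr fun e => by simp
  induction c with
  | zero => exact h0
  | succ i ih => exact ih.add h1
  | pred i ih => exact ih.sub h1

/-- Division by such a power of two leaves `0` or `-1`: all bits from position `m` on repeat the
sign. -/
theorem zbit_neg_iff {z : ℤ} {m i : ℕ} (h1 : -2 ^ m ≤ z) (h2 : z < 2 ^ m) (hi : m ≤ i) :
    ZBit z i ↔ z < 0 := by
  have h3 : (2 : ℤ) ^ m ≤ 2 ^ i := pow_le_pow_right₀ (by norm_num) hi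
  have h4 : (0 : ℤ) < 2 ^ i := by positivity
  rw [ZBit]
  rcases lt_or_ge z 0 with h | h
  · have : z / 2 ^ i = -1 := by
      rw [Int.ediv_eq_iff_of_pos h4]; constructor <;> linarith
    simp [this, h]
  · rw [Int.ediv_eq_zero_of_lt h (by linarith)]
    simp; omega

theorem eq_zero_of_zbit {z : ℤ} {m : ℕ} (h1 : -2 ^ m ≤ z) (h2 : z < 2 ^ m)
    (h : ∀ i, i ≤ m → ¬ ZBit z i) : z = 0 := by
  have h0 : 0 ≤ z := by
    have := h m le_rfl
    rw [zbit_neg_iff h1 h2 le_rfl] at this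
    omega
  obtain ⟨n, rfl⟩ := Int.eq_ofNat_of_zero_le h0
  simp only [zbit_natCast] at h
  norm_cast at h2 ⊢
  refine Nat.eq_of_testBit_eq fun i => ?_
  rw [Nat.zero_testBit]
  rcases le_or_gt i m with hi | hi
  · simpa using h i hi
  · exact Nat.testBit_lt_two_pow (h2.trans (Nat.pow_lt_pow_right (by norm_num) hi))

/-- The integers are less than `2 ^ (2 ^ N e - 1)` in absolute value. -/
def Fits (𝔅 : Base BS A₀) (z : 𝔅.E → ℕ → ℤ) : Prop :=
  ∀ e k, k < 2 ^ 𝔅.N e → -2 ^ (2 ^ 𝔅.N e - 1) ≤ z e k ∧ z e k < 2 ^ (2 ^ 𝔅.N e - 1)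

/-- Definable as the position with no larger one below the bound of the quantifiers. -/
theorem last [Finite ι] (x : ι) : CompN 𝔅 (fun e v => v x = 2 ^ 𝔅.N e - 1) :=
  (CompN.ex (Q := fun _ m v => v x < m) (CompN.lt (some x) none)).not.congr fun e v hv => by
    have := hv x
    push Not
    constructor
    · intro h m hm; omega
    · intro h
      have := h (2 ^ 𝔅.N e - 1) (by omega)
      omega

/-- Bit `i` of the half is bit `i + 1`. At the last position that bit is out of reach, but by `Fits`
both bits equal the sign there. -/
theorem half (hz : CompZ 𝔅 z) (hb : Fits 𝔅 z) : CompZ 𝔅 (fun e k => z e k / 2) := by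
  have h1 := CompN.ex (Q := fun e m v => v true + 1 = m ∧ ZBit (z e (v false)) m)
    ((CompN.succ (some true) none).and (hz.bit (some false) none))
  refine (h1.or ((last true).and hz)).congr fun e v hv => ?_
  have := hv true
  have hb := hb e _ (hv false)
  rw [zbit_half]
  constructor
  · intro h
    by_cases h' : v true + 1 < 2 ^ 𝔅.N e
    · exact .inl ⟨_, h', rfl, h⟩
    · refine .inr ⟨by omega, ?_⟩
      rwa [zbit_neg_iff hb.1 hb.2 (by omega)] at h ⊢
  · rintro (⟨m, hm, rfl, h⟩ | ⟨h', h⟩)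
    · exact h
    · rwa [zbit_neg_iff hb.1 hb.2 (by omega)] at h ⊢

/-- An integer is positive iff its sign bit, found at the last position by `Fits`, is clear and some
bit is set. -/
theorem pos (hz : CompZ 𝔅 z) (hb : Fits 𝔅 z) :
    CompN 𝔅 (fun e (v : Unit → ℕ) => 0 < z e (v ())) := by
  have h1 := CompN.ex (ι := Unit) (Q := fun e m v => m = 2 ^ 𝔅.N e - 1 ∧ ¬ ZBit (z e (v ())) m)
    ((last none).and (hz.bit (some ()) none).not)
  have h2 := CompN.ex (ι := Unit) (Q := fun e m v => ZBit (z e (v ())) m) (hz.bit (some ()) none)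
  refine (h1.and h2).congr fun e v hv => ?_
  have hpos : 0 < 2 ^ 𝔅.N e := by positivity
  have hb := hb e _ (hv ())
  constructor
  · intro h
    refine ⟨⟨_, by omega, rfl, ?_⟩, ?_⟩
    · rw [zbit_neg_iff hb.1 hb.2 le_rfl]; omega
    · by_contra h'
      push Not at h'
      have := eq_zero_of_zbit hb.1 hb.2 fun i hi => h' i (by omega)
      omega
  · rintro ⟨⟨m, _, rfl, h⟩, m', hm', h'⟩
    rw [zbit_neg_iff hb.1 hb.2 le_rfl] at h
    rcases lt_or_eq_of_le (not_lt.1 h) with h0 | h0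
    · exact h0
    · rw [← h0] at h'
      simp [ZBit] at h'

theorem sign (hz : CompZ 𝔅 z) (hb : Fits 𝔅 z) : CompZ 𝔅 (fun e k => sg (z e k)) :=
  (indicator (P := fun e k => 0 < z e k) (hz.pos hb)).congr fun _ _ _ => by
    unfold sg
    split_ifs <;> rfl

end CompZ

/-! ### Iterated addition by a tree of carry-save adders -/

def xor₃ (p q r : Prop) : Prop := p ↔ (q ↔ r)

def maj₃ (p q r : Prop) : Prop := (p ∧ q) ∨ (r ∧ (p ∨ q))

/-- Replacing three summands by two; bits of the summands are given. -/
def carrySave (p q r : ℕ → Prop) (c : Bool) (i : ℕ) : Prop :=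
  if c then 1 ≤ i ∧ maj₃ (p (i - 1)) (q (i - 1)) (r (i - 1)) else xor₃ (p i) (q i) (r i)

theorem bitSum_succ' (m : ℕ) (p : ℕ → Prop) :
    bitSum (m + 1) (fun i => 1 ≤ i ∧ p (i - 1)) = 2 * bitSum m p := by
  classical
  induction m with
  | zero => simp [bitSum_succ]
  | succ m ih =>
    rw [bitSum_succ, ih, bitSum_succ]
    simp only [Nat.le_add_left, true_and, Nat.add_sub_cancel]
    split_ifs <;> ring

theorem bitSum_succ_modEq (m : ℕ) (p : ℕ → Prop) : bitSum (m + 1) p ≡ bitSum m p [MOD 2 ^ m] := by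
  rw [bitSum_succ]
  split_ifs
  · simp [Nat.ModEq]
  · rfl

/-- Bitwise, `p + q + r` is the parity plus twice the majority. The shift moves the top majority bit
to position `m`, where it is cut off; hence a congruence only. -/
theorem bitSum_carrySave (m : ℕ) (p q r : ℕ → Prop) :
    bitSum m (carrySave p q r false) + bitSum m (carrySave p q r true) ≡
      bitSum m p + bitSum m q + bitSum m r [MOD 2 ^ m] := by
  have h1 : bitSum m p + bitSum m q + bitSum m r = bitSum m (carrySave p q r false) +
      2 * bitSum m (fun i => maj₃ (p i) (q i) (r i)) := by
    induction m with
    | zero => rfl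
    | succ m ih =>
      simp only [bitSum_succ, carrySave, xor₃, maj₃] at ih ⊢
      by_cases hp : p m <;> by_cases hq : q m <;> by_cases hr : r m <;>
        simp [hp, hq, hr] <;> omega
  have h2 := bitSum_succ_modEq m (carrySave p q r true)
  have h3 : bitSum (m + 1) (carrySave p q r true) = 2 * bitSum m (fun i => maj₃ (p i) (q i) (r i)) := by
    rw [← bitSum_succ']
    exact bitSum_congr fun i _ => by simp [carrySave]
  rw [h1, ← h3]
  exact Nat.ModEq.add_left _ h2.symm

/-- Two numbers whose sum is that of the numbers with the bits `T v`, for all completions `v` of the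
partial assignment `u` with `k` blanks. -/
def carrySaveTree {N : ℕ} (T : (Fin N → Bool) → ℕ → Prop) :
    ℕ → (Fin N → Option Bool) → Bool → ℕ → Prop
  | 0, u, c, i => if c then False else T (fun t => (u t).getD false) i
  | k + 1, u, c, i =>
    let x := carrySaveTree T k (fillFirst false N u)
    let y := carrySaveTree T k (fillFirst true N u)
    let s := carrySave (x false) (x true) (y false)
    carrySave (s false) (s true) (y true) c i

theorem not_completes_both {N : ℕ} {v : Fin N → Bool} {u : Fin N → Option Bool}
    (hu : blanks u ≠ 0) (h0 : Completes v (fillFirst false N u))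
    (h1 : Completes v (fillFirst true N u)) : False := by
  induction N with
  | zero => simp [blanks] at hu
  | succ N ih =>
    simp only [Completes, Fin.forall_fin_succ, fillFirst] at h0 h1
    cases h : u 0 with
    | none =>
      simp only [h, Fin.cons_zero, Option.some.injEq, forall_eq'] at h0 h1
      simp [h0.1] at h1
    | some x =>
      simp only [h, Fin.cons_zero, Fin.cons_succ] at h0 h1
      refine ih (v := Fin.tail v) (u := Fin.tail u) ?_ h0.2 h1.2
      rw [blanks_succ, h] at hu
      simpa using hu

-- At a leaf the two numbers are the summand and `0`. At an inner node the completions of `u` split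
-- according to the first blank, and two carry-save adders reduce the four numbers of the two
-- subtrees to two, keeping the sum modulo `2 ^ m`. A level of the tree thus costs constant depth,
-- and only one carry propagation is needed, at the root.
open Classical in
theorem bitSum_carrySaveTree {N : ℕ} (T : (Fin N → Bool) → ℕ → Prop) (m k : ℕ)
    (u : Fin N → Option Bool) (hk : blanks u = k) :
    bitSum m (carrySaveTree T k u false) + bitSum m (carrySaveTree T k u true) ≡
      ∑ v with Completes v u, bitSum m (T v) [MOD 2 ^ m] := by
  induction k generalizing u with
  | zero =>
    have h : Finset.univ.filter (fun v => Completes v u) = {fun t => (u t).getD false} := by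
      ext v
      simp [completes_of_full hk]
    rw [h, Finset.sum_singleton]
    have h0 : bitSum m (carrySaveTree T 0 u true) = 0 := by
      refine Nat.eq_of_testBit_eq fun i => ?_
      rw [Bool.eq_iff_iff, testBit_bitSum]
      simp [carrySaveTree]
    rw [h0]
    rfl
  | succ k ih =>
    have hne : blanks u ≠ 0 := by omega
    have hsplit : Finset.univ.filter (fun v => Completes v u) =
        Finset.univ.filter (fun v => Completes v (fillFirst false N u)) ∪
          Finset.univ.filter (fun v => Completes v (fillFirst true N u)) := by
      ext v
      simp [completes_iff hne]
    rw [hsplit, Finset.sum_union (Finset.disjoint_filter.2 fun v _ h0 h1 =>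
      not_completes_both hne h0 h1)]
    have ihx := ih (fillFirst false N u) (by rw [blanks_fillFirst]; omega)
    have ihy := ih (fillFirst true N u) (by rw [blanks_fillFirst]; omega)
    refine Nat.ModEq.trans ?_ (Nat.ModEq.add ihx ihy)
    set x := carrySaveTree T k (fillFirst false N u)
    set y := carrySaveTree T k (fillFirst true N u)
    have h1 := bitSum_carrySave m (x false) (x true) (y false)
    refine (bitSum_carrySave m _ _ (y true)).trans ?_
    rw [← Nat.add_assoc]
    exact Nat.ModEq.add_right _ h1

theorem sum_words {M : Type*} [AddCommMonoid M] (N : ℕ) (f : ℕ → M) :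
    ∑ v : Fin N → Bool, f (Nat.ofBits v) = ∑ j ∈ Finset.range (2 ^ N), f j :=
  Finset.sum_bij' (fun v _ => Nat.ofBits v) (fun j _ => wordOf N j)
    (fun v _ => Finset.mem_range.2 (Nat.ofBits_lt_two_pow v)) (fun _ _ => Finset.mem_univ _)
    (fun v _ => wordOf_ofBits v) (fun _ hj => ofBits_wordOf (Finset.mem_range.1 hj))
    (fun _ _ => rfl)

theorem zbit_two_pow_mul (z : ℤ) (j i : ℕ) : ZBit (2 ^ j * z) i ↔ j ≤ i ∧ ZBit z (i - j) := by
  rcases le_or_gt j i with h | h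
  · obtain ⟨d, rfl⟩ := Nat.exists_eq_add_of_le h
    rw [ZBit, pow_add, Int.mul_ediv_mul_of_pos _ _ (by positivity)]
    simp [ZBit]
  · obtain ⟨d, rfl⟩ := Nat.exists_eq_add_of_lt h
    have : (2 : ℤ) ^ (i + d + 1) * z = 2 ^ i * (2 * (2 ^ d * z)) := by ring
    rw [ZBit, this, Int.mul_ediv_cancel_left _ (by positivity)]
    constructor
    · intro h; omega
    · intro h; omega

namespace BExpr

variable {L M : Type} (x : L → Prop) (y : M → Prop)

def xor₃ (a b c : BExpr L M) : BExpr L M :=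
  .or (.and a (.or (.and b c) (.and (.not b) (.not c))))
    (.and (.not a) (.or (.and b (.not c)) (.and (.not b) c)))

def maj₃ (a b c : BExpr L M) : BExpr L M := .or (.and a b) (.and c (.or a b))

theorem eval_xor₃ (a b c : BExpr L M) : (xor₃ a b c).eval x y ↔
    LengthODE.xor₃ (a.eval x y) (b.eval x y) (c.eval x y) := by
  simp only [xor₃, eval, LengthODE.xor₃]
  tauto

theorem eval_maj₃ (a b c : BExpr L M) : (maj₃ a b c).eval x y ↔
    LengthODE.maj₃ (a.eval x y) (b.eval x y) (c.eval x y) := Iff.rfl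

open Classical in
noncomputable def guard (p : Prop) (a : BExpr L M) : BExpr L M := if p then a else .const false

theorem eval_guard (p : Prop) (a : BExpr L M) : (guard p a).eval x y ↔ p ∧ a.eval x y := by
  unfold guard
  split_ifs with h <;> simp [h, eval]

end BExpr

/-! ### Networks for carry-save trees and products -/

section

variable {BS A₀ : Type} {𝔅 : Base BS A₀} [Inhabited A₀]

/-- The letters of words for the nodes of a tree of carry-save adders: a partial assignment, a
position, a parameter, and a tag which of the two numbers is meant. -/
abbrev TreeLetter : Type := (Option Bool × Bool × Bool) × Bool

open Classical in
noncomputable def treeTag {N : ℕ} (u : Fin N → TreeLetter) : Bool := decide (∃ t, (u t).2 = true)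

theorem treeTag_const {N : ℕ} (hN : 0 < N) (f : Fin N → Option Bool × Bool × Bool) (c : Bool) :
    treeTag (fun t => (f t, c)) = c := by
  have : Nonempty (Fin N) := ⟨⟨0, hN⟩⟩
  simp [treeTag]

open Classical in
/-- The gates at a node of the tree; `ge₁` and `ge₂` say that the position is at least `1`, `2`. -/
noncomputable def treeExpr (full ge₁ ge₂ : Prop) (c : Bool) :
    BExpr (Bool × Fin 3 × Bool) Unit :=
  if full then (if c then .const false else .ext ())
  else
    -- The atom `(b, d, c)` is the bit at position `i - d` of number `c` in subtree `b`. Two layers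
    -- of adders, each shifting its carries by one place, need the positions `i`, `i - 1` and `i -
    -- 2`.
    let s : Fin 3 → BExpr (Bool × Fin 3 × Bool) Unit := fun d =>
      .xor₃ (.own (false, d, false)) (.own (false, d, true)) (.own (true, d, false))
    let m : Fin 3 → BExpr (Bool × Fin 3 × Bool) Unit := fun d =>
      .maj₃ (.own (false, d, false)) (.own (false, d, true)) (.own (true, d, false))
    if c then .guard ge₁ (.maj₃ (s 1) (.guard ge₂ (m 2)) (.own (true, 1, true)))
    else .xor₃ (s 0) (.guard ge₁ (m 1)) (.own (true, 0, true))

theorem eval_treeExpr_full {full : Prop} (h : full) (ge₁ ge₂ : Prop) (c : Bool)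
    (x : Bool × Fin 3 × Bool → Prop) (y : Unit → Prop) :
    (treeExpr full ge₁ ge₂ c).eval x y ↔ if c then False else y () := by
  cases c <;> simp [treeExpr, BExpr.eval, h]

theorem eval_treeExpr {full : Prop} (h : ¬ full) (i : ℕ) (c : Bool) (f : Bool → Bool → ℕ → Prop)
    (y : Unit → Prop) :
    (treeExpr full (1 ≤ i) (2 ≤ i) c).eval (fun l => f l.1 l.2.2 (i - l.2.1)) y ↔
      carrySave (carrySave (f false false) (f false true) (f true false) false)
        (carrySave (f false false) (f false true) (f true false) true) (f true true) c i := by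
  cases c
  · simp [treeExpr, carrySave, BExpr.eval_xor₃, BExpr.eval_maj₃, BExpr.eval_guard, BExpr.eval, h]
  · simp only [treeExpr, h, if_false, if_true, carrySave, BExpr.eval_xor₃, BExpr.eval_maj₃,
      BExpr.eval_guard, BExpr.eval, Bool.false_eq_true]
    have e1 : i - ((1 : Fin 3) : ℕ) = i - 1 := rfl
    have e2 : i - ((2 : Fin 3) : ℕ) = i - 1 - 1 := rfl
    have e3 : 1 ≤ i - 1 ↔ 2 ≤ i := by omega
    rw [e1, e2, e3]

theorem reg_ge (d : ℕ) (hd : d ≤ 2) :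
    RegFun (fun N (u : Fin N → Bool) => d ≤ Nat.ofBits u) := by
  have h : RegFun (fun N (u : Fin N → Bool) => (⟨min (Nat.ofBits u) 2, by omega⟩ : Fin 3)) := by
    refine RegFun.foldr ⟨0, by omega⟩ (fun b x => ⟨min (2 * x + b.toNat) 2, by omega⟩) ?_ ?_
    · intro u; rfl
    · intro N u
      simp only [ofBits_eq_tail, Fin.mk.injEq]
      omega
  exact (h.map (fun x => d ≤ (x : ℕ))).congr_iff fun N u => by
    show _ ↔ d ≤ min (Nat.ofBits u) 2
    omega

/-- The bits of the two numbers at the nodes of a tree of carry-save adders. -/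
theorem Comp.carrySaveTree (T : ∀ e, ℕ → (Fin (𝔅.N e) → Bool) → ℕ → Prop)
    (hT : Comp 𝔅 (fun e (u : Fin (𝔅.N e) → Bool × Bool × Bool) =>
      T e (Nat.ofBits fun t => (u t).2.2) (fun t => (u t).1) (Nat.ofBits fun t => (u t).2.1))) :
    Comp 𝔅 (fun e (u : Fin (𝔅.N e) → TreeLetter) =>
      LengthODE.carrySaveTree (T e (Nat.ofBits fun t => (u t).1.2.2)) (blanks fun t => (u t).1.1)
        (fun t => (u t).1.1) (treeTag u) (Nat.ofBits fun t => (u t).1.2.1)) := by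
  obtain ⟨𝒩, V, emb, h1, h2, h3⟩ := hT
  have hsub : ∀ d : Fin 3, AutFun (fun N (u : Fin N → Bool) => wordOf N (Nat.ofBits u - d)) :=
    fun d => AutFun.sub (by omega)
  refine Comp.recursion 𝒩 V h2 (L := Bool × Fin 3 × Bool) (M := Unit)
    (κ := (Prop × Prop × Prop) × Bool) (fun k => treeExpr k.1.1 k.1.2.1 k.1.2.2 k.2)
    (fun N u => ((blanks (fun t => (u t).1.1) = 0, 1 ≤ Nat.ofBits fun t => (u t).1.2.1,
      2 ≤ Nat.ofBits fun t => (u t).1.2.1), treeTag u)) ?_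
    (fun l N u t => ((fillFirst l.1 N (fun t => (u t).1.1) t,
      wordOf N ((Nat.ofBits fun t => (u t).1.2.1) - l.2.1) t, (u t).1.2.2), l.2.2)) ?_
    (fun _ N u t => emb ((u t).1.1.getD false, (u t).1.2))
    (fun _ => AutFun.letters fun b : TreeLetter => emb (b.1.1.getD false, b.1.2))
    (fun N u => blanks fun t => (u t).1.1) 1 (fun N u => ?_) (fun N u l hl => ?_) _ ?_
  · refine RegFun.map₂ (RegFun.map₂ (reg_blanks fun b : TreeLetter => b.1.1)
      (RegFun.map₂ ((reg_ge 1 (by omega)).comap fun b : TreeLetter => b.1.2.1)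
        ((reg_ge 2 (by omega)).comap fun b : TreeLetter => b.1.2.1) Prod.mk) Prod.mk) ?_ Prod.mk
    exact ((RegFun.exists_letter (fun b : TreeLetter => b.2 = true)).map
      (fun p => @decide p (Classical.propDecidable p))).congr fun N u => by simp [treeTag]
  · intro l
    exact (((aut_fillFirst l.1).pre fun b : TreeLetter => b.1.1).pair
      (((hsub l.2.1).pre fun b : TreeLetter => b.1.2.1).pair
        (AutFun.letters fun b : TreeLetter => b.1.2.2))).pair (AutFun.letters fun _ => l.2.2)
  · have := blanks_le fun t => (u t).1.1
    omega
  · beta_reduce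
    rw [blanks_fillFirst]
    by_cases h : blanks (fun t => (u t).1.1) = 0
    · exfalso
      simp only [treeExpr, h, if_true] at hl
      split_ifs at hl <;> simp [BExpr.subs] at hl
    · omega
  · intro e u
    by_cases h : blanks (fun t => (u t).1.1) = 0
    · rw [eval_treeExpr_full h, h]
      simp only [LengthODE.carrySaveTree]
      split_ifs
      · rfl
      · exact (h3 e (fun t => ((u t).1.1.getD false, (u t).1.2))).symm
    · obtain ⟨k, hk⟩ := Nat.exists_eq_succ_of_ne_zero h
      have hlt := Nat.ofBits_lt_two_pow fun t => (u t).1.2.1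
      have hw : ∀ d, Nat.ofBits (wordOf (𝔅.N e) ((Nat.ofBits fun t => (u t).1.2.1) - d)) =
          (Nat.ofBits fun t => (u t).1.2.1) - d := fun d => ofBits_wordOf (by omega)
      simp only [blanks_fillFirst, treeTag_const (𝔅.N_pos e), hw]
      rw [eval_treeExpr h _ _ (fun b c i => LengthODE.carrySaveTree (T e _)
        (blanks (fun t => (u t).1.1) - 1) (fillFirst b _ fun t => (u t).1.1) c i), hk]
      rfl

/-- Modulo `2 ^ m` with `m = 2 ^ N`, `z` is the sum of `2 ^ j` over its bits `j < m`, also for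
negative `z`. So the product is congruent to a sum of `m` shifted copies of `w`, which a carry-save
tree over the words of length `N` reduces to two numbers. -/
theorem CompZ.mul {z w : 𝔅.E → ℕ → ℤ} (hz : CompZ 𝔅 z) (hw : CompZ 𝔅 w) :
    CompZ 𝔅 (fun e k => z e k * w e k) := by
  classical
  let T : ∀ e, ℕ → (Fin (𝔅.N e) → Bool) → ℕ → Prop := fun e k v =>
    ZBit (if ZBit (z e k) (Nat.ofBits v) then 2 ^ Nat.ofBits v * w e k else 0)
  have hT : CompN 𝔅 (fun e (v : Fin 3 → ℕ) =>
      ZBit (if ZBit (z e (v 2)) (v 0) then 2 ^ v 0 * w e (v 2) else 0) (v 1)) := by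
    refine ((hz.bit 2 0).and (CompN.ex (Q := fun e m v => v 0 + m = v 1 ∧ ZBit (w e (v 2)) m)
      ((CompN.add (some 0) none (some 1)).and (hw.bit (some 2) none)))).congr fun e v hv => ?_
    by_cases h : ZBit (z e (v 2)) (v 0)
    · simp only [h, if_true, true_and]
      rw [zbit_two_pow_mul]
      have := hv 1
      constructor
      · rintro ⟨h1, h2⟩
        exact ⟨v 1 - v 0, by omega, by omega, h2⟩
      · rintro ⟨m, _, h1, h2⟩
        exact ⟨by omega, by rwa [show v 1 - v 0 = m by omega]⟩
    · simp only [h, if_false, false_and, iff_false]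
      simp [ZBit]
  have hT' := Comp.carrySaveTree T (hT.comap fun b : Bool × Bool × Bool => ![b.1, b.2.1, b.2.2])
  let D : ∀ e, ℕ → Bool → ℕ → Prop := fun e k => carrySaveTree (T e k) (𝔅.N e) fun _ => none
  have hD : ∀ c, CompZ 𝔅 (fun e k => (bitSum (2 ^ 𝔅.N e) (D e k c) : ℤ)) := by
    intro c
    refine Comp.congr (hT'.comap fun b : Bool → Bool => ((none, b true, b false), c)) fun e u => ?_
    beta_reduce
    rw [treeTag_const (𝔅.N_pos e), zbit_natCast, testBit_bitSum]
    have : blanks (fun _ : Fin (𝔅.N e) => (none : Option Bool)) = 𝔅.N e := by simp [blanks]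
    simp only [this, Nat.ofBits_lt_two_pow, true_and]
    rfl
  refine ((hD false).add (hD true)).congr_modEq fun e k _ => ?_
  set m := 2 ^ 𝔅.N e
  have h1 := bitSum_carrySaveTree (T e k) m (𝔅.N e) (fun _ => none) (by simp [blanks])
  have h2 : Finset.univ.filter (fun v => Completes v fun _ : Fin (𝔅.N e) => none) = Finset.univ := by
    simp [Completes]
  rw [h2, sum_words (𝔅.N e) fun j =>
    bitSum m (ZBit (if ZBit (z e k) j then 2 ^ j * w e k else 0))] at h1
  have h3 := (Int.natCast_modEq_iff.2 h1).symm
  push_cast at h3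
  refine Int.ModEq.trans ?_ h3
  have h4 : ∀ x : ℤ, x ≡ bitSum m (ZBit x) [ZMOD 2 ^ m] := fun x =>
    Int.modEq_iff_dvd.2 ⟨-(x / 2 ^ m), by linarith [bitSum_zbit x m]⟩
  have h5 : z e k * w e k ≡ ∑ j ∈ Finset.range m,
      (if ZBit (z e k) j then 2 ^ j * w e k else 0) [ZMOD 2 ^ m] := by
    refine ((h4 (z e k)).mul_right _).trans ?_
    rw [bitSum]
    push_cast
    rw [Finset.sum_mul]
    simp only [ite_mul, zero_mul]
    rfl
  refine h5.trans ?_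
  exact Int.ModEq.sum fun j _ => h4 _

end

/-! ### Strings on tracks of words -/

/-- A string as a word of length `N`, followed by blanks. -/
def pack (N : ℕ) (l : List Bool) : Fin N → Option Bool := fun t => l[(t : ℕ)]?

/-- The string on a track with blanks. -/
def str {N : ℕ} (w : Fin N → Option Bool) : List Bool := (List.ofFn w).reduceOption

theorem pack_nil (N : ℕ) : pack N [] = fun _ => none := by
  funext t
  simp [pack]

theorem tail_pack_cons (N : ℕ) (x : Bool) (l : List Bool) :
    Fin.tail (pack (N + 1) (x :: l)) = pack N l := by
  funext t
  simp [pack, Fin.tail]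

theorem str_succ {N : ℕ} (w : Fin (N + 1) → Option Bool) :
    str w = (w 0).toList ++ str (Fin.tail w) := by
  rw [str, List.ofFn_succ]
  cases h : w 0 with
  | none => rw [List.reduceOption_cons_of_none]; rfl
  | some x => rw [List.reduceOption_cons_of_some]; rfl

theorem str_const_none (N : ℕ) : str (fun _ : Fin N => none) = [] := by
  induction N with
  | zero => rfl
  | succ N ih =>
    rw [str_succ]
    exact ih

theorem str_pack {N : ℕ} {l : List Bool} (h : l.length ≤ N) : str (pack N l) = l := by
  induction N generalizing l with
  | zero =>
    rw [List.length_eq_zero_iff.1 (Nat.le_zero.1 h)]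
    rfl
  | succ N ih =>
    cases l with
    | nil => rw [pack_nil, str_const_none]
    | cons x l =>
      rw [str_succ, tail_pack_cons, ih (by simpa using h)]
      rfl

theorem str_eq_nil_iff {N : ℕ} {w : Fin N → Option Bool} : str w = [] ↔ ∀ t, w t = none := by
  induction N with
  | zero => simp [str]
  | succ N ih =>
    rw [str_succ, Fin.forall_fin_succ, List.append_eq_nil_iff, ih]
    simp [Fin.tail]

/-- All blanks are at the end. -/
def Packed {N : ℕ} (w : Fin N → Option Bool) : Prop := w = pack N (str w)

theorem packed_pack (N : ℕ) (l : List Bool) : Packed (pack N l) := by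
  induction N generalizing l with
  | zero => exact funext fun t => t.elim0
  | succ N ih =>
    cases l with
    | nil => rw [Packed, pack_nil, str_const_none, pack_nil]
    | cons x l =>
      rw [Packed, str_succ, tail_pack_cons]
      funext t
      refine Fin.cases ?_ (fun t => ?_) t
      · simp [pack]
      · have := congrFun (ih l) t
        simpa [pack] using this

theorem packed_succ {N : ℕ} (w : Fin (N + 1) → Option Bool) : Packed w ↔
    (w 0 = none ∧ ∀ t, Fin.tail w t = none) ∨ (w 0 ≠ none ∧ Packed (Fin.tail w)) := by
  cases h : w 0 with
  | none =>
    simp only [true_and, ne_eq, not_true_eq_false, false_and, or_false]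
    constructor
    · intro hw
      have h0 := congrFun hw 0
      rw [h] at h0
      have : str w = [] := by
        simpa [pack] using h0.symm
      rw [str_eq_nil_iff] at this
      exact fun t => this t.succ
    · intro hw
      have : w = pack (N + 1) [] := by
        rw [pack_nil]
        exact funext (Fin.cases h hw)
      rw [this]
      exact packed_pack _ _
  | some x =>
    simp only [reduceCtorEq, false_and, ne_eq, not_false_eq_true, true_and, false_or]
    rw [Packed, Packed, str_succ, h]
    constructor
    · intro hw
      nth_rewrite 1 [hw]
      exact tail_pack_cons _ _ _
    · intro hw
      funext t
      refine Fin.cases ?_ (fun t => ?_) t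
      · simp [h, pack]
      · have := congrFun hw t
        simpa [pack, Fin.tail] using this

/-- A recursion from the right also has to know whether the rest of the word is blank; the pair of
both properties is regular. -/
theorem reg_packed : RegFun (fun N (w : Fin N → Option Bool) => Packed w) := by
  have h : RegFun (fun N (w : Fin N → Option Bool) => (Packed w, ∀ t, w t = none)) := by
    refine RegFun.foldr (True, True) (fun b s => ((b = none ∧ s.2) ∨ (b ≠ none ∧ s.1),
      b = none ∧ s.2)) ?_ ?_
    · intro u
      have : Packed u := funext fun t => t.elim0
      simp [this]
    · intro N u
      rw [packed_succ, Fin.forall_fin_succ]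
      rfl
  exact h.map Prod.fst

/-- The binary representation of a number without leading zeros, as a word with blanks. -/
def canon (N : ℕ) (u : Fin N → Bool) : Fin N → Option Bool := pack N (Nat.bits (Nat.ofBits u))

theorem bits_two_mul_add (m : ℕ) (b : Bool) : Nat.bits (2 * m + b.toNat) =
    if m = 0 ∧ b = false then [] else b :: Nat.bits m := by
  split_ifs with h
  · simp [h.1, h.2]
  · rw [← Nat.bits_append_bit m b (fun hm => by
      cases b
      · exact absurd ⟨hm, rfl⟩ h
      · rfl)]
    congr 1
    rw [Nat.bit_val]

theorem ofBits_eq_zero {N : ℕ} (u : Fin N → Bool) : Nat.ofBits u = 0 ↔ ∀ t, u t = false := by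
  constructor
  · intro h
    have h1 := wordOf_ofBits u
    rw [h] at h1
    intro t
    rw [← h1]
    simp [wordOf]
  · intro h
    rw [show u = fun _ => false from funext h]
    exact ofBits_const_false N

theorem canon_succ {N : ℕ} (u : Fin (N + 1) → Bool) : canon (N + 1) u =
    Fin.cons (if u 0 = false ∧ ∀ t, Fin.tail u t = false then none else some (u 0))
      (canon N (Fin.tail u)) := by
  rw [canon, ofBits_eq_tail, bits_two_mul_add]
  simp only [ofBits_eq_zero, and_comm (a := u 0 = false)]
  split_ifs with h
  · rw [canon, (ofBits_eq_zero _).2 h.1]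
    funext t
    refine Fin.cases ?_ (fun t => ?_) t <;> simp [pack]
  · funext t
    refine Fin.cases ?_ (fun t => ?_) t
    · simp [pack]
    · simp [pack, canon]

-- A digit is replaced by a blank iff it and all higher digits are `0`, so the recursion from the
-- right carries along whether all digits so far vanish.
open Classical in
theorem aut_canon : AutFun canon := by
  have h : RegFun (fun N (w : Fin N → Bool × Option Bool) =>
      (canon N (fun t => (w t).1) = fun t => (w t).2, ∀ t, (w t).1 = false)) := by
    refine RegFun.foldr (True, True) (fun b s =>
      ((if b.1 = false ∧ s.2 then none else some b.1) = b.2 ∧ s.1, b.1 = false ∧ s.2)) ?_ ?_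
    · intro u
      simp [funext_iff]
    · intro N u
      rw [Fin.forall_fin_succ, canon_succ, funext_iff, Fin.forall_fin_succ]
      simp only [Fin.cons_zero, Fin.cons_succ, ← funext_iff]
      rfl
  exact h.map Prod.fst

theorem bits_length_le {m N : ℕ} (h : m < 2 ^ N) : (Nat.bits m).length ≤ N := by
  rw [Nat.size_eq_bits_len]
  exact Nat.size_le.2 h

theorem str_canon {N : ℕ} (u : Fin N → Bool) : str (canon N u) = Nat.bits (Nat.ofBits u) :=
  str_pack (bits_length_le (Nat.ofBits_lt_two_pow u))

theorem canon_wordOf {N m : ℕ} (h : m < 2 ^ N) : canon N (wordOf N m) = pack N (Nat.bits m) := by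
  rw [canon, ofBits_wordOf h]

theorem getD_pack_bits (N m : ℕ) : (fun t => (pack N (Nat.bits m) t).getD false) = wordOf N m := by
  funext t
  rw [pack, wordOf, Nat.testBit_eq_inth, List.getI_eq_getElem?_getD]
  rfl

/-- The track holds a number in binary without leading zeros. -/
def IsCanon {N : ℕ} (w : Fin N → Option Bool) : Prop := canon N (fun t => (w t).getD false) = w

theorem isCanon_iff {N : ℕ} {w : Fin N → Option Bool} :
    IsCanon w ↔ ∃ m, m < 2 ^ N ∧ w = pack N (Nat.bits m) := by
  constructor
  · intro h
    exact ⟨_, Nat.ofBits_lt_two_pow _, h.symm⟩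
  · rintro ⟨m, hm, rfl⟩
    rw [IsCanon, getD_pack_bits, canon_wordOf hm]

theorem isCanon_canon {N : ℕ} (u : Fin N → Bool) : IsCanon (canon N u) :=
  isCanon_iff.2 ⟨_, Nat.ofBits_lt_two_pow _, rfl⟩

theorem reg_isCanon : RegFun (fun N (w : Fin N → Option Bool) => IsCanon w) :=
  aut_canon.graph (fun x : Option Bool => x.getD false) _root_.id

/-- The number on a track with blanks. -/
def trackNum {N : ℕ} (w : Fin N → Option Bool) : ℕ := Nat.ofBits fun t => (w t).getD false

theorem trackNum_pack {N m : ℕ} (h : m < 2 ^ N) : trackNum (pack N (Nat.bits m)) = m := by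
  rw [trackNum, getD_pack_bits, ofBits_wordOf h]

theorem ofDigits_bits (m : ℕ) : Nat.ofDigits 2 ((Nat.bits m).map Bool.toNat) = m := by
  have : (Nat.bits m).map Bool.toNat = Nat.digits 2 m := by
    rw [Nat.digits_two_eq_bits]
    refine List.map_congr_left fun b _ => by cases b <;> rfl
  rw [this, Nat.ofDigits_digits]

theorem exists_track_pair {N : ℕ} {P : (Fin N → Option Bool) → Prop} : (∃ w, P w) ↔
    ∃ u v : Fin N → Bool, P fun t => if u t then some (v t) else none := by
  constructor
  · rintro ⟨w, h⟩
    refine ⟨fun t => (w t).isSome, fun t => (w t).getD false, ?_⟩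
    convert h using 2 with t
    beta_reduce
    cases w t <;> rfl
  · rintro ⟨u, v, h⟩
    exact ⟨_, h⟩

/-- A network for an existential statement about a string. -/
theorem Comp.exTrack {BS A₀ B : Type} {𝔅 : Base BS A₀} [Inhabited A₀] [Finite B]
    {Q : ∀ e, (Fin (𝔅.N e) → B × Option Bool) → Prop} (hQ : Comp 𝔅 Q) :
    Comp 𝔅 (fun e (u : Fin (𝔅.N e) → B) =>
      ∃ w : Fin (𝔅.N e) → Option Bool, Q e (fun t => (u t, w t))) := by
  have h := (hQ.comap (fun x : (B × Bool) × Bool =>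
    (x.1.1, if x.1.2 then some x.2 else none))).ex.ex
  exact h.congr fun e u => exists_track_pair

/-! ### Circuits whose gates are named by words -/

section Words

variable {Γ : Type} {w : ℕ} {p n N : ℕ} (enc : Γ → Fin w → Bool)

open Classical in
noncomputable def wordLabel (lab : (Fin N → Γ) → Label p n) (a : Name) : Label p n :=
  if h : ∃ u : Fin N → Γ, a = encodeWord enc u then lab h.choose else .const false

open Classical in
noncomputable def wordPred (pr : (Fin N → Γ) → Finset (Fin N → Γ)) (a : Name) : Finset Name :=
  if h : ∃ u : Fin N → Γ, a = encodeWord enc u then (pr h.choose).image (encodeWord enc) else ∅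

variable {enc} [NeZero w]

theorem encodeWord_choose (henc : Function.Injective enc) (u : Fin N → Γ)
    (h : ∃ u' : Fin N → Γ, encodeWord enc u = encodeWord enc u') : h.choose = u :=
  (encodeWord_injective enc henc N h.choose_spec).symm

theorem wordLabel_encodeWord (henc : Function.Injective enc)
    (lab : (Fin N → Γ) → Label p n) (u : Fin N → Γ) :
    wordLabel enc lab (encodeWord enc u) = lab u := by
  have h : ∃ u' : Fin N → Γ, encodeWord enc u = encodeWord enc u' := ⟨u, rfl⟩
  rw [wordLabel, dif_pos h, encodeWord_choose henc]

open Classical in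
theorem wordPred_encodeWord (henc : Function.Injective enc)
    (pr : (Fin N → Γ) → Finset (Fin N → Γ)) (u : Fin N → Γ) :
    wordPred enc pr (encodeWord enc u) = (pr u).image (encodeWord enc) := by
  have h : ∃ u' : Fin N → Γ, encodeWord enc u = encodeWord enc u' := ⟨u, rfl⟩
  rw [wordPred, dif_pos h, encodeWord_choose henc]

/-- A circuit whose gates are named by words. -/
structure WordCircuit (p n N : ℕ) (Γ : Type) where
  gates : Finset (Fin N → Γ)
  label : (Fin N → Γ) → Label p n
  pred : (Fin N → Γ) → Finset (Fin N → Γ)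
  numOut : ℕ
  out : Fin numOut → Fin N → Γ
  pred_subset : ∀ u ∈ gates, pred u ⊆ gates
  out_mem : ∀ i, out i ∈ gates
  card_and : ∀ u ∈ gates, label u = .and → (pred u).card = 1 ∨ (pred u).card = 2
  card_or : ∀ u ∈ gates, label u = .or → (pred u).card = 1 ∨ (pred u).card = 2
  card_not : ∀ u ∈ gates, label u = .not → (pred u).card = 1
  card_const : ∀ u ∈ gates, ∀ c, label u = .const c → pred u = ∅
  card_input : ∀ u ∈ gates, ∀ j i, label u = .input j i → pred u = ∅

namespace WordCircuit

variable (W : WordCircuit p n N Γ) (henc : Function.Injective enc)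

open Classical in
noncomputable def toCircuit : Circuit p n where
  gates := W.gates.image (encodeWord enc)
  label := wordLabel enc W.label
  pred := wordPred enc W.pred
  numOut := W.numOut
  out i := encodeWord enc (W.out i)
  pred_subset := by
    simp only [Finset.forall_mem_image, wordPred_encodeWord henc]
    exact fun u hu => Finset.image_subset_image (W.pred_subset u hu)
  out_mem i := Finset.mem_image_of_mem _ (W.out_mem i)
  card_and := by
    simp only [Finset.forall_mem_image, wordLabel_encodeWord henc, wordPred_encodeWord henc,
      Finset.card_image_of_injective _ (encodeWord_injective enc henc N)]
    exact W.card_and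
  card_or := by
    simp only [Finset.forall_mem_image, wordLabel_encodeWord henc, wordPred_encodeWord henc,
      Finset.card_image_of_injective _ (encodeWord_injective enc henc N)]
    exact W.card_or
  card_not := by
    simp only [Finset.forall_mem_image, wordLabel_encodeWord henc, wordPred_encodeWord henc,
      Finset.card_image_of_injective _ (encodeWord_injective enc henc N)]
    exact W.card_not
  card_const := by
    simp only [Finset.forall_mem_image, wordLabel_encodeWord henc, wordPred_encodeWord henc,
      Finset.image_eq_empty]
    exact W.card_const
  card_input := by
    simp only [Finset.forall_mem_image, wordLabel_encodeWord henc, wordPred_encodeWord henc,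
      Finset.image_eq_empty]
    exact W.card_input

theorem mem_gates {a : Name} :
    a ∈ (W.toCircuit henc).gates ↔ ∃ u ∈ W.gates, encodeWord enc u = a := by
  classical
  exact Finset.mem_image

theorem length_of_mem_gates {a : Name} (ha : a ∈ (W.toCircuit henc).gates) : a.length = w * N := by
  obtain ⟨u, _, rfl⟩ := (W.mem_gates henc).1 ha
  exact encodeWord_length enc u

theorem mem_pred {u : Fin N → Γ} {b : Name} : b ∈ (W.toCircuit henc).pred (encodeWord enc u) ↔
    ∃ v ∈ W.pred u, encodeWord enc v = b := by
  classical
  show b ∈ wordPred enc W.pred (encodeWord enc u) ↔ _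
  rw [wordPred_encodeWord henc]
  exact Finset.mem_image

theorem label_eq (u : Fin N → Γ) :
    (W.toCircuit henc).label (encodeWord enc u) = W.label u := wordLabel_encodeWord henc _ u

variable (enc) in
/-- The direct connection language on words. -/
def ConnWord (t : ConnType p) (u : Fin N → Γ) (b : Name) : Prop :=
  match t with
  | .and => W.label u = .and ∧ ∃ v ∈ W.pred u, encodeWord enc v = b
  | .or => W.label u = .or ∧ ∃ v ∈ W.pred u, encodeWord enc v = b
  | .not => W.label u = .not ∧ ∃ v ∈ W.pred u, encodeWord enc v = b
  | .const c => W.label u = .const c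
  | .input j => ∃ i : Fin n, W.label u = .input j i ∧ b = Nat.bits i
  | .output => ∃ i : Fin W.numOut, u = W.out i ∧ b = Nat.bits i

theorem conn_iff (t : ConnType p) (a b : Name) : (W.toCircuit henc).Conn t a b ↔
    ∃ u : Fin N → Γ, a = encodeWord enc u ∧ u ∈ W.gates ∧ W.ConnWord enc t u b := by
  have hinj := encodeWord_injective enc henc N
  unfold Circuit.Conn
  rw [mem_gates]
  constructor
  · rintro ⟨⟨u, hu, rfl⟩, h⟩
    refine ⟨u, rfl, hu, ?_⟩
    cases t
    case output =>
      obtain ⟨i, h1, h2⟩ := h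
      exact ⟨i, hinj h1, h2⟩
    all_goals simpa only [label_eq, mem_pred, ConnWord] using h
  · rintro ⟨u, rfl, hu, h⟩
    refine ⟨⟨u, hu, rfl⟩, ?_⟩
    cases t
    case output =>
      obtain ⟨i, h1, h2⟩ := h
      exact ⟨i, congrArg _ h1, h2⟩
    all_goals simpa only [label_eq, mem_pred, ConnWord] using h

theorem depthLE {d : ℕ} (level : (Fin N → Γ) → ℕ) (h : ∀ u ∈ W.gates, level u ≤ d ∧
    ∀ v ∈ W.pred u, level v < level u) : (W.toCircuit henc).DepthLE d := by
  classical
  have hex : ∀ u, ∃ u' : Fin N → Γ, encodeWord enc u = encodeWord enc u' := fun u => ⟨u, rfl⟩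
  refine ⟨fun a => if h : ∃ u : Fin N → Γ, a = encodeWord enc u then level h.choose else 0, ?_⟩
  simp only [mem_gates, forall_exists_index, and_imp]
  rintro _ u hu rfl
  simp only [mem_pred, forall_exists_index, and_imp, dif_pos (hex u), encodeWord_choose henc]
  refine ⟨(h u hu).1, ?_⟩
  rintro _ v hv rfl
  rw [dif_pos (hex v), encodeWord_choose henc]
  exact (h u hu).2 v hv

theorem size_le [Finite Γ] : (W.toCircuit henc).size ≤ Nat.card Γ ^ N + W.numOut := by
  classical
  have : Fintype Γ := Fintype.ofFinite Γ
  refine Nat.add_le_add_right ((Finset.card_image_le).trans ((Finset.card_le_univ _).trans ?_)) _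
  simp [Nat.card_eq_fintype_card]

/-- `V` assigns to the gates the values which they compute. -/
def IsValuation (y : Fin p → ℕ) (V : (Fin N → Γ) → Prop) : Prop :=
  ∀ u ∈ W.gates,
    match W.label u with
    | .and => (V u ↔ ∀ v ∈ W.pred u, V v)
    | .or => (V u ↔ ∃ v ∈ W.pred u, V v)
    | .not => (V u ↔ ∀ v ∈ W.pred u, ¬ V v)
    | .const c => (V u ↔ c = true)
    | .input j i => (V u ↔ (y j).testBit i = true)

open Classical in
theorem outputs {y : Fin p → ℕ} {V : (Fin N → Γ) → Prop} (h : W.IsValuation y V) :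
    (W.toCircuit henc).Outputs y
      (∑ i : Fin W.numOut, 2 ^ (i : ℕ) * (decide (V (W.out i))).toNat) := by
  have hinj := encodeWord_injective enc henc N
  let f : Name → Bool := fun a => decide (∃ u, a = encodeWord enc u ∧ V u)
  have hf : ∀ u, f (encodeWord enc u) = true ↔ V u := by
    intro u
    simp only [f, decide_eq_true_iff]
    constructor
    · rintro ⟨u', h1, h2⟩
      rwa [hinj h1]
    · exact fun h => ⟨u, rfl, h⟩
  have hf' : ∀ u, f (encodeWord enc u) = false ↔ ¬ V u := by
    intro u
    rw [← hf, Bool.not_eq_true]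
  refine ⟨f, ?_, ?_⟩
  · simp only [Circuit.IsValuation, mem_gates, forall_exists_index, and_imp]
    rintro _ u hu rfl
    have := h u hu
    rw [label_eq]
    cases hl : W.label u <;> simp only [hl] at this ⊢
    · simp only [hf, this, mem_pred, forall_exists_index, and_imp, forall_apply_eq_imp_iff₂]
    · simp only [hf, this, mem_pred, exists_exists_and_eq_and]
    · simp only [hf, this, mem_pred, forall_exists_index, and_imp, forall_apply_eq_imp_iff₂, hf']
    · rw [Bool.eq_iff_iff, hf, this]
    · rw [Bool.eq_iff_iff, hf, this]
  · refine Finset.sum_congr rfl fun i _ => ?_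
    congr 2
    rw [Bool.eq_iff_iff, decide_eq_true_iff]
    exact (hf _).symm

end WordCircuit

end Words

/-! ### Circuits with copies of given circuits -/

/-- Finitely many functions which may be called, with circuits for them. The arguments of the calls
are inputs or (for `pin = none`) a number `2 ^ k - 1`. -/
structure Calls (p : ℕ) (κ : Type) where
  P : κ → ℕ
  F : ∀ q, (Fin (P q) → ℕ) → ℕ
  C : ∀ q n, Circuit (P q) n
  pin : ∀ q, Fin (P q) → Option (Fin p)
  c : ℕ
  c_pos : 0 < c
  length_le : ∀ q n, ∀ a ∈ (C q n).gates, a.length ≤ c * (len n + 1)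
  depth_le : ∀ q n, (C q n).DepthLE (c * (len n + 1))
  dec : ∀ q, DecidableInLogtime fun n t a b => (C q n).Conn t a b
  outputs : ∀ q n y, (∀ j, len (y j) ≤ n) → (C q n).Outputs y (F q y)

/-- A letter of a call: the number `k`, the number of a bit and the name of a gate. -/
abbrev Payload : Type := Bool × Option Bool × Option Bool

namespace Payload

variable {N : ℕ} (x : Fin N → Payload)

def num : ℕ := Nat.ofBits fun t => (x t).1

def idx : Fin N → Option Bool := fun t => (x t).2.1

def name : Fin N → Option Bool := fun t => (x t).2.2

def setIdx (i : Fin N → Option Bool) : Fin N → Payload := fun t => ((x t).1, i t, (x t).2.2)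

def setName (a : Fin N → Option Bool) : Fin N → Payload := fun t => ((x t).1, (x t).2.1, a t)

end Payload

theorem lt_two_pow_len (n : ℕ) : n < 2 ^ len n := Nat.lt_size_self n

theorem testBit_sum (m : ℕ) (f : Fin m → Bool) (i : ℕ) :
    (∑ j : Fin m, 2 ^ (j : ℕ) * (f j).toNat).testBit i = true ↔ ∃ h : i < m, f ⟨i, h⟩ = true := by
  have : ∑ j : Fin m, 2 ^ (j : ℕ) * (f j).toNat = Nat.ofBits f := by
    induction m with
    | zero => rfl
    | succ m ih =>
      rw [ofBits_eq_tail, ← ih, Fin.sum_univ_succ, Finset.mul_sum]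
      simp [Fin.tail, pow_succ', Nat.mul_assoc, Nat.add_comm]
  rw [this]
  by_cases h : i < m
  · simp [h]
  · rw [Nat.testBit_ofBits_ge f i (not_lt.1 h)]
    simp [h]

namespace Calls

variable {p : ℕ} {κ : Type} (S : Calls p κ)

def width (n : ℕ) : ℕ := S.c * (len n + 1)

theorem width_pos (n : ℕ) : 0 < S.width n := Nat.mul_pos S.c_pos (Nat.succ_pos _)

theorem lt_two_pow_width (n : ℕ) : n < 2 ^ S.width n :=
  (lt_two_pow_len n).trans_le (Nat.pow_le_pow_right (by norm_num)
    ((Nat.le_succ _).trans (Nat.le_mul_of_pos_left _ S.c_pos)))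

theorem str_pack_name {q : κ} {n : ℕ} {a : Name} (ha : a ∈ (S.C q n).gates) :
    str (pack (S.width n) a) = a := str_pack (S.length_le q n a ha)

/-- The inputs of at most `n` bits. -/
abbrev Input (p : ℕ) : Type := {e : ℕ × (Fin p → ℕ) // ∀ j, len (e.2 j) ≤ e.1}

/-- The arguments of a call. -/
def args (y : Fin p → ℕ) (q : κ) (k : ℕ) : Fin (S.P q) → ℕ :=
  fun j => (S.pin q j).elim (2 ^ k - 1) y

theorem len_two_pow_sub_one (k : ℕ) : len (2 ^ k - 1) ≤ k :=
  Nat.size_le.2 (Nat.sub_lt (by positivity) (by norm_num))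

theorem len_args (e : Input p) (q : κ) {k : ℕ} (hk : k ≤ e.1.1) (j : Fin (S.P q)) :
    len (S.args e.1.2 q k j) ≤ e.1.1 := by
  rw [args]
  cases S.pin q j with
  | none => exact (len_two_pow_sub_one k).trans hk
  | some j' => exact e.2 j'

/-- The exponent is capped at the number `n` of input bits: for larger `k` the argument `2 ^ k - 1`
would not fit the circuit, yet every word on the number track names a copy of it, whose gates need
values. -/
theorem exists_val (e : Input p) (q : κ) (k : ℕ) : ∃ v : Name → Bool,
    (S.C q e.1.1).IsValuation (S.args e.1.2 q (min k e.1.1)) v ∧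
      S.F q (S.args e.1.2 q (min k e.1.1)) =
        ∑ i : Fin (S.C q e.1.1).numOut, 2 ^ (i : ℕ) * (v ((S.C q e.1.1).out i)).toNat :=
  S.outputs q e.1.1 _ (S.len_args e q (min_le_right _ _))

/-- The values of the gates of the called circuit. -/
noncomputable def val (e : Input p) (q : κ) (k : ℕ) : Name → Bool := (S.exists_val e q k).choose

/-- The gate is the output for the bit whose number is given. -/
def IsOut (n : ℕ) (q : κ) {N : ℕ} (w : Fin N → Payload) : Prop :=
  (S.C q n).Conn .output (str (Payload.name w)) (str (Payload.idx w))

/-- The bits of the inputs and the outputs of calls. -/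
abbrev base : Base (Fin p ⊕ κ) Payload where
  E := Input p
  N e := S.width e.1.1
  N_pos _ := S.width_pos _
  β e s w := match s with
    | .inl j => IsCanon (Payload.idx w) ∧ trackNum (Payload.idx w) < e.1.1 ∧
        (e.1.2 j).testBit (trackNum (Payload.idx w)) = true
    | .inr q => S.IsOut e.1.1 q w ∧ S.val e q (Payload.num w) (str (Payload.name w)) = true

theorem bits_inj {m m' : ℕ} (h : Nat.bits m = Nat.bits m') : m = m' := by
  rw [← ofDigits_bits m, h, ofDigits_bits]

theorem base_inr (e : Input p) (q : κ) (k : Fin (S.width e.1.1) → Bool)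
    (i a : Fin (S.width e.1.1) → Option Bool) :
    S.base.β e (Sum.inr q) (fun t => (k t, i t, a t)) ↔
      (S.C q e.1.1).Conn .output (str a) (str i) ∧ S.val e q (Nat.ofBits k) (str a) = true :=
  Iff.rfl

theorem base_inl (e : Input p) (j : Fin p) (k : Fin (S.width e.1.1) → Bool)
    (i a : Fin (S.width e.1.1) → Option Bool) :
    S.base.β e (Sum.inl j) (fun t => (k t, i t, a t)) ↔
      IsCanon i ∧ trackNum i < e.1.1 ∧ (e.1.2 j).testBit (trackNum i) = true :=
  Iff.rfl

/-- The bits of the values of the called functions. -/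
theorem comp_call (q : κ) : CompN S.base (fun e (v : Bool → ℕ) =>
    (S.F q (S.args e.1.2 q (min (v false) e.1.1))).testBit (v true) = true) := by
  have h1 : Comp S.base (fun e (u : Fin (S.base.N e) → (Bool × Option Bool) × Option Bool) =>
      S.base.β e (Sum.inr q) (fun t => ((u t).1.1, (u t).1.2, (u t).2))) :=
    Comp.base (𝔅 := S.base) (Sum.inr q)
      (AutFun.letters fun b : (Bool × Option Bool) × Option Bool => (b.1.1, b.1.2, b.2))
  -- The name of the output gate for the wanted bit is not computed but quantified over; the base
  -- value is true only if the guessed gate is that output and carries a `1`.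
  have h2 := h1.exTrack.subst (B := Bool → Bool) (φ := fun N u t => (u t false,
    canon N (fun t => u t true) t)) ((AutFun.letters fun b : Bool → Bool => b false).pair
      (aut_canon.pre fun b : Bool → Bool => b true))
  refine h2.congr fun e u => ?_
  obtain ⟨hv, hF⟩ := (S.exists_val e q (Nat.ofBits fun t => u t false)).choose_spec
  beta_reduce
  rw [hF, testBit_sum]
  refine Iff.trans ?_ (exists_congr fun a => S.base_inr e q (fun t => u t false) (canon _ fun t => u t true) a).symm
  rw [str_canon]
  constructor
  · rintro ⟨hi, h⟩
    refine ⟨pack _ ((S.C q e.1.1).out ⟨_, hi⟩), ?_⟩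
    rw [S.str_pack_name ((S.C q e.1.1).out_mem ⟨_, hi⟩)]
    exact ⟨⟨(S.C q e.1.1).out_mem _, ⟨_, hi⟩, rfl, rfl⟩, h⟩
  · rintro ⟨a, ⟨-, ⟨i, hi⟩, h1, h2⟩, h3⟩
    obtain rfl := bits_inj h2
    refine ⟨hi, ?_⟩
    rw [h1] at h3
    exact h3

/-- The bits of the inputs. -/
theorem comp_input (j : Fin p) : CompZ S.base (fun e _ => e.1.2 j) := by
  have h : Comp S.base (fun e (u : Fin (S.base.N e) → Bool → Bool) =>
      S.base.β e (Sum.inl j) (fun t => (false, canon (S.base.N e) (fun t => u t true) t, none))) :=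
    Comp.base (𝔅 := S.base) (Sum.inl j)
      (φ := fun N (u : Fin N → Bool → Bool) t => (false, canon N (fun t => u t true) t, none))
      (((AutFun.letters fun _ => false).pair
        ((aut_canon.pre fun b : Bool → Bool => b true).pair (AutFun.letters fun _ => none))))
  refine h.congr fun e u => ?_
  have hlt := Nat.ofBits_lt_two_pow fun t => u t true
  beta_reduce
  rw [zbit_natCast, base_inl]
  rw [show trackNum (canon (S.width e.1.1) fun t => u t true) = Nat.ofBits fun t => u t true from
    trackNum_pack hlt, and_iff_right (isCanon_canon _)]
  refine ⟨fun h => ⟨?_, h⟩, fun h => h.2⟩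
  by_contra h'
  rw [Nat.testBit_lt_two_pow] at h
  · exact absurd h (by simp)
  · exact (lt_two_pow_len _).trans_le (Nat.pow_le_pow_right (by norm_num)
      ((e.2 j).trans (not_lt.1 h')))

end Calls

/-- A value at a base gate is fetched from an input node `inp`, or from `leaf`, the exit of a copy
of a called circuit. Such a copy consists of nodes `gate`, and its own input nodes `pin` are wired
to `inp` or constant. -/
inductive Shape {κ : Type} (p : ℕ) (P : κ → ℕ) : Type
  | net
  | inp (j : Fin p)
  | leaf (q : κ)
  | pin (q : κ) (j : Fin (P q))
  | gate (q : κ)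

instance {κ : Type} [Finite κ] (p : ℕ) (P : κ → ℕ) : Finite (Shape p P) := by
  let φ : Shape p P → Unit ⊕ Fin p ⊕ κ ⊕ (Σ q, Fin (P q)) ⊕ κ
    | .net => .inl ()
    | .inp j => .inr (.inl j)
    | .leaf q => .inr (.inr (.inl q))
    | .pin q j => .inr (.inr (.inr (.inl ⟨q, j⟩)))
    | .gate q => .inr (.inr (.inr (.inr q)))
  refine Finite.of_injective φ ?_
  intro x y h
  cases x <;> cases y <;> simp_all [φ]

def Shape.ofBase {κ : Type} {p : ℕ} {P : κ → ℕ} : Fin p ⊕ κ → Shape p P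
  | .inl j => .inp j
  | .inr q => .leaf q

/-- A gate of kind `base` turns into an `or` gate with a single predecessor, the node which supplies
the value. -/
def Kind.label {BS : Type} {p n : ℕ} : Kind BS → Label p n
  | .const c => .const c
  | .not => .not
  | .and => .and
  | .or => .or
  | .base _ => .or

/-- Input nodes of a called circuit become gates with one predecessor. -/
def Label.inner {P p n : ℕ} : Label P n → Label p n
  | .and => .and
  | .or => .or
  | .not => .not
  | .const c => .const c
  | .input _ _ => .or

namespace Calls

variable {p : ℕ} {κ : Type} (S : Calls p κ) (𝒩 : Net (Fin p ⊕ κ) Payload)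

/-- Letters of the names of gates: the kind of the node, the name of a gate of the network, and the
parameters of a call. -/
abbrev Letter : Type := Shape p S.P × 𝒩.A × Payload

variable {S 𝒩} {N : ℕ}

def node (s : Shape p S.P) (x : Fin N → 𝒩.A) (w : Fin N → Payload) : Fin N → S.Letter 𝒩 :=
  fun t => (s, x t, w t)

noncomputable def shape (u : Fin N → S.Letter 𝒩) : Option (Shape p S.P) :=
  constTag fun t => (u t).1

def inner (u : Fin N → S.Letter 𝒩) : Fin N → 𝒩.A := fun t => (u t).2.1

def load (u : Fin N → S.Letter 𝒩) : Fin N → Payload := fun t => (u t).2.2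

theorem eq_node {u : Fin N → S.Letter 𝒩} {s : Shape p S.P} (h : shape u = some s) :
    u = node s (inner u) (load u) := by
  have := congrFun (eq_of_constTag h)
  funext t
  exact Prod.ext (this t) rfl

theorem shape_node (hN : 0 < N) (s : Shape p S.P) (x : Fin N → 𝒩.A) (w : Fin N → Payload) :
    shape (node s x w) = some s := constTag_const hN s

theorem node_inj (hN : 0 < N) {s s' : Shape p S.P} {x x' : Fin N → 𝒩.A} {w w' : Fin N → Payload}
    (h : (node s x w : Fin N → S.Letter 𝒩) = node s' x' w') : s = s' ∧ x = x' ∧ w = w' := by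
  refine ⟨?_, ?_, ?_⟩
  · exact congrArg Prod.fst (congrFun h ⟨0, hN⟩)
  · exact funext fun t => congrArg (fun g => g.2.1) (congrFun h t)
  · exact funext fun t => congrArg (fun g => g.2.2) (congrFun h t)

variable (S 𝒩) (n : ℕ)

-- Bit `i` of `2 ^ k - 1` is `i < k`, so an argument of a call which is pinned to this number
-- becomes a constant that can be read off the name. A `leaf` whose name does not fit to an output
-- is constantly false, as the base value requires.
open Classical in
noncomputable def nodeLabel (s : Shape p S.P) (x : Fin N → 𝒩.A) (w : Fin N → Payload) :
    Label p n :=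
  match s with
  | .net => (𝒩.kind N x).label
  | .inp j => if h : IsCanon (Payload.idx w) ∧ trackNum (Payload.idx w) < n then
      .input j ⟨_, h.2⟩ else .const false
  | .leaf q => if S.IsOut n q w then .or else .const false
  | .pin q j => (S.pin q j).elim
      (.const (decide (trackNum (Payload.idx w) < Payload.num w))) fun _ => .or
  | .gate q => ((S.C q n).label (str (Payload.name w))).inner

-- Inside a copy of a called circuit only the name track changes; the word `x`, the number `k` and
-- the index are kept and so distinguish the copies. On leaving the copy through an input node, the
-- index track receives the number of the input bit.
open Classical in
noncomputable def nodePred (s : Shape p S.P) (x : Fin N → 𝒩.A) (w : Fin N → Payload) :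
    Finset (Fin N → S.Letter 𝒩) :=
  match s with
  | .net =>
    match 𝒩.kind N x with
    | .const _ => ∅
    | .not => {node .net (𝒩.ch false N x) w}
    | .and => {node .net (𝒩.ch false N x) w, node .net (𝒩.ch true N x) w}
    | .or => {node .net (𝒩.ch false N x) w, node .net (𝒩.ch true N x) w}
    | .base s => {node (.ofBase s) x (𝒩.bs N x)}
  | .inp _ => ∅
  | .leaf q => if S.IsOut n q w then {node (.gate q) x w} else ∅
  | .pin q j => (S.pin q j).elim ∅ fun j' => {node (.inp j') x w}
  | .gate q =>
    match (S.C q n).label (str (Payload.name w)) with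
    | .const _ => ∅
    | .input j i => {node (.pin q j) x (Payload.setIdx w (pack N (Nat.bits i)))}
    | _ => ((S.C q n).pred (str (Payload.name w))).image fun b =>
        node (.gate q) x (Payload.setName w (pack N b))

/-- Membership needs a check only for gates of called circuits. All other words, even those without
a shape, are admitted as gates. -/
def NodeOK (s : Shape p S.P) (w : Fin N → Payload) : Prop :=
  match s with
  | .gate q => str (Payload.name w) ∈ (S.C q n).gates
  | _ => True

variable {S 𝒩 n}

theorem card_pred_gate {q : κ} (x : Fin (S.width n) → 𝒩.A) (w : Fin (S.width n) → Payload)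
    {a : Name} (ha : a ∈ (S.C q n).gates) : open Classical in
    (((S.C q n).pred a).image fun b => (node (.gate q) x (Payload.setName w (pack _ b)) :
      Fin (S.width n) → S.Letter 𝒩)).card = ((S.C q n).pred a).card := by
  classical
  refine Finset.card_image_of_injOn fun b hb b' hb' h => ?_
  have h1 := congrArg (fun w => str (Payload.name w)) (node_inj (S.width_pos n) h).2.2
  have h2 : str (pack (S.width n) b) = str (pack (S.width n) b') := h1
  rwa [S.str_pack_name ((S.C q n).pred_subset a ha hb),
    S.str_pack_name ((S.C q n).pred_subset a ha hb')] at h2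

section Card

variable {s : Shape p S.P} {x : Fin (S.width n) → 𝒩.A} {w : Fin (S.width n) → Payload}

theorem card_nodePred (hOK : S.NodeOK n s w) :
    (S.nodeLabel 𝒩 n s x w = .and ∨ S.nodeLabel 𝒩 n s x w = .or →
      (S.nodePred 𝒩 n s x w).card = 1 ∨ (S.nodePred 𝒩 n s x w).card = 2) ∧
    (S.nodeLabel 𝒩 n s x w = .not → (S.nodePred 𝒩 n s x w).card = 1) ∧
    (∀ c, S.nodeLabel 𝒩 n s x w = .const c → S.nodePred 𝒩 n s x w = ∅) ∧
    (∀ j i, S.nodeLabel 𝒩 n s x w = .input j i → S.nodePred 𝒩 n s x w = ∅) := by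
  classical
  cases s with
  | net =>
    simp only [nodeLabel, nodePred]
    cases 𝒩.kind _ x <;> simp [Kind.label]
  | inp j =>
    simp only [nodeLabel, nodePred]
    split_ifs <;> simp
  | leaf q =>
    simp only [nodeLabel, nodePred]
    split_ifs <;> simp
  | pin q j =>
    simp only [nodeLabel, nodePred]
    cases S.pin q j <;> simp
  | gate q =>
    have hg : str (Payload.name w) ∈ (S.C q n).gates := hOK
    simp only [nodeLabel, nodePred]
    cases hl : (S.C q n).label (str (Payload.name w)) with
    | and =>
      simpa [Label.inner, card_pred_gate x w hg] using (S.C q n).card_and _ hg hl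
    | or => simpa [Label.inner, card_pred_gate x w hg] using (S.C q n).card_or _ hg hl
    | not => simpa [Label.inner, card_pred_gate x w hg] using (S.C q n).card_not _ hg hl
    | const c => simp [Label.inner]
    | input j i => simp [Label.inner]

theorem nodePred_ok (hOK : S.NodeOK n s w) {v : Fin (S.width n) → S.Letter 𝒩}
    (hv : v ∈ S.nodePred 𝒩 n s x w) : ∃ s' x' w', v = node s' x' w' ∧ S.NodeOK n s' w' := by
  classical
  cases s with
  | net =>
    simp only [nodePred] at hv
    cases hk : 𝒩.kind _ x with
    | const c => simp [hk] at hv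
    | not =>
      simp only [hk, Finset.mem_singleton] at hv
      exact ⟨_, _, _, hv, trivial⟩
    | and =>
      simp only [hk, Finset.mem_insert, Finset.mem_singleton] at hv
      rcases hv with rfl | rfl <;> exact ⟨_, _, _, rfl, trivial⟩
    | or =>
      simp only [hk, Finset.mem_insert, Finset.mem_singleton] at hv
      rcases hv with rfl | rfl <;> exact ⟨_, _, _, rfl, trivial⟩
    | base s =>
      simp only [hk, Finset.mem_singleton] at hv
      refine ⟨_, _, _, hv, ?_⟩
      cases s <;> trivial
  | inp j => simp [nodePred] at hv
  | leaf q =>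
    simp only [nodePred] at hv
    split_ifs at hv with h
    · exact ⟨_, _, _, Finset.mem_singleton.1 hv, h.1⟩
    · simp at hv
  | pin q j =>
    simp only [nodePred] at hv
    cases hj : S.pin q j with
    | none => simp [hj] at hv
    | some j' =>
      simp only [hj, Option.elim_some, Finset.mem_singleton] at hv
      exact ⟨_, _, _, hv, trivial⟩
  | gate q =>
    have hg : str (Payload.name w) ∈ (S.C q n).gates := hOK
    have key : v ∈ ((S.C q n).pred (str (Payload.name w))).image (fun b =>
        (node (.gate q) x (Payload.setName w (pack _ b)) : Fin (S.width n) → S.Letter 𝒩)) →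
        ∃ s' x' w', v = node s' x' w' ∧ S.NodeOK n s' w' := by
      intro h
      obtain ⟨b, hb, rfl⟩ := Finset.mem_image.1 h
      refine ⟨_, _, _, rfl, ?_⟩
      have hb' := (S.C q n).pred_subset _ hg hb
      show str (pack _ b) ∈ _
      rwa [S.str_pack_name hb']
    simp only [nodePred] at hv
    cases hl : (S.C q n).label (str (Payload.name w)) with
    | and => simp only [hl] at hv; exact key hv
    | or => simp only [hl] at hv; exact key hv
    | not => simp only [hl] at hv; exact key hv
    | const c => simp [hl] at hv
    | input j i =>
      simp only [hl, Finset.mem_singleton] at hv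
      exact ⟨_, _, _, hv, trivial⟩

end Card

variable (S 𝒩 n)

/-- The circuit consisting of the network, the called circuits and the inputs. -/
noncomputable def wordCircuit [Finite κ] (out : Fin (2 ^ S.width n) → Fin (S.width n) → 𝒩.A) :
    WordCircuit p n (S.width n) (S.Letter 𝒩) where
  gates :=
    have := 𝒩.finite_A
    (Set.toFinite {u | (shape u).elim True fun s => S.NodeOK n s (load u)}).toFinset
  label u := (shape u).elim (.const false) fun s => S.nodeLabel 𝒩 n s (inner u) (load u)
  pred u := (shape u).elim ∅ fun s => S.nodePred 𝒩 n s (inner u) (load u)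
  numOut := 2 ^ S.width n
  out i := node .net (out i) default
  pred_subset u hu v hv := by
    rw [Set.Finite.mem_toFinset, Set.mem_ofPred_eq] at hu ⊢
    cases hs : shape u with
    | none => simp [hs] at hv
    | some s =>
      simp only [hs, Option.elim_some] at hu hv
      obtain ⟨s', x', w', rfl, h⟩ := nodePred_ok hu hv
      rw [shape_node (S.width_pos n)]
      exact h
  out_mem i := by
    rw [Set.Finite.mem_toFinset, Set.mem_ofPred_eq, shape_node (S.width_pos n)]
    trivial
  card_and u hu h := by
    rw [Set.Finite.mem_toFinset, Set.mem_ofPred_eq] at hu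
    cases hs : shape u with
    | none => simp [hs] at h
    | some s =>
      simp only [hs, Option.elim_some] at hu h ⊢
      exact (card_nodePred hu).1 (.inl h)
  card_or u hu h := by
    rw [Set.Finite.mem_toFinset, Set.mem_ofPred_eq] at hu
    cases hs : shape u with
    | none => simp [hs] at h
    | some s =>
      simp only [hs, Option.elim_some] at hu h ⊢
      exact (card_nodePred hu).1 (.inr h)
  card_not u hu h := by
    rw [Set.Finite.mem_toFinset, Set.mem_ofPred_eq] at hu
    cases hs : shape u with
    | none => simp [hs] at h
    | some s =>
      simp only [hs, Option.elim_some] at hu h ⊢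
      exact (card_nodePred hu).2.1 h
  card_const u hu c h := by
    rw [Set.Finite.mem_toFinset, Set.mem_ofPred_eq] at hu
    cases hs : shape u with
    | none => rfl
    | some s =>
      simp only [hs, Option.elim_some] at hu h ⊢
      exact (card_nodePred hu).2.2.1 c h
  card_input u hu j i h := by
    rw [Set.Finite.mem_toFinset, Set.mem_ofPred_eq] at hu
    cases hs : shape u with
    | none => rfl
    | some s =>
      simp only [hs, Option.elim_some] at hu h ⊢
      exact (card_nodePred hu).2.2.2 j i h

/-- The level of a gate in the called circuit. -/
noncomputable def gateLevel (q : κ) : Name → ℕ := (S.depth_le q n).choose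

variable {S n} in
theorem gateLevel_spec {q : κ} {a : Name} (ha : a ∈ (S.C q n).gates) :
    S.gateLevel n q a ≤ S.width n ∧ ∀ b ∈ (S.C q n).pred a, S.gateLevel n q b < S.gateLevel n q a :=
  (S.depth_le q n).choose_spec a ha

section Eval

variable [Finite κ] (out : Fin (2 ^ S.width n) → Fin (S.width n) → 𝒩.A)

theorem mem_gates {u : Fin (S.width n) → S.Letter 𝒩} : u ∈ (S.wordCircuit 𝒩 n out).gates ↔
    (shape u).elim True fun s => S.NodeOK n s (load u) := by
  rw [wordCircuit, Set.Finite.mem_toFinset, Set.mem_ofPred_eq]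

/-- The levels of the nodes. -/
noncomputable def nodeLevel (s : Shape p S.P) (x : Fin N → 𝒩.A) (w : Fin N → Payload) : ℕ :=
  match s with
  | .net => 4 + S.width n + 𝒩.level N x
  | .leaf _ => 3 + S.width n
  | .gate q => 2 + S.gateLevel n q (str (Payload.name w))
  | .pin _ _ => 1
  | .inp _ => 0

theorem exists_level : ∃ level : (Fin (S.width n) → S.Letter 𝒩) → ℕ,
    ∀ u ∈ (S.wordCircuit 𝒩 n out).gates,
      level u ≤ 4 + S.width n + 𝒩.depth * (S.width n + 1) ∧
      ∀ v ∈ (S.wordCircuit 𝒩 n out).pred u, level v < level u := by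
  classical
  let level : (Fin (S.width n) → S.Letter 𝒩) → ℕ := fun u =>
    (shape u).elim 0 fun s => S.nodeLevel 𝒩 n s (inner u) (load u)
  have hlevel : ∀ s x w, level (node s x w) = S.nodeLevel 𝒩 n s x w := by
    intro s x w
    simp only [level, shape_node (S.width_pos n)]
    rfl
  refine ⟨level, fun u hu => ?_⟩
  rw [mem_gates] at hu
  have hpred : (S.wordCircuit 𝒩 n out).pred u =
    (shape u).elim ∅ fun s => S.nodePred 𝒩 n s (inner u) (load u) := rfl
  rw [hpred]
  cases hs : shape u with
  | none => simp [level, hs]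
  | some s =>
    simp only [hs, Option.elim_some] at hu ⊢
    rw [eq_node hs, hlevel, ← eq_node hs]
    generalize inner u = x at hu
    generalize load u = w at hu
    cases s with
    | net =>
      refine ⟨Nat.add_le_add_left (𝒩.level_le _ x) _, ?_⟩
      have h := 𝒩.level_lt _ x
      simp only [nodePred]
      cases hk : 𝒩.kind _ x with
      | const c => simp
      | not =>
        simp only [Finset.mem_singleton, forall_eq, hlevel, nodeLevel]
        have := h false (by simp [hk, Kind.Uses])
        omega
      | and =>
        simp only [Finset.mem_insert, Finset.mem_singleton, forall_eq_or_imp, forall_eq, hlevel,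
          nodeLevel]
        have h1 := h false (by simp [hk, Kind.Uses])
        have h2 := h true (by simp [hk, Kind.Uses])
        omega
      | or =>
        simp only [Finset.mem_insert, Finset.mem_singleton, forall_eq_or_imp, forall_eq, hlevel,
          nodeLevel]
        have h1 := h false (by simp [hk, Kind.Uses])
        have h2 := h true (by simp [hk, Kind.Uses])
        omega
      | base s =>
        simp only [Finset.mem_singleton, forall_eq, hlevel]
        cases s <;> simp only [Shape.ofBase, nodeLevel] <;> omega
    | inp j => simp [nodePred, nodeLevel]
    | leaf q =>
      refine ⟨by simp only [nodeLevel]; omega, ?_⟩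
      simp only [nodePred]
      split_ifs with h
      · simp only [Finset.mem_singleton, forall_eq, hlevel, nodeLevel]
        have := (gateLevel_spec h.1).1
        omega
      · simp
    | pin q j =>
      refine ⟨by simp only [nodeLevel]; omega, ?_⟩
      simp only [nodePred]
      cases S.pin q j with
      | none => simp
      | some j' => simp [hlevel, nodeLevel]
    | gate q =>
      have hg : str (Payload.name w) ∈ (S.C q n).gates := hu
      have hspec := gateLevel_spec hg
      refine ⟨by simp only [nodeLevel]; omega, ?_⟩
      have key : ∀ v ∈ ((S.C q n).pred (str (Payload.name w))).image (fun b =>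
          (node (.gate q) x (Payload.setName w (pack _ b)) : Fin (S.width n) → S.Letter 𝒩)),
          level v < S.nodeLevel 𝒩 n (.gate q) x w := by
        intro v hv
        obtain ⟨b, hb, rfl⟩ := Finset.mem_image.1 hv
        rw [hlevel]
        show 2 + S.gateLevel n q (str (pack _ b)) < 2 + _
        rw [S.str_pack_name ((S.C q n).pred_subset _ hg hb)]
        exact Nat.add_lt_add_left (hspec.2 b hb) _
      simp only [nodePred]
      cases hl : (S.C q n).label (str (Payload.name w)) with
      | and => exact key
      | or => exact key
      | not => exact key
      | const c => simp
      | input j i =>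
        simp only [Finset.mem_singleton, forall_eq, hlevel, nodeLevel]
        omega

/-- The values of the nodes. -/
noncomputable def nodeVal (e : Input p) (V : (Fin (S.width e.1.1) → 𝒩.A) → Prop)
    (s : Shape p S.P) (x : Fin (S.width e.1.1) → 𝒩.A) (w : Fin (S.width e.1.1) → Payload) : Prop :=
  match s with
  | .net => V x
  | .inp j => S.base.β e (Sum.inl j) w
  | .leaf q => S.base.β e (Sum.inr q) w
  | .pin q j => (S.pin q j).elim (trackNum (Payload.idx w) < Payload.num w) fun j' =>
      S.base.β e (Sum.inl j') w
  | .gate q => S.val e q (Payload.num w) (str (Payload.name w)) = true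

theorem testBit_two_pow_sub_one (k i : ℕ) : (2 ^ k - 1).testBit i = true ↔ i < k := by
  rw [Nat.testBit_two_pow_sub_one, decide_eq_true_iff]

/-- The network keeps its values, and every copy of a called circuit takes over a valuation of the
original on the arguments of its call. At the input nodes of a copy this is consistent because they
are wired to just these arguments. -/
theorem exists_valuation (e : Input p) (out : Fin (2 ^ S.width e.1.1) → Fin (S.width e.1.1) → 𝒩.A)
    (V : (Fin (S.width e.1.1) → 𝒩.A) → Prop) (hV : 𝒩.IsVal (S.base.β e) V) :
    ∃ V' : (Fin (S.width e.1.1) → S.Letter 𝒩) → Prop,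
      (S.wordCircuit 𝒩 e.1.1 out).IsValuation e.1.2 V' ∧ ∀ x w, V' (node .net x w) ↔ V x := by
  classical
  let V' : (Fin (S.width e.1.1) → S.Letter 𝒩) → Prop := fun u =>
    (shape u).elim False fun s => S.nodeVal 𝒩 e V s (inner u) (load u)
  have hV' : ∀ s x w, V' (node s x w) ↔ S.nodeVal 𝒩 e V s x w := by
    intro s x w
    simp only [V', shape_node (S.width_pos _)]
    rfl
  refine ⟨V', fun u hu => ?_, fun x w => hV' _ _ _⟩
  rw [mem_gates] at hu
  have hpred : (S.wordCircuit 𝒩 e.1.1 out).pred u =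
    (shape u).elim ∅ fun s => S.nodePred 𝒩 e.1.1 s (inner u) (load u) := rfl
  have hlabel : (S.wordCircuit 𝒩 e.1.1 out).label u =
    (shape u).elim (.const false) fun s => S.nodeLabel 𝒩 e.1.1 s (inner u) (load u) := rfl
  rw [hpred, hlabel]
  cases hs : shape u with
  | none => simp [V', hs]
  | some s =>
    simp only [hs, Option.elim_some] at hu ⊢
    rw [eq_node hs, hV', ← eq_node hs]
    generalize inner u = x at hu
    generalize load u = w at hu
    cases s with
    | net =>
      have h := hV x
      simp only [nodeLabel, nodePred, nodeVal]
      cases hk : 𝒩.kind _ x with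
      | base s =>
        simp only [Kind.label, Finset.mem_singleton, exists_eq_left, hV']
        rw [hk] at h
        cases s <;> exact h
      | _ => simpa [Kind.label, hV', nodeVal, hk, Kind.value] using h
    | inp j =>
      simp only [nodeLabel]
      split_ifs with h
      · show _ ∧ _ ∧ _ ↔ _
        simp [h.1, h.2]
      · show (_ ∧ _ ∧ _ ↔ _)
        rw [← and_assoc]
        simp [h]
    | leaf q =>
      simp only [nodeLabel, nodePred]
      split_ifs with h
      · simp only [Finset.mem_singleton, exists_eq_left, hV']
        exact and_iff_right h
      · show (_ ∧ _ ↔ _)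
        simp [h]
    | pin q j =>
      simp only [nodeLabel, nodePred, nodeVal]
      cases S.pin q j with
      | none => simp
      | some j' => simp [hV', nodeVal]
    | gate q =>
      have hg : str (Payload.name w) ∈ (S.C q e.1.1).gates := hu
      have hval := (S.exists_val e q (Payload.num w)).choose_spec.1 _ hg
      rw [← val] at hval
      have hb : ∀ b ∈ (S.C q e.1.1).pred (str (Payload.name w)),
          (V' (node (.gate q) x (Payload.setName w (pack _ b))) ↔
            S.val e q (Payload.num w) b = true) := by
        intro b hb
        rw [hV']
        show S.val e q _ (str (pack _ b)) = true ↔ _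
        rw [S.str_pack_name ((S.C q e.1.1).pred_subset _ hg hb)]
        rfl
      simp only [nodeLabel, nodePred, nodeVal]
      cases hl : (S.C q e.1.1).label (str (Payload.name w)) with
      | and =>
        simp only [hl, Label.inner, Finset.forall_mem_image] at hval ⊢
        rw [hval]
        exact forall₂_congr fun b h => (hb b h).symm
      | or =>
        simp only [hl, Label.inner, Finset.exists_mem_image] at hval ⊢
        rw [hval]
        exact exists_congr fun b => and_congr_right fun h => (hb b h).symm
      | not =>
        simp only [hl, Label.inner, Finset.forall_mem_image] at hval ⊢
        rw [hval]
        refine forall₂_congr fun b h => ?_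
        rw [hb b h, Bool.not_eq_true]
      | const c =>
        simp only [hl, Label.inner] at hval ⊢
        rw [hval]
      | input j i =>
        simp only [hl, Label.inner, Finset.mem_singleton, exists_eq_left, hV'] at hval ⊢
        rw [hval]
        have hi := i.2.trans (S.lt_two_pow_width e.1.1)
        have hnum : trackNum (pack (S.width e.1.1) (Nat.bits i)) = i := trackNum_pack hi
        simp only [nodeVal, args]
        cases hj : S.pin q j with
        | none =>
          show _ ↔ trackNum (pack (S.width e.1.1) (Nat.bits i)) < _
          rw [hnum, Option.elim_none, testBit_two_pow_sub_one]
          -- As `i < n`, capping the exponent at `n` does not change this bit.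
          have := i.2
          show _ ↔ _ < Payload.num w
          omega
        | some j' =>
          show _ ↔ IsCanon (pack (S.width e.1.1) (Nat.bits i)) ∧ trackNum (pack _ _) < _ ∧
            Nat.testBit _ (trackNum (pack _ _)) = true
          rw [hnum, and_iff_right (isCanon_iff.2 ⟨_, hi, rfl⟩), and_iff_right i.2]
          rfl

end Eval

end Calls

instance (p : ℕ) : Finite (ConnType p) := by
  let φ : ConnType p → Fin 4 ⊕ Bool ⊕ Fin p
    | .and => .inl 0
    | .or => .inl 1
    | .not => .inl 2
    | .output => .inl 3
    | .const c => .inr (.inl c)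
    | .input j => .inr (.inr j)
  refine Finite.of_injective φ ?_
  intro x y h
  cases x <;> cases y <;> simp_all [φ]

/-! ### Answers of classifiers -/

section Answers

variable {I' : Type}

open Classical in
noncomputable def tell (P : Prop) : Bool ⊕ (I' × Bool) := .inl (decide P)

open Classical in
noncomputable def ask (P : Prop) (q : I') : Bool ⊕ (I' × Bool) :=
  if P then .inr (q, true) else .inl false

open Classical in
noncomputable def askNot (P : Prop) (q : I') : Bool ⊕ (I' × Bool) :=
  if P then .inr (q, false) else .inl true

/-- The answer, where `Θ` gives the answers to queries. -/
def Holds (Θ : I' → Prop) (r : Bool ⊕ (I' × Bool)) : Prop :=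
  match r with
  | .inl r => r = true
  | .inr q => (Θ q.1 ↔ q.2 = true)

variable (Θ : I' → Prop)

theorem holds_tell (P : Prop) : Holds Θ (tell P) ↔ P := by simp [Holds, tell]

theorem holds_ask (P : Prop) (q : I') : Holds Θ (ask P q) ↔ P ∧ Θ q := by
  unfold ask
  split_ifs with h <;> simp [Holds, h]

theorem holds_askNot (P : Prop) (q : I') : Holds Θ (askNot P q) ↔ (P → ¬ Θ q) := by
  unfold askNot
  split_ifs with h <;> simp [Holds, h]

theorem not_holds_false : ¬ Holds Θ (.inl false) := by simp [Holds]

end Answers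

namespace Calls

variable {p : ℕ} {κ : Type} (S : Calls p κ) (𝒩 : Net (Fin p ⊕ κ) Payload)

/-! ### The queries -/

abbrev QueryIndex (q : Option κ) : Type := q.elim Unit fun q => ConnType (S.P q)

def query : ∀ q : Option κ, ℕ → S.QueryIndex q → List Bool → List Bool → Prop
  | none => fun n _ a _ => Nat.ofDigits 2 (a.map Bool.toNat) < n
  | some q => fun n t a b => (S.C q n).Conn t a b

theorem decidableInLogtime_query [Finite κ] :
    DecidableInLogtime (fun n (t : Σ q, S.QueryIndex q) a b => S.query t.1 n t.2 a b) := by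
  refine DecidableInLogtime.sigma (Θ := S.query) fun q => ?_
  cases q with
  | none => exact DecidableInLogtime.below
  | some q => exact S.dec q

/-- The answers to the queries for a pair of strings. -/
def answer (n : ℕ) (a b : List Bool) (Z : Σ q, S.QueryIndex q) : Prop := S.query Z.1 n Z.2 a b

abbrev Query : Type := Σ q, S.QueryIndex q

instance [Finite κ] : Finite S.Query := by
  have : ∀ q, Finite (S.QueryIndex q) := fun q => by
    cases q
    · exact inferInstanceAs (Finite Unit)
    · exact inferInstanceAs (Finite (ConnType _))
  infer_instance

variable {S}

def below : S.Query := ⟨none, ()⟩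

def called (q : κ) (t : ConnType (S.P q)) : S.Query := ⟨some q, t⟩

variable (S) {𝒩} {N : ℕ}

/-! ### The connections -/

def Kind.Is {BS : Type} : ConnType p → Kind BS → Prop
  | .and, .and => True
  | .or, .or => True
  | .not, .not => True
  | _, _ => False

def gateType {P : ℕ} : ConnType p → ConnType P
  | .and => .and
  | .or => .or
  | _ => .not

/-- Whether there is an edge between the nodes with the names `u`, `v`, where the first has the
type `t`. -/
noncomputable def edge (t : ConnType p) (s s' : Shape p S.P) (u v : Fin N → S.Letter 𝒩) :
    Bool ⊕ (S.Query × Bool) :=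
  match s, s' with
  | .net, .net => tell (load v = load u ∧ Kind.Is t (𝒩.kind N (inner u)) ∧
      (𝒩.ch false N (inner u) = inner v ∨
        (𝒩.kind N (inner u)).Uses true ∧ 𝒩.ch true N (inner u) = inner v))
  | .net, .inp j => tell ((t = .or ∧ 𝒩.kind N (inner u) = .base (.inl j)) ∧ inner v = inner u ∧
      𝒩.bs N (inner u) = load v)
  | .net, .leaf q => tell ((t = .or ∧ 𝒩.kind N (inner u) = .base (.inr q)) ∧ inner v = inner u ∧
      𝒩.bs N (inner u) = load v)
  | .leaf q, .gate q' => ask ((t = .or ∧ q' = q) ∧ inner v = inner u ∧ load v = load u)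
      (called q .output)
  | .pin q j, .inp j' => tell ((t = .or ∧ S.pin q j = some j') ∧ inner v = inner u ∧
      load v = load u)
  | .gate q, .gate q' => ask (q' = q ∧ inner v = inner u ∧
      (fun t => (load v t).1) = (fun t => (load u t).1) ∧
      Payload.idx (load v) = Payload.idx (load u) ∧ Packed (Payload.name (load v)))
      (called q (gateType t))
  | .gate q, .pin q' j => ask ((t = .or ∧ q' = q) ∧ inner v = inner u ∧
      (fun t => (load v t).1) = (fun t => (load u t).1) ∧
      Payload.name (load v) = Payload.name (load u) ∧ Packed (Payload.idx (load v)))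
      (called q' (.input j))
  | _, _ => .inl false

theorem reg_edge (t : ConnType p) (s s' : Shape p S.P) :
    RegFun (fun N (z : Fin N → S.Letter 𝒩 × S.Letter 𝒩) =>
      S.edge t s s' (fun t => (z t).1) (fun t => (z t).2)) := by
  have hinner := RegFun.eq_tracks (B := S.Letter 𝒩 × S.Letter 𝒩) (fun z => z.2.2.1)
    (fun z => z.1.2.1)
  have hload := RegFun.eq_tracks (B := S.Letter 𝒩 × S.Letter 𝒩) (fun z => z.2.2.2)
    (fun z => z.1.2.2)
  have hnum := RegFun.eq_tracks (B := S.Letter 𝒩 × S.Letter 𝒩) (fun z => z.2.2.2.1)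
    (fun z => z.1.2.2.1)
  have hidx := RegFun.eq_tracks (B := S.Letter 𝒩 × S.Letter 𝒩) (fun z => z.2.2.2.2.1)
    (fun z => z.1.2.2.2.1)
  have hname := RegFun.eq_tracks (B := S.Letter 𝒩 × S.Letter 𝒩) (fun z => z.2.2.2.2.2)
    (fun z => z.1.2.2.2.2)
  have hkind := 𝒩.reg_kind.comap (fun z : S.Letter 𝒩 × S.Letter 𝒩 => z.1.2.1)
  have hch : ∀ i, RegFun _ := fun i => (𝒩.aut_ch i).graph
    (fun z : S.Letter 𝒩 × S.Letter 𝒩 => z.1.2.1) (fun z => z.2.2.1)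
  have hbs := 𝒩.aut_bs.graph (fun z : S.Letter 𝒩 × S.Letter 𝒩 => z.1.2.1) (fun z => z.2.2.2)
  have hfalse : RegFun (fun N (_ : Fin N → S.Letter 𝒩 × S.Letter 𝒩) =>
      (.inl false : Bool ⊕ (S.Query × Bool))) := RegFun.const _
  cases s with
  | net =>
    cases s' with
    | net =>
      exact (hload.and ((hkind.map (Kind.Is t)).and ((hch false).or
        ((hkind.map fun k => k.Uses true).and (hch true))))).map tell
    | inp j => exact ((hkind.map fun k => t = .or ∧ k = .base (.inl j)).and (hinner.and hbs)).map tell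
    | leaf q => exact ((hkind.map fun k => t = .or ∧ k = .base (.inr q)).and (hinner.and hbs)).map tell
    | _ => exact hfalse
  | inp j => exact hfalse
  | leaf q =>
    cases s' with
    | gate q' =>
      exact ((RegFun.const (t = .or ∧ q' = q)).and (hinner.and hload)).map
        (fun P => ask P (called q .output))
    | _ => exact hfalse
  | pin q j =>
    cases s' with
    | inp j' => exact ((RegFun.const (t = .or ∧ S.pin q j = some j')).and (hinner.and hload)).map tell
    | _ => exact hfalse
  | gate q =>
    cases s' with
    | gate q' =>
      exact ((RegFun.const (q' = q)).and (hinner.and (hnum.and (hidx.and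
        (reg_packed.comap fun z : S.Letter 𝒩 × S.Letter 𝒩 => z.2.2.2.2.2))))).map
          (fun P => ask P (called q (gateType t)))
    | pin q' j =>
      exact ((RegFun.const (t = .or ∧ q' = q)).and (hinner.and (hnum.and (hname.and
        (reg_packed.comap fun z : S.Letter 𝒩 × S.Letter 𝒩 => z.2.2.2.2.1))))).map
          (fun P => ask P (called q' (.input j)))
    | _ => exact hfalse

theorem node_eq_node_iff (hN : 0 < N) {s s' : Shape p S.P} {x x' : Fin N → 𝒩.A}
    {w w' : Fin N → Payload} :
    (node s x w : Fin N → S.Letter 𝒩) = node s' x' w' ↔ s = s' ∧ x = x' ∧ w = w' :=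
  ⟨node_inj hN, by rintro ⟨rfl, rfl, rfl⟩; rfl⟩

def gateLabel {P n : ℕ} : ConnType p → Label P n
  | .and => .and
  | .or => .or
  | _ => .not

def IsGateType (t : ConnType p) : Prop := t = .and ∨ t = .or ∨ t = .not

/-- The second string in the query for an edge. -/
def edgeArg (s s' : Shape p S.P) (w w' : Fin N → Payload) : Fin N → Option Bool :=
  match s, s' with
  | .leaf _, _ => Payload.idx w
  | _, .gate _ => Payload.name w'
  | _, _ => Payload.idx w'

/-- A query sees only the string on a track, which determines the track if the blanks are at the
end. So `Packed` makes the predecessor with a given string unique. -/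
theorem mem_gate_pred_iff {n : ℕ} {q q' : κ} {x x' : Fin (S.width n) → 𝒩.A}
    {w w' : Fin (S.width n) → Payload} {a : Name} (ha : a ∈ (S.C q n).gates) :
    (∃ b ∈ (S.C q n).pred a, (node (.gate q) x (Payload.setName w (pack _ b)) :
      Fin (S.width n) → S.Letter 𝒩) = node (.gate q') x' w') ↔
    (q' = q ∧ x' = x ∧ (fun t => (w' t).1) = (fun t => (w t).1) ∧
      Payload.idx w' = Payload.idx w ∧ Packed (Payload.name w')) ∧
      str (Payload.name w') ∈ (S.C q n).pred a := by
  simp only [S.node_eq_node_iff (S.width_pos n)]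
  constructor
  · rintro ⟨b, hb, h1, rfl, rfl⟩
    have h2 : str (Payload.name (Payload.setName w (pack (S.width n) b))) = b :=
      S.str_pack_name ((S.C q n).pred_subset _ ha hb)
    refine ⟨⟨(Shape.gate.inj h1).symm, rfl, rfl, rfl, packed_pack _ _⟩, ?_⟩
    rwa [h2]
  · rintro ⟨⟨rfl, rfl, h1, h2, h3⟩, hb⟩
    refine ⟨_, hb, rfl, rfl, ?_⟩
    rw [← h3]
    funext t
    exact Prod.ext (congrFun h1 t).symm (Prod.ext (congrFun h2 t).symm rfl)

theorem gateLabel_ne {P n : ℕ} (t : ConnType p) :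
    (∀ c, (.const c : Label P n) ≠ gateLabel t) ∧ ∀ j i, (.input j i : Label P n) ≠ gateLabel t := by
  cases t <;> simp [gateLabel]

theorem inner_eq_gateLabel_iff {P n : ℕ} {t : ConnType p} (ht : IsGateType t) (l : Label P n) :
    (l.inner : Label p n) = gateLabel t ↔ l = gateLabel t ∨ t = .or ∧ ∃ j i, l = .input j i := by
  rcases ht with rfl | rfl | rfl <;> cases l <;> simp [Label.inner, gateLabel]

theorem conn_gateType {P n : ℕ} {t : ConnType p} (ht : IsGateType t) (C : Circuit P n) (a b : Name) :
    C.Conn (gateType t) a b ↔ a ∈ C.gates ∧ C.label a = gateLabel t ∧ b ∈ C.pred a := by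
  rcases ht with rfl | rfl | rfl <;> exact Iff.rfl

section Edge

variable {n : ℕ} {t : ConnType p} (s' : Shape p S.P)
  (x x' : Fin (S.width n) → 𝒩.A) (w w' : Fin (S.width n) → Payload)

theorem edge_net_iff (ht : IsGateType t) : Holds (S.answer n (str (Payload.name w))
      (str (S.edgeArg .net s' w w'))) (S.edge t .net s' (node .net x w) (node s' x' w')) ↔
    S.nodeLabel 𝒩 n .net x w = gateLabel t ∧ node s' x' w' ∈ S.nodePred 𝒩 n .net x w := by
  classical
  have hne := fun s s' x x' w w' =>
    S.node_eq_node_iff (𝒩 := 𝒩) (S.width_pos n) (s := s) (s' := s') (x := x) (x' := x') (w := w)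
      (w' := w')
  have hl : ∀ s x w, load (node s x w : Fin (S.width n) → S.Letter 𝒩) = w := fun _ _ _ => rfl
  have hi : ∀ s x w, inner (node s x w : Fin (S.width n) → S.Letter 𝒩) = x := fun _ _ _ => rfl
  simp only [nodeLabel, nodePred]
  cases hk : 𝒩.kind _ x with
  | base b =>
    rcases ht with rfl | rfl | rfl <;> cases b <;> cases s' <;>
    simp [edge, holds_tell, not_holds_false, hl, hi, hk, Kind.Is, Kind.label, gateLabel, hne,
      Shape.ofBase] <;> grind
  | _ =>
    rcases ht with rfl | rfl | rfl <;> cases s' <;>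
    simp [edge, holds_tell, not_holds_false, hl, hi, hk, Kind.Is, Kind.Uses, Kind.label, gateLabel,
      hne] <;> grind

theorem edge_leaf_iff (ht : IsGateType t) (q : κ) : Holds (S.answer n (str (Payload.name w))
      (str (S.edgeArg (.leaf q) s' w w'))) (S.edge t (.leaf q) s' (node (.leaf q) x w) (node s' x' w')) ↔
    S.nodeLabel 𝒩 n (.leaf q) x w = gateLabel t ∧ node s' x' w' ∈ S.nodePred 𝒩 n (.leaf q) x w := by
  classical
  have hne := fun s s' x x' w w' =>
    S.node_eq_node_iff (𝒩 := 𝒩) (S.width_pos n) (s := s) (s' := s') (x := x) (x' := x') (w := w)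
      (w' := w')
  simp only [nodeLabel, nodePred]
  cases s' with
  | gate q' =>
    simp only [edge, holds_ask]
    show _ ∧ S.IsOut n q w ↔ _
    split_ifs with h
    · rw [Finset.mem_singleton, hne, and_iff_left h]
      rcases ht with rfl | rfl | rfl <;> simp [gateLabel]
      exact fun _ => Iff.rfl
    · simp [h]
  | _ =>
    simp only [edge, Holds, Bool.false_eq_true, false_iff]
    split_ifs <;> simp [hne]

theorem edge_pin_iff (ht : IsGateType t) (q : κ) (j : Fin (S.P q)) :
    Holds (S.answer n (str (Payload.name w))
      (str (S.edgeArg (.pin q j) s' w w'))) (S.edge t (.pin q j) s' (node (.pin q j) x w) (node s' x' w')) ↔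
    S.nodeLabel 𝒩 n (.pin q j) x w = gateLabel t ∧
      node s' x' w' ∈ S.nodePred 𝒩 n (.pin q j) x w := by
  classical
  have hne := fun s s' x x' w w' =>
    S.node_eq_node_iff (𝒩 := 𝒩) (S.width_pos n) (s := s) (s' := s') (x := x) (x' := x') (w := w)
      (w' := w')
  simp only [nodeLabel, nodePred]
  cases s' with
  | inp j' =>
    simp only [edge, holds_tell]
    cases hj : S.pin q j with
    | none => simp
    | some j'' =>
      rw [Option.elim_some, Option.elim_some, Finset.mem_singleton, hne]
      rcases ht with rfl | rfl | rfl <;> simp [gateLabel, eq_comm (a := j'')]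
      exact fun _ => Iff.rfl
  | _ =>
    simp only [edge, Holds, Bool.false_eq_true, false_iff]
    cases hj : S.pin q j <;> simp [hne]

theorem edge_gate_iff (ht : IsGateType t) (q : κ) : Holds (S.answer n (str (Payload.name w))
      (str (S.edgeArg (.gate q) s' w w'))) (S.edge t (.gate q) s' (node (.gate q) x w) (node s' x' w')) ↔
    str (Payload.name w) ∈ (S.C q n).gates ∧ S.nodeLabel 𝒩 n (.gate q) x w = gateLabel t ∧
      node s' x' w' ∈ S.nodePred 𝒩 n (.gate q) x w := by
  classical
  have hne := fun s s' x x' w w' =>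
    S.node_eq_node_iff (𝒩 := 𝒩) (S.width_pos n) (s := s) (s' := s') (x := x) (x' := x') (w := w)
      (w' := w')
  have hl : ∀ s x w, load (node s x w : Fin (S.width n) → S.Letter 𝒩) = w := fun _ _ _ => rfl
  have hi : ∀ s x w, inner (node s x w : Fin (S.width n) → S.Letter 𝒩) = x := fun _ _ _ => rfl
  simp only [nodeLabel, nodePred]
  generalize ha : str (Payload.name w) = a
  rw [inner_eq_gateLabel_iff ht]
  cases s' with
  | gate q' =>
    simp only [edge, holds_ask, hl, hi]
    show _ ∧ (S.C q n).Conn (gateType t) a (str (Payload.name w')) ↔ _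
    rw [conn_gateType ht]
    by_cases hg : a ∈ (S.C q n).gates
    swap
    · simp [hg]
    have key := S.mem_gate_pred_iff (q' := q') (x := x) (x' := x') (w := w) (w' := w') hg
    cases hlab : (S.C q n).label a with
    | const c => simp [(gateLabel_ne t).1 c]
    | input j i => simp [(gateLabel_ne t).2 j i, hne]
    | _ =>
      simp only [Finset.mem_image, key]
      simp [hg]
      tauto
  | pin q' j =>
    simp only [edge, holds_ask, hl, hi]
    show _ ∧ (S.C q' n).Conn (.input j) a (str (Payload.idx w')) ↔ _
    constructor
    · rintro ⟨⟨⟨rfl, rfl⟩, rfl, h1, h2, h3⟩, hg, i, h4, h5⟩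
      refine ⟨hg, .inr ⟨rfl, _, _, h4⟩, ?_⟩
      rw [h4]
      simp only [Finset.mem_singleton, hne, true_and]
      rw [← h5, ← h3]
      funext t
      exact Prod.ext (congrFun h1 t) (Prod.ext rfl (congrFun h2 t))
    · rintro ⟨hg, h1, h2⟩
      cases hlab : (S.C q n).label a with
      | const c => simp [hlab] at h2
      | input j' i =>
        simp only [hlab, Finset.mem_singleton, hne] at h1 h2
        obtain ⟨h3, rfl, rfl⟩ := h2
        cases h3
        have hlen := bits_length_le (i.2.trans (S.lt_two_pow_width n))
        refine ⟨⟨⟨?_, rfl⟩, rfl, rfl, rfl, packed_pack _ _⟩, hg, i, hlab, str_pack hlen⟩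
        rcases h1 with h1 | h1
        · exact absurd h1 ((gateLabel_ne t).2 _ _)
        · exact h1.1
      | _ => simp [hlab, hne] at h2
  | _ =>
    simp only [edge, Holds, Bool.false_eq_true, false_iff]
    rintro ⟨-, -, h⟩
    cases hlab : (S.C q n).label a <;> simp [hlab, hne] at h

end Edge

theorem edge_iff {n : ℕ} {t : ConnType p} (ht : IsGateType t) (s s' : Shape p S.P)
    (x x' : Fin (S.width n) → 𝒩.A) (w w' : Fin (S.width n) → Payload) :
    Holds (S.answer n (str (Payload.name w))
      (str (S.edgeArg s s' w w'))) (S.edge t s s' (node s x w) (node s' x' w')) ↔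
    S.NodeOK n s w ∧ S.nodeLabel 𝒩 n s x w = gateLabel t ∧
      node s' x' w' ∈ S.nodePred 𝒩 n s x w := by
  cases s with
  | net => exact (S.edge_net_iff s' x x' w w' ht).trans (and_iff_right trivial).symm
  | inp j => simp [edge, Holds, nodePred]
  | leaf q => exact (S.edge_leaf_iff s' x x' w w' ht q).trans (and_iff_right trivial).symm
  | pin q j => exact (S.edge_pin_iff s' x x' w w' ht q j).trans (and_iff_right trivial).symm
  | gate q => exact S.edge_gate_iff s' x x' w w' ht q

end Calls

theorem constTag_some {T : Type} {N : ℕ} (hN : 0 < N) (u : Fin N → T) :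
    constTag (fun t => some (u t)) = (constTag u).map some := by
  cases h : constTag u with
  | some x =>
    rw [eq_of_constTag h]
    exact constTag_const hN (some x)
  | none =>
    cases h' : constTag (fun t => some (u t)) with
    | none => rfl
    | some x =>
      have h1 := eq_of_constTag h'
      have h2 : u = fun _ => u ⟨0, hN⟩ := by
        funext t
        exact Option.some_injective _ ((congrFun h1 t).trans (congrFun h1 ⟨0, hN⟩).symm)
      rw [h2, constTag_const hN] at h
      simp at h

theorem eq_bits_of_isCanon {N : ℕ} {b : List Bool} (hb : b.length ≤ N) (h : IsCanon (pack N b)) :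
    ∃ m, m < 2 ^ N ∧ b = Nat.bits m := by
  obtain ⟨m, hm, h⟩ := isCanon_iff.1 h
  refine ⟨m, hm, ?_⟩
  rw [← str_pack hb, h, str_pack (bits_length_le hm)]

theorem IsCanon.str_eq {N : ℕ} {w : Fin N → Option Bool} (h : IsCanon w) :
    str w = Nat.bits (trackNum w) := by
  obtain ⟨m, hm, rfl⟩ := isCanon_iff.1 h
  rw [trackNum_pack hm, str_pack (bits_length_le hm)]

/-! ### The classifier for the direct connection language -/

namespace Calls

variable {p : ℕ} {κ : Type} (S : Calls p κ) (𝒩 : Net (Fin p ⊕ κ) Payload)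

/-- Letters of a name together with those of a second argument. -/
abbrev LetterPair : Type := S.Letter 𝒩 × (Option (S.Letter 𝒩) × Option Bool)

variable {𝒩} {N : ℕ}

/-- Whether the node of shape `s` with the name `u` is the constant `c`. -/
noncomputable def constAnswer (c : Bool) (s : Shape p S.P) (u : Fin N → S.Letter 𝒩) :
    Bool ⊕ (S.Query × Bool) :=
  match s with
  | .net => tell (𝒩.kind N (inner u) = .const c)
  | .inp _ => if c then .inl false else askNot (IsCanon (Payload.idx (load u))) below
  | .leaf q => if c then .inl false else askNot True (called q .output)
  | .pin q j => tell (S.pin q j = none ∧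
      (c = true ↔ trackNum (Payload.idx (load u)) < Payload.num (load u)))
  | .gate q => ask True (called q (.const c))

open Classical in
noncomputable def edgeAnswer (t : ConnType p) (v : Fin N → S.LetterPair 𝒩) (fits : Prop) :
    Bool ⊕ (S.Query × Bool) :=
  (shape fun t => (v t).1).elim (.inl false) fun s =>
    (constTag fun t => (v t).2.1.map Prod.fst).elim (.inl false) fun s' =>
      s'.elim (.inl false) fun s' => if fits then
        S.edge t s s' (fun t => (v t).1) (fun t => (v t).2.1.getD (v t).1) else .inl false

noncomputable def classify (emb : Bool → 𝒩.A) (t : ConnType p) (N : ℕ)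
    (v : Fin N → S.LetterPair 𝒩) (fits : Prop) : Bool ⊕ (S.Query × Bool) :=
  match t with
  -- Words without a shape are gates too, labelled as the constant `false`.
  | .const c => (shape fun t => (v t).1).elim (tell (c = false)) fun s =>
      S.constAnswer c s fun t => (v t).1
  | .input j => ask (fits ∧ (shape fun t => (v t).1) = some (.inp j) ∧
      IsCanon (Payload.idx (load fun t => (v t).1)) ∧
      Payload.idx (load fun t => (v t).1) = fun t => (v t).2.2) below
  | .output => tell (fits ∧ (shape fun t => (v t).1) = some .net ∧
      (load fun t => (v t).1) = default ∧
      (inner fun t => (v t).1) = (fun t => emb ((v t).2.2.getD false)) ∧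
      IsCanon fun t => (v t).2.2)
  | .and => S.edgeAnswer .and v fits
  | .or => S.edgeAnswer .or v fits
  | .not => S.edgeAnswer .not v fits

theorem reg_constAnswer (c : Bool) (s : Shape p S.P) :
    RegFun (fun N (u : Fin N → S.Letter 𝒩) => S.constAnswer c s u) := by
  have hidx := fun u : S.Letter 𝒩 => u.2.2.2.1
  cases s with
  | net => exact (𝒩.reg_kind.comap fun u : S.Letter 𝒩 => u.2.1).map fun k => tell (k = .const c)
  | inp j =>
    cases c
    · exact (reg_isCanon.comap fun u : S.Letter 𝒩 => u.2.2.2.1).map fun P => askNot P below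
    · exact RegFun.const _
  | leaf q => exact RegFun.const (if c then .inl false else askNot True (called q .output))
  | pin q j =>
    exact (RegFun.lt.comap fun u : S.Letter 𝒩 => (u.2.2.2.1.getD false, u.2.2.1)).map
      fun P => tell (S.pin q j = none ∧ (c = true ↔ P))
  | gate q => exact RegFun.const (ask True (called q (.const c)))

variable [Finite κ]

theorem reg_shape : RegFun (fun N (u : Fin N → S.Letter 𝒩) => shape u) :=
  RegFun.constTag.comap Prod.fst

theorem reg_edgeAnswer (t : ConnType p) (fits : Prop) :
    RegFun (fun N (v : Fin N → S.LetterPair 𝒩) => S.edgeAnswer t v fits) := by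
  classical
  have h1 : RegFun (fun N (v : Fin N → S.LetterPair 𝒩) => shape fun t => (v t).1) :=
    S.reg_shape.comap Prod.fst
  have h2 : RegFun (fun N (v : Fin N → S.LetterPair 𝒩) =>
      constTag fun t => (v t).2.1.map Prod.fst) :=
    RegFun.constTag.comap fun z : S.LetterPair 𝒩 => z.2.1.map Prod.fst
  refine RegFun.bind (h1.map₂ h2 Prod.mk) (f := fun x N (v : Fin N → S.LetterPair 𝒩) =>
    x.1.elim (.inl false) fun s => x.2.elim (.inl false) fun s' =>
      s'.elim (.inl false) fun s' => if fits then
        S.edge t s s' (fun t => (v t).1) (fun t => (v t).2.1.getD (v t).1) else .inl false) ?_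
  rintro ⟨_ | s, _ | _ | s'⟩
  any_goals exact RegFun.const (B := S.LetterPair 𝒩) (Sum.inl false : Bool ⊕ (S.Query × Bool))
  by_cases hf : fits
  · simp only [Option.elim_some, hf, if_true]
    exact (S.reg_edge t s s').comap fun z : S.LetterPair 𝒩 => (z.1, z.2.1.getD z.1)
  · simp only [Option.elim_some, hf, if_false]
    exact RegFun.const _

theorem reg_classify (emb : Bool → 𝒩.A) (t : ConnType p) : RegFun (S.classify emb t) := by
  refine RegFun.pi fun fits => ?_
  have hshape : RegFun (fun N (v : Fin N → S.LetterPair 𝒩) => shape fun t => (v t).1) :=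
    S.reg_shape.comap Prod.fst
  cases t with
  | and => exact S.reg_edgeAnswer _ _
  | or => exact S.reg_edgeAnswer _ _
  | not => exact S.reg_edgeAnswer _ _
  | const c =>
    refine RegFun.bind hshape (f := fun x N (v : Fin N → S.LetterPair 𝒩) =>
      x.elim (tell (c = false)) fun s => S.constAnswer c s fun t => (v t).1) ?_
    rintro (_ | s)
    · exact RegFun.const _
    · exact (S.reg_constAnswer c s).comap Prod.fst
  | input j =>
    exact ((RegFun.const fits).and ((hshape.map fun x => x = some (.inp j)).and
      ((reg_isCanon.comap fun z : S.LetterPair 𝒩 => z.1.2.2.2.1).and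
        (RegFun.eq_tracks (fun z : S.LetterPair 𝒩 => z.1.2.2.2.1) fun z => z.2.2)))).map
          fun P => ask P below
  | output =>
    exact ((RegFun.const fits).and ((hshape.map fun x => x = some .net).and
      ((RegFun.eq_tracks (fun z : S.LetterPair 𝒩 => z.1.2.2) fun _ => default).and
        ((RegFun.eq_tracks (fun z : S.LetterPair 𝒩 => z.1.2.1) fun z => emb (z.2.2.getD false)).and
          (reg_isCanon.comap fun z : S.LetterPair 𝒩 => z.2.2))))).map tell

def edgeLetter (s s' : Shape p S.P) (x x' : Payload) : Option Bool :=
  match s, s' with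
  | .leaf _, _ => x.2.1
  | _, .gate _ => x'.2.2
  | _, _ => x'.2.1

omit [Finite κ] in
theorem edgeArg_eq (s s' : Shape p S.P) (w w' : Fin N → Payload) :
    S.edgeArg s s' w w' = fun t => S.edgeLetter s s' (w t) (w' t) := by
  cases s <;> cases s' <;> rfl

/-- The classifier for the direct connection language. -/
noncomputable def classifier (emb : Bool → 𝒩.A) :
    Classifier (ConnType p) S.Query (S.Letter 𝒩) where
  fast
    | .and => true
    | .or => true
    | .not => true
    | _ => false
  cls := S.classify emb
  outA t z := match t with
    | .const _ => match z.1.1 with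
      | .inp _ => z.1.2.2.2.1
      | _ => z.1.2.2.2.2
    | .input _ => z.1.2.2.2.1
    | .output => none
    | _ => z.1.2.2.2.2
  outB t z := match t with
    | .const _ => z.1.2.2.2.1
    | .input _ => none
    | .output => none
    | _ => S.edgeLetter z.1.1 (z.2.1.getD z.1).1 z.1.2.2 (z.2.1.getD z.1).2.2
  regular := S.reg_classify emb

section Correct

variable {n : ℕ} {w : ℕ} [NeZero w] (enc : S.Letter 𝒩 → Fin w → Bool)
  (emb : Bool → 𝒩.A)

/-- The outputs, named by the words for their numbers. -/
noncomputable def outName (emb : Bool → 𝒩.A) (N : ℕ) (i : Fin (2 ^ N)) : Fin N → 𝒩.A :=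
  fun t => emb (wordOf N i t)

/-- If `b` encodes a word, this is `edge_iff`. If not, some block of `b` does not decode or `b` is
too long; then the answer is negative, and no predecessor has the name `b`. -/
theorem holds_edgeAnswer (henc : Function.Injective enc) {t : ConnType p} (ht : IsGateType t)
    (u : Fin (S.width n) → S.Letter 𝒩) (b : Name)
    (out : Fin (2 ^ S.width n) → Fin (S.width n) → 𝒩.A) :
    let v : Fin (S.width n) → S.LetterPair 𝒩 := fun s => (u s, argLetter enc true b s)
    Holds (S.answer n (str fun s => (u s).2.2.2.2) (str fun s =>
        S.edgeLetter (u s).1 ((v s).2.1.getD (u s)).1 (u s).2.2 ((v s).2.1.getD (u s)).2.2))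
      (S.edgeAnswer t v (argFits w true b (S.width n))) ↔
    u ∈ (S.wordCircuit 𝒩 n out).gates ∧ (S.wordCircuit 𝒩 n out).label u = gateLabel t ∧
      ∃ v ∈ (S.wordCircuit 𝒩 n out).pred u, encodeWord enc v = b := by
  classical
  intro v
  have hpos := S.width_pos n
  rw [mem_gates, show (S.wordCircuit 𝒩 n out).pred u =
    (shape u).elim ∅ fun s => S.nodePred 𝒩 n s (inner u) (load u) from rfl,
    show (S.wordCircuit 𝒩 n out).label u = (shape u).elim (.const false)
      fun s => S.nodeLabel 𝒩 n s (inner u) (load u) from rfl]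
  unfold edgeAnswer
  rw [show (shape fun t => (v t).1) = shape u from rfl]
  cases hs : shape u with
  | none => simp [not_holds_false]
  | some s =>
    simp only [Option.elim_some]
    by_cases hb : ∃ u' : Fin (S.width n) → S.Letter 𝒩, encodeWord enc u' = b
    · obtain ⟨u', rfl⟩ := hb
      have hv : v = fun s => (u s, (some (u' s), none)) := by
        funext s
        simp only [v, argLetter, if_true, block_encodeWord, decodeLetter_enc enc henc]
      have hfits : argFits w true (encodeWord enc u') (S.width n) :=
        (encodeWord_length enc u').le
      have hmem : (∃ v ∈ S.nodePred 𝒩 n s (inner u) (load u), encodeWord enc v = encodeWord enc u') ↔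
          u' ∈ S.nodePred 𝒩 n s (inner u) (load u) :=
        ⟨fun ⟨v, h, h'⟩ => encodeWord_injective enc henc _ h' ▸ h, fun h => ⟨u', h, rfl⟩⟩
      rw [hmem]
      simp only [hv, Option.map_some, Option.getD_some, hfits, if_true]
      rw [constTag_some hpos, show (constTag fun t => (u' t).1) = shape u' from rfl]
      cases hs' : shape u' with
      | none =>
        simp only [Option.map_none, Option.elim_none, not_holds_false, false_iff]
        rintro ⟨h1, -, h3⟩
        obtain ⟨s', x', w', rfl, -⟩ := nodePred_ok h1 h3
        rw [shape_node hpos] at hs'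
        simp at hs'
      | some s' =>
        simp only [Option.map_some, Option.elim_some]
        have key := S.edge_iff ht s s' (inner u) (inner u') (load u) (load u')
        rw [← eq_node hs, ← eq_node hs', edgeArg_eq] at key
        have h1 : ∀ t, (u t).1 = s := fun t => congrFun (eq_of_constTag hs) t
        have h2 : ∀ t, (u' t).1 = s' := fun t => congrFun (eq_of_constTag hs') t
        simp only [h1, h2]
        exact key
    · have : ¬ ∃ v ∈ S.nodePred 𝒩 n s (inner u) (load u), encodeWord enc v = b :=
        fun ⟨v, _, h⟩ => hb ⟨v, h⟩
      simp only [this, and_false, iff_false]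
      intro h
      cases hc : constTag fun t => (v t).2.1.map Prod.fst with
      | none => simp [hc, not_holds_false] at h
      | some s' =>
        cases s' with
        | none => simp [hc, not_holds_false] at h
        | some s' =>
          simp only [hc, Option.elim_some] at h
          split_ifs at h with hf
          · apply hb
            have h1 := fun t => congrFun (eq_of_constTag hc) t
            have h2 : ∀ t : Fin (S.width n), ∃ g, decodeLetter enc (block w b t) = some g := by
              intro t
              have := h1 t
              simp only [v, argLetter, if_true, Option.map_eq_some_iff] at this
              obtain ⟨g, hg, -⟩ := this
              exact ⟨g, hg⟩
            choose g hg using h2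
            exact ⟨g, ((eq_encodeWord_iff enc g b).2
              ⟨hf, fun s => eq_of_decodeLetter enc (hg s)⟩).symm⟩
          · exact not_holds_false _ h

omit [Finite κ] in
theorem holds_constAnswer (c : Bool) (s : Shape p S.P) (u : Fin (S.width n) → S.Letter 𝒩)
    (hs : shape u = some s) :
    Holds (S.answer n (str fun t => match (u t).1 with
        | .inp _ => (u t).2.2.2.1
        | _ => (u t).2.2.2.2) (str fun t => (u t).2.2.2.1))
      (S.constAnswer c s u) ↔
    S.NodeOK n s (load u) ∧ S.nodeLabel 𝒩 n s (inner u) (load u) = .const c := by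
  classical
  have h1 : ∀ t, (u t).1 = s := fun t => congrFun (eq_of_constTag hs) t
  simp only [h1]
  cases s with
  | net =>
    simp only [constAnswer, holds_tell, NodeOK, nodeLabel, true_and]
    cases 𝒩.kind _ (inner u) <;> simp [Kind.label]
  | inp j =>
    simp only [constAnswer, NodeOK, nodeLabel, true_and]
    cases c
    · simp only [Bool.false_eq_true, if_false, holds_askNot]
      have h2 : IsCanon (Payload.idx (load u)) →
          (S.answer n (str fun t => (u t).2.2.2.1) (str fun t => (u t).2.2.2.1) below ↔
            trackNum (Payload.idx (load u)) < n) := by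
        intro h
        show Nat.ofDigits 2 ((str (Payload.idx (load u))).map Bool.toNat) < n ↔ _
        rw [h.str_eq, ofDigits_bits]
      split_ifs with h
      · simp [h.1, h2 h.1, h.2]
      · simp only [iff_true]
        intro h3
        rw [h2 h3]
        exact fun h4 => h ⟨h3, h4⟩
    · simp only [if_true, not_holds_false, false_iff]
      split_ifs <;> simp
  | leaf q =>
    simp only [constAnswer, NodeOK, nodeLabel, true_and]
    cases c
    · simp only [Bool.false_eq_true, if_false, holds_askNot, true_imp_iff]
      show ¬ S.IsOut n q (load u) ↔ _
      split_ifs with h <;> simp [h]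
    · simp only [if_true, not_holds_false, false_iff]
      split_ifs <;> simp
  | pin q j =>
    simp only [constAnswer, holds_tell, NodeOK, nodeLabel, true_and]
    cases S.pin q j with
    | none => cases c <;> simp
    | some j' => simp
  | gate q =>
    simp only [constAnswer, holds_ask, true_and, NodeOK, nodeLabel]
    show _ ∧ (S.C q n).label (str (Payload.name (load u))) = .const c ↔ _
    refine and_congr_right fun _ => ?_
    cases (S.C q n).label (str (Payload.name (load u))) <;> simp [Label.inner]

omit [Finite κ] in
theorem label_eq_input {s : Shape p S.P} {x : Fin N → 𝒩.A} {w : Fin N → Payload} {j : Fin p}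
    {i : Fin n} : S.nodeLabel 𝒩 n s x w = .input j i ↔
      s = .inp j ∧ IsCanon (Payload.idx w) ∧ trackNum (Payload.idx w) = i := by
  cases s with
  | net => simp only [nodeLabel]; cases 𝒩.kind _ x <;> simp [Kind.label]
  | inp j' =>
    simp only [nodeLabel]
    split_ifs with h
    · simp [h.1, Fin.ext_iff]
    · simp only [false_iff]
      rintro ⟨-, h1, h2⟩
      exact h ⟨h1, by rw [h2]; exact i.2⟩
  | leaf q => simp only [nodeLabel]; split_ifs <;> simp
  | pin q j' => simp only [nodeLabel]; cases S.pin q j' <;> simp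
  | gate q => simp only [nodeLabel]; cases (S.C q n).label _ <;> simp [Label.inner]

theorem accepts_classifier (henc : Function.Injective enc) (t : ConnType p) (a b : Name) :
    (S.classifier emb).Accepts enc (fun n q a b => S.query q.1 n q.2 a b) n (S.width n) t a b ↔
      ((S.wordCircuit 𝒩 n (outName emb _)).toCircuit henc).Conn t a b := by
  rw [WordCircuit.conn_iff]
  refine exists_congr fun u => and_congr_right fun _ => ?_
  have hpos := S.width_pos n
  set W := S.wordCircuit 𝒩 n (outName emb _) with hW
  have hlabel : W.label u = (shape u).elim (.const false)
      fun s => S.nodeLabel 𝒩 n s (inner u) (load u) := rfl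
  have hgates : u ∈ W.gates ↔ _ := S.mem_gates 𝒩 n _
  cases t with
  | and => exact S.holds_edgeAnswer enc henc (.inl rfl) u b _
  | or => exact S.holds_edgeAnswer enc henc (.inr (.inl rfl)) u b _
  | not => exact S.holds_edgeAnswer enc henc (.inr (.inr rfl)) u b _
  | const c =>
    show Holds (S.answer n _ _) ((shape u).elim (tell (c = false)) fun s => S.constAnswer c s u) ↔
      u ∈ W.gates ∧ W.label u = .const c
    rw [hgates, hlabel]
    cases hs : shape u with
    | none => simp [holds_tell, eq_comm]
    | some s => exact S.holds_constAnswer c s u hs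
  | input j =>
    show Holds (S.answer n (str (Payload.idx (load u))) _) (ask (b.length ≤ S.width n ∧
      shape u = some (.inp j) ∧ IsCanon (Payload.idx (load u)) ∧
        Payload.idx (load u) = pack (S.width n) b) below) ↔
      u ∈ W.gates ∧ ∃ i : Fin n, W.label u = .input j i ∧ b = Nat.bits i
    rw [holds_ask, hgates, hlabel]
    show _ ∧ Nat.ofDigits 2 ((str (Payload.idx (load u))).map Bool.toNat) < n ↔ _
    cases hs : shape u with
    | none => simp
    | some s =>
      simp only [Option.elim_some, label_eq_input]
      constructor
      · rintro ⟨⟨h1, h2, h3, h4⟩, h5⟩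
        rw [h3.str_eq, ofDigits_bits] at h5
        obtain rfl := Option.some_injective _ h2
        refine ⟨trivial, ⟨_, h5⟩, ⟨rfl, h3, rfl⟩, ?_⟩
        rw [← h3.str_eq, h4, str_pack h1]
      · rintro ⟨-, i, ⟨rfl, h1, h2⟩, rfl⟩
        rw [h1.str_eq, ofDigits_bits, h2]
        have hi := bits_length_le (i.2.trans (S.lt_two_pow_width n))
        refine ⟨⟨hi, rfl, h1, ?_⟩, i.2⟩
        obtain ⟨m, hm, h3⟩ := isCanon_iff.1 h1
        rw [h3, trackNum_pack hm] at h2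
        rw [h3, h2]
  | output =>
    refine (holds_tell (S.answer n (str fun _ : Fin (S.width n) => none)
      (str fun _ : Fin (S.width n) => none)) _).trans ?_
    show (b.length ≤ S.width n ∧ shape u = some .net ∧ load u = default ∧
      inner u = (fun t => emb ((pack (S.width n) b t).getD false)) ∧
        IsCanon (pack (S.width n) b)) ↔
      u ∈ W.gates ∧ ∃ i : Fin (2 ^ S.width n),
        u = node .net (outName emb _ i) default ∧ b = Nat.bits i
    constructor
    · rintro ⟨h1, h2, h3, h4, h5⟩
      obtain ⟨m, hm, rfl⟩ := eq_bits_of_isCanon h1 h5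
      have hu : u = node .net (outName emb _ ⟨m, hm⟩) default := by
        rw [eq_node h2, h3, h4]
        congr 1
        funext t
        rw [outName, ← getD_pack_bits]
      exact ⟨by rw [hu]; exact W.out_mem ⟨m, hm⟩, ⟨m, hm⟩, hu, rfl⟩
    · rintro ⟨-, i, rfl, rfl⟩
      refine ⟨bits_length_le i.2, shape_node hpos _ _ _, rfl, ?_, isCanon_iff.2 ⟨i, i.2, rfl⟩⟩
      funext t
      have := congrFun (getD_pack_bits (S.width n) i) t
      rw [this]
      rfl

end Correct

end Calls

/-- The code of a letter has a single `1`, at its number; the additional bit keeps the width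
positive even for an empty alphabet. -/
theorem exists_encoding (Γ : Type) [Finite Γ] : ∃ (w : ℕ) (_ : NeZero w) (enc : Γ → Fin w → Bool),
    Function.Injective enc := by
  refine ⟨Nat.card Γ + 1, inferInstance, fun g i => decide (i = (Finite.equivFin Γ g).castSucc), ?_⟩
  intro g g' h
  have := congrFun h (Finite.equivFin Γ g).castSucc
  simpa using this

theorem two_pow_len_le (n : ℕ) : 2 ^ (len n + 1) ≤ 4 * (n + 1) := by
  cases h : len n with
  | zero => omega
  | succ s =>
    have : 2 ^ s ≤ n := Nat.lt_size.1 (by rw [← len, h]; exact Nat.lt_succ_self s)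
    rw [pow_succ, pow_succ]
    omega

/-- There are only polynomially many words of logarithmic length. The bound is weakened so that the
same number `4 ^ D` is the coefficient and the exponent, as the definition of polynomial size
requires. -/
theorem two_pow_mul_len_le (D n : ℕ) : 2 ^ (D * (len n + 1)) ≤ 4 ^ D * (n + 1) ^ 4 ^ D := by
  rw [Nat.mul_comm, pow_mul]
  calc (2 ^ (len n + 1)) ^ D ≤ (4 * (n + 1)) ^ D := Nat.pow_le_pow_left (two_pow_len_le n) D
    _ = 4 ^ D * (n + 1) ^ D := mul_pow _ _ _
    _ ≤ _ := Nat.mul_le_mul_left _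
      (Nat.pow_le_pow_right (Nat.succ_pos n) (Nat.lt_pow_self (by norm_num)).le)

/-- A function whose bits are computed by a network with calls is in `FNC¹`. -/
theorem Calls.fnc1 {p : ℕ} {κ : Type} [Finite κ] (S : Calls p κ) (F : (Fin p → ℕ) → ℕ)
    (h : CompN S.base (fun e (v : Unit → ℕ) => (F e.1.2).testBit (v ()) = true))
    (hF : ∀ e : Input p, F e.1.2 < 2 ^ 2 ^ S.width e.1.1) : FNC1 F := by
  classical
  obtain ⟨𝒩, V, emb, -, hV, hQ⟩ := h
  have hfin := 𝒩.finite_A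
  obtain ⟨w, hw, enc, henc⟩ := exists_encoding (S.Letter 𝒩)
  let emb' : Bool → 𝒩.A := fun b => emb fun _ => b
  have hc : NeZero S.c := ⟨S.c_pos.ne'⟩
  refine ⟨fun n => (S.wordCircuit 𝒩 n (outName emb' _)).toCircuit henc, ⟨⟨w * S.c, fun n a ha => ?_⟩,
    ?_⟩, ?_, ⟨4 + S.c + 𝒩.depth * S.c + 𝒩.depth, fun n => ?_⟩, fun n y hy => ?_⟩
  · rw [WordCircuit.length_of_mem_gates _ henc ha, Nat.mul_assoc]
    rfl
  · obtain ⟨M, c, hM⟩ := (S.classifier emb').decidableInLogtime enc henc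
      S.decidableInLogtime_query S.c
    refine ⟨M, c, fun n t a b => ?_⟩
    have h1 := S.accepts_classifier enc emb' henc (n := n) t a b
    obtain ⟨r, hr, h2⟩ := hM n t a b
    exact ⟨r, hr, h2.trans h1⟩
  · obtain ⟨γ, hγ⟩ : ∃ γ, Nat.card (S.Letter 𝒩) ≤ 2 ^ γ := ⟨_, Nat.lt_two_pow_self.le⟩
    refine ⟨4 ^ ((γ + 2) * S.c), fun n => ?_⟩
    refine (WordCircuit.size_le _ henc).trans (le_trans ?_ (two_pow_mul_len_le _ n))
    rw [Nat.mul_assoc]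
    show _ + 2 ^ S.width n ≤ 2 ^ ((γ + 2) * S.width n)
    have hpos := S.width_pos n
    have h1 : Nat.card (S.Letter 𝒩) ^ S.width n ≤ 2 ^ ((γ + 1) * S.width n) := by
      rw [pow_mul]
      exact Nat.pow_le_pow_left (hγ.trans (Nat.pow_le_pow_right (by norm_num) (Nat.le_succ _))) _
    have h2 : 2 ^ S.width n ≤ 2 ^ ((γ + 1) * S.width n) :=
      Nat.pow_le_pow_right (by norm_num) (Nat.le_mul_of_pos_left _ (Nat.succ_pos _))
    calc _ ≤ 2 ^ ((γ + 1) * S.width n) + 2 ^ ((γ + 1) * S.width n) := Nat.add_le_add h1 h2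
      _ = 2 ^ ((γ + 1) * S.width n + 1) := by rw [pow_succ]; omega
      _ ≤ _ := Nat.pow_le_pow_right (by norm_num) (by nlinarith)
  · obtain ⟨level, hlevel⟩ := S.exists_level 𝒩 n (outName emb' _)
    refine WordCircuit.depthLE _ henc level fun u hu => ⟨(hlevel u hu).1.trans ?_, (hlevel u hu).2⟩
    show 4 + S.c * (len n + 1) + 𝒩.depth * (S.c * (len n + 1) + 1) ≤ _
    nlinarith [Nat.zero_le (𝒩.depth * len n), Nat.zero_le (len n)]
  · let e : Input p := ⟨(n, y), hy⟩
    obtain ⟨V', hV', hnet⟩ := S.exists_valuation 𝒩 e (outName emb' _) (V e) (hV e)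
    have key := WordCircuit.outputs _ henc hV'
    convert key using 1
    refine Nat.eq_of_testBit_eq fun i => ?_
    rw [Bool.eq_iff_iff]
    refine Iff.trans ?_ (testBit_sum (2 ^ S.width n) (fun i => decide (V' (node .net (outName emb' _ i) default))) i).symm
    have h1 : ∀ hi : i < 2 ^ S.width n, (V' (node .net (outName emb' _ ⟨i, hi⟩) default) ↔
        (F y).testBit i = true) := by
      intro hi
      rw [hnet]
      refine (hQ e fun t _ => wordOf _ i t).trans ?_
      show (F y).testBit (Nat.ofBits fun t => wordOf (S.width n) i t) = true ↔ _
      rw [show (Nat.ofBits fun t => wordOf (S.width n) i t) = i from ofBits_wordOf hi]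
    constructor
    · intro hi
      have : i < 2 ^ S.width n := by
        by_contra hle
        rw [Nat.testBit_lt_two_pow ((hF e).trans_le
          (Nat.pow_le_pow_right (by norm_num) (not_lt.1 hle)))] at hi
        exact absurd hi (by simp)
      exact ⟨this, decide_eq_true ((h1 this).2 hi)⟩
    · rintro ⟨hi, h2⟩
      exact (h1 hi).1 (of_decide_eq_true h2)

/-! ### Evaluation of expressions -/

namespace SgPoly

variable {X : Type}

/-- The value of the expression is at most `2 ^ (K.bound * M)` in absolute value if those of the
variables are at most `2 ^ M`, `M ≥ 1`. -/
def bound : SgPoly X → ℕ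
  | .var _ => 1
  | .const c => c.natAbs
  | .add P Q => P.bound + Q.bound + 1
  | .sub P Q => P.bound + Q.bound + 1
  | .mul P Q => P.bound + Q.bound
  | .half P => P.bound
  | .sign P => P.bound

theorem abs_eval_le (K : SgPoly X) {ρ : X → ℤ} {M : ℕ} (hM : 1 ≤ M) (hρ : ∀ v, |ρ v| ≤ 2 ^ M) :
    |K.eval ρ| ≤ 2 ^ (K.bound * M) := by
  -- The extra `1` in the bound of a sum is worth a factor `2 ^ M ≥ 2`, which pays for adding two
  -- numbers below the same power of two.
  have hsum : ∀ {x y : ℤ} {a b : ℕ}, |x| ≤ 2 ^ (a * M) → |y| ≤ 2 ^ (b * M) →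
      |x| + |y| ≤ 2 ^ ((a + b + 1) * M) := by
    intro x y a b hx hy
    have h1 : (2 : ℤ) ^ (a * M) ≤ 2 ^ ((a + b) * M) :=
      pow_le_pow_right₀ (by norm_num) (Nat.mul_le_mul_right _ (by omega))
    have h2 : (2 : ℤ) ^ (b * M) ≤ 2 ^ ((a + b) * M) :=
      pow_le_pow_right₀ (by norm_num) (Nat.mul_le_mul_right _ (by omega))
    have h3 : (2 : ℤ) ^ ((a + b) * M + 1) ≤ 2 ^ ((a + b + 1) * M) :=
      pow_le_pow_right₀ (by norm_num) (by rw [Nat.succ_mul]; omega)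
    rw [pow_succ] at h3
    linarith
  induction K with
  | var v => simpa [eval, bound] using hρ v
  | const c =>
    have h1 : c.natAbs < 2 ^ c.natAbs := Nat.lt_two_pow_self
    have h2 : 2 ^ c.natAbs ≤ 2 ^ (c.natAbs * M) :=
      Nat.pow_le_pow_right (by norm_num) (Nat.le_mul_of_pos_right _ hM)
    rw [eval, bound, Int.abs_eq_natAbs]
    exact_mod_cast h1.le.trans h2
  | add P Q hP hQ => exact (abs_add_le _ _).trans (hsum hP hQ)
  | sub P Q hP hQ => exact (abs_sub _ _).trans (hsum hP hQ)
  | mul P Q hP hQ =>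
    rw [eval, bound, abs_mul, Nat.add_mul, pow_add]
    exact mul_le_mul hP hQ (abs_nonneg _) (by positivity)
  | half P hP =>
    refine le_trans ?_ hP
    rw [eval, abs_le]
    have := neg_abs_le (P.eval ρ)
    have := le_abs_self (P.eval ρ)
    omega
  | sign P hP =>
    have : (1 : ℤ) ≤ 2 ^ (P.bound * M) := one_le_pow₀ (by norm_num)
    rw [eval, bound, sg]
    split_ifs <;> simp [this]

/-- The unknown value occurs only under `sg`, and `sg` does not distinguish a positive number from
`1`. -/
theorem value_eq_of_simpleCalls {p : ℕ} {K : SgPoly (Term p)} (hK : K.SimpleCalls) (x : ℕ)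
    (y : Fin p → ℕ) (hv fv : ℕ) : K.value x y hv fv = K.value x y hv (if 0 < fv then 1 else 0) := by
  unfold value
  induction K with
  | var v => cases v <;> first | rfl | exact hK.elim
  | const c => rfl
  | add P Q hP hQ => rw [eval, eval, hP hK.1, hQ hK.2]
  | sub P Q hP hQ => rw [eval, eval, hP hK.1, hQ hK.2]
  | mul P Q hP hQ => rw [eval, eval, hP hK.1, hQ hK.2]
  | half P hP => rw [eval, eval, hP hK]
  | sign P hP =>
    rw [eval, eval]
    cases P with
    | var v =>
      cases v
      case f =>
        simp only [eval, Term.val, sg]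
        split_ifs <;> simp_all
      all_goals rfl
    | _ => rw [hP hK]

/-- The ring operations need no bound on the values, but halving and `sg` do. As `bound` does not
increase in passing to a subexpression, the single inequality `hM'` makes all subexpressions fit. -/
theorem compZ {BS A₀ : Type} {𝔅 : Base BS A₀} [Inhabited A₀] (K : SgPoly X)
    {ρ : 𝔅.E → ℕ → X → ℤ} (hρ : ∀ v, CompZ 𝔅 (fun e k => ρ e k v)) (M : 𝔅.E → ℕ)
    (hM : ∀ e, 1 ≤ M e) (hM' : ∀ e, K.bound * M e < 2 ^ 𝔅.N e - 1)
    (hle : ∀ e k v, |ρ e k v| ≤ 2 ^ M e) :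
    CompZ 𝔅 (fun e k => K.eval (ρ e k)) ∧ CompZ.Fits 𝔅 (fun e k => K.eval (ρ e k)) := by
  have hfits : ∀ K : SgPoly X, (∀ e, K.bound * M e < 2 ^ 𝔅.N e - 1) →
      CompZ.Fits 𝔅 (fun e k => K.eval (ρ e k)) := by
    intro K hK e k _
    have h1 := K.abs_eval_le (hM e) (hle e k)
    have h2 : (2 : ℤ) ^ (K.bound * M e) < 2 ^ (2 ^ 𝔅.N e - 1) :=
      pow_lt_pow_right₀ (by norm_num) (hK e)
    have h3 := abs_lt.1 (h1.trans_lt h2)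
    exact ⟨h3.1.le, h3.2⟩
  refine ⟨?_, hfits K hM'⟩
  have mono : ∀ {a b : ℕ}, a ≤ b → (∀ e, b * M e < 2 ^ 𝔅.N e - 1) →
      ∀ e, a * M e < 2 ^ 𝔅.N e - 1 :=
    fun h h' e => (Nat.mul_le_mul_right _ h).trans_lt (h' e)
  induction K with
  | var v => exact hρ v
  | const c => exact CompZ.const c
  | add P Q hP hQ =>
    exact (hP (mono (by simp only [bound]; omega) hM')).add
      (hQ (mono (by simp only [bound]; omega) hM'))
  | sub P Q hP hQ =>
    exact (hP (mono (by simp only [bound]; omega) hM')).sub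
      (hQ (mono (by simp only [bound]; omega) hM'))
  | mul P Q hP hQ =>
    exact (hP (mono (by simp only [bound]; omega) hM')).mul
      (hQ (mono (by simp only [bound]; omega) hM'))
  | half P hP => exact (hP hM').half (hfits P hM')
  | sign P hP => exact (hP hM').sign (hfits P hM')

end SgPoly

/-! ### Lengths and concatenation -/

namespace CompN

variable {BS A₀ : Type} {𝔅 : Base BS A₀} [Inhabited A₀]

/-- A position is below the length iff some bit at it or above it is set; the leading bit is the
witness. -/
theorem lt_len {x : 𝔅.E → ℕ} (hx : CompZ 𝔅 fun e _ => x e) (hN : ∀ e, len (x e) ≤ 2 ^ 𝔅.N e) :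
    CompN 𝔅 (fun e (v : Unit → ℕ) => v () < len (x e)) := by
  have h := CompN.ex (ι := Unit) (Q := fun e j v => ¬ j < v () ∧ ZBit (x e) j)
    ((CompN.lt none (some ())).not.and (hx.bit none none))
  refine h.congr fun e v _ => ?_
  simp only [zbit_natCast]
  constructor
  · intro hv
    have hsize := hN e
    cases hs : len (x e) with
    | zero => omega
    | succ s =>
      refine ⟨s, by omega, by omega, ?_⟩
      have h1 : 2 ^ s ≤ x e := Nat.lt_size.1 (by rw [← len, hs]; exact Nat.lt_succ_self s)
      have h2 : x e < 2 ^ (s + 1) := by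
        have := lt_two_pow_len (x e)
        rwa [hs] at this
      rw [pow_succ] at h2
      have h3 : x e / 2 ^ s = 1 := Nat.div_eq_of_lt_le (by omega) (by omega)
      rw [Nat.testBit_eq_decide_div_mod_eq, h3]
      rfl
  · rintro ⟨j, -, hj, h⟩
    exact (not_lt.1 hj).trans_lt (Nat.lt_size.2 (Nat.ge_two_pow_of_testBit h))

theorem eq_len {x : 𝔅.E → ℕ} (hx : CompZ 𝔅 fun e _ => x e) (hN : ∀ e, len (x e) ≤ 2 ^ 𝔅.N e) :
    CompN 𝔅 (fun e (v : Unit → ℕ) => v () = len (x e)) := by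
  have h := lt_len hx hN
  have h1 := CompN.all (ι := Unit) (Q := fun e j v => j < v () → j < len (x e))
    ((CompN.lt none (some ())).imp (h.rename fun _ => none))
  refine (h.not.and h1).congr fun e v hv => ?_
  have hv := hv ()
  constructor
  · intro h
    exact ⟨by omega, fun j _ hj => by omega⟩
  · rintro ⟨h1, h2⟩
    by_contra h3
    have := h2 (len (x e)) (by omega) (by omega)
    omega

/-- In `f` the bits `B` appear in reverse order below position `m`, and those of `g` above. The
subtractions in `h` are expressed by addition and successor: `k = m - 1 - i` by `k + i + 1 = m`, and
`d = i - m` by `m + d = i`. All auxiliary numbers are below `2 ^ N` because `m` and `i` are. -/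
theorem concat {f g m : 𝔅.E → ℕ} {B : 𝔅.E → ℕ → Prop}
    (hm : CompN 𝔅 (fun e (v : Unit → ℕ) => v () = m e)) (hmN : ∀ e, m e < 2 ^ 𝔅.N e)
    (hg : CompN 𝔅 (fun e (v : Unit → ℕ) => (g e).testBit (v ()) = true))
    (hB : CompN 𝔅 (fun e (v : Unit → ℕ) => B e (v ())))
    (h : ∀ e i, (f e).testBit i = true ↔
      (i < m e ∧ B e (m e - 1 - i)) ∨ (m e ≤ i ∧ (g e).testBit (i - m e) = true)) :
    CompN 𝔅 (fun e (v : Unit → ℕ) => (f e).testBit (v ()) = true) := by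
  have h1 := CompN.ex (ι := Option Unit) (Q := fun e k v => B e k ∧
      ∃ t, t < 2 ^ 𝔅.N e ∧ (k + v (some ()) = t ∧ t + 1 = v none))
    ((hB.rename fun _ => none).and (CompN.ex (ι := Option (Option Unit))
      (Q := fun e t v => v none + v (some (some ())) = t ∧ t + 1 = v (some none))
      ((CompN.add (some none) (some (some (some ()))) none).and
        (CompN.succ none (some (some none))))))
  have h2 := CompN.ex (ι := Option Unit) (Q := fun e d v => v none + d = v (some ()) ∧
      (g e).testBit d = true)
    ((CompN.add (some none) none (some (some ()))).and (hg.rename fun _ => none))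
  have h3 := CompN.ex (ι := Unit) (Q := fun e l v => l = m e ∧
      ((∃ k, k < 2 ^ 𝔅.N e ∧ B e k ∧ ∃ t, t < 2 ^ 𝔅.N e ∧ (k + v () = t ∧ t + 1 = l)) ∨
        ∃ d, d < 2 ^ 𝔅.N e ∧ l + d = v () ∧ (g e).testBit d = true))
    ((hm.rename fun _ => none).and (h1.or h2))
  refine h3.congr fun e v hv => ?_
  have hv := hv ()
  have hmN := hmN e
  rw [h]
  constructor
  · rintro (⟨hi, hb⟩ | ⟨hi, hb⟩)
    · exact ⟨_, hmN, rfl, .inl ⟨_, by omega, hb, m e - 1, by omega, by omega, by omega⟩⟩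
    · exact ⟨_, hmN, rfl, .inr ⟨_, by omega, by omega, hb⟩⟩
  · rintro ⟨l, -, rfl, ⟨k, -, hb, t, -, h4, h5⟩ | ⟨d, -, h4, hb⟩⟩
    · exact .inl ⟨by omega, by rwa [show m e - 1 - v () = k by omega]⟩
    · exact .inr ⟨by omega, by rwa [show v () - m e = d by omega]⟩

end CompN

/-! ### Circuits for finitely many functions -/

theorem Circuit.Outputs.lt {p n : ℕ} {C : Circuit p n} {y : Fin p → ℕ} {z : ℕ}
    (h : C.Outputs y z) : z < 2 ^ C.numOut := by
  obtain ⟨v, -, rfl⟩ := h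
  refine Nat.lt_pow_two_of_testBit _ fun i hi => ?_
  rw [← Bool.not_eq_true, testBit_sum C.numOut (fun i => v (C.out i)) i]
  rintro ⟨h, -⟩
  omega

theorem poly_le_two_pow (c n : ℕ) : c * (n + 1) ^ c ≤ 2 ^ (c * (len n + 1)) := by
  rw [Nat.mul_succ, pow_add, Nat.mul_comm c (len n), pow_mul, Nat.mul_comm]
  exact Nat.mul_le_mul (Nat.pow_le_pow_left (lt_two_pow_len n) _) Nat.lt_two_pow_self.le

theorem Circuit.DepthLE.mono {p n d d' : ℕ} {C : Circuit p n} (h : C.DepthLE d) (hd : d ≤ d') :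
    C.DepthLE d' := by
  obtain ⟨level, h⟩ := h
  exact ⟨level, fun a ha => ⟨(h a ha).1.trans hd, (h a ha).2⟩⟩

theorem exists_circuits {κ : Type} [Fintype κ] {P : κ → ℕ} {F : ∀ q, (Fin (P q) → ℕ) → ℕ}
    (hF : ∀ q, FNC1 (F q)) : ∃ (C : ∀ q n, Circuit (P q) n) (c : ℕ), 0 < c ∧
      (∀ q n, ∀ a ∈ (C q n).gates, a.length ≤ c * (len n + 1)) ∧
      (∀ q n, (C q n).numOut ≤ 2 ^ (c * (len n + 1))) ∧
      (∀ q n, (C q n).DepthLE (c * (len n + 1))) ∧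
      (∀ q, DecidableInLogtime fun n t a b => (C q n).Conn t a b) ∧
      ∀ q n y, (∀ j, len (y j) ≤ n) → (C q n).Outputs y (F q y) := by
  choose C hU hS hD hO using hF
  choose a ha using fun q => (hU q).1
  choose s hs using hS
  choose d hd using hD
  have hle : ∀ (f : κ → ℕ) q, f q ≤ ∑ q, f q := fun f q =>
    Finset.single_le_sum (f := f) (fun _ _ => Nat.zero_le _) (Finset.mem_univ q)
  refine ⟨C, 1 + ∑ q, a q + ∑ q, s q + ∑ q, d q, by omega, fun q n x hx => ?_, fun q n => ?_,
    fun q n => ?_, fun q => (hU q).2, hO⟩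
  · have := hle a q
    exact (ha q n x hx).trans (Nat.mul_le_mul_right _ (by omega))
  · have := hle s q
    exact ((Nat.le_add_left _ _).trans (hs q n)).trans ((poly_le_two_pow _ _).trans
      (Nat.pow_le_pow_right (by norm_num) (Nat.mul_le_mul_right _ (by omega))))
  · have := hle d q
    exact (hd q n).mono (Nat.mul_le_mul_right _ (by omega))

/-! ### The solution of the initial value problem -/

section Solution

variable {p : ℕ} {g : (Fin p → ℕ) → ℕ} {h f : ℕ → (Fin p → ℕ) → ℕ} {K : SgPoly (Term p)}

theorem len_two_pow_sub_one_eq (k : ℕ) : len (2 ^ k - 1) = k := by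
  refine le_antisymm (Calls.len_two_pow_sub_one k) ?_
  cases k with
  | zero => exact Nat.zero_le _
  | succ k =>
    refine Nat.lt_size.2 ?_
    have : 0 < 2 ^ k := by positivity
    rw [pow_succ]
    omega

/-- The solution in terms of the length of `x`. -/
theorem exists_of_len (hf0 : ∀ y, f 0 y = g y)
    (hf : SolvesLengthODE f (fun x y => (f x y : ℤ) + K.value x y (h x y) (f x y)))
    (y : Fin p → ℕ) : ∃ G : ℕ → ℕ, (∀ x, f x y = G (len x)) ∧ G 0 = g y ∧
      ∀ k, (G (k + 1) : ℤ) = 2 * G k + K.value (2 ^ k - 1) y (h (2 ^ k - 1) y) (G k) := by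
  -- Where the length does not change, the factor in front of the right-hand side vanishes.
  have h0 : ∀ x d, len (x + d) = len x → f (x + d) y = f x y := by
    intro x d
    induction d with
    | zero => intro _; rfl
    | succ d ih =>
      intro hd
      have h1 : len x ≤ len (x + d) := Nat.size_le_size (Nat.le_add_right _ _)
      have h2 : len (x + d) ≤ len (x + (d + 1)) := Nat.size_le_size (by omega)
      have h3 : len (x + d + 1) = len (x + d) := le_antisymm (by rw [Nat.add_assoc]; omega) h2
      have h4 := hf (x + d) y
      rw [h3, sub_self, zero_mul, add_zero] at h4
      rw [← ih (by omega)]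
      exact_mod_cast h4
  -- `2 ^ len x - 1` is the largest number of the same length as `x`.
  have h1 : ∀ x, f x y = f (2 ^ len x - 1) y := by
    intro x
    obtain ⟨d, hd⟩ := Nat.exists_eq_add_of_le (Nat.le_sub_one_of_lt (lt_two_pow_len x))
    have := h0 x d (by rw [← hd, len_two_pow_sub_one_eq])
    rw [hd, this]
  refine ⟨fun k => f (2 ^ k - 1) y, h1, hf0 y, fun k => ?_⟩
  have hpos : 0 < 2 ^ k := by positivity
  have hx : 2 ^ k - 1 + 1 = 2 ^ k := by omega
  have h2 := hf (2 ^ k - 1) y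
  rw [hx, len_two_pow_sub_one_eq, show len (2 ^ k) = k + 1 from Nat.size_pow, h1 (2 ^ k),
    show len (2 ^ k) = k + 1 from Nat.size_pow] at h2
  beta_reduce
  rw [h2]
  push_cast
  ring

/-- The value of the expression at `2 ^ k - 1`, if the sign of the unknown function is `s`. -/
def stepValue (h : ℕ → (Fin p → ℕ) → ℕ) (K : SgPoly (Term p)) (y : Fin p → ℕ) (s k : ℕ) : ℤ :=
  K.value (2 ^ k - 1) y (h (2 ^ k - 1) y) s

/-- The solution becomes positive before step `k`. -/
def Positive (g : (Fin p → ℕ) → ℕ) (h : ℕ → (Fin p → ℕ) → ℕ) (K : SgPoly (Term p))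
    (y : Fin p → ℕ) (k : ℕ) : Prop :=
  0 < g y ∨ ∃ j, j < k ∧ 0 < stepValue h K y 0 j

/-- The bit which is appended in step `k`. -/
def StepBit (g : (Fin p → ℕ) → ℕ) (h : ℕ → (Fin p → ℕ) → ℕ) (K : SgPoly (Term p))
    (y : Fin p → ℕ) (k : ℕ) : Prop :=
  (Positive g h K y k ∧ 0 < stepValue h K y 1 k) ∨ (¬ Positive g h K y k ∧ 0 < stepValue h K y 0 k)

-- The bit appended in step `k` is shifted by each of the `len x - 1 - k` later steps; so bit `i`
-- comes from step `len x - 1 - i`, and the bits of `g y` are shifted by `len x`. The bound on the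
-- size follows from `G (k + 1) ≤ 2 * G k + 1`.
open Classical in
theorem testBit_solution (hK : K.SimpleCalls)
    (hK01 : ∀ x y, K.value x y (h x y) (f x y) = 0 ∨ K.value x y (h x y) (f x y) = 1)
    (hf0 : ∀ y, f 0 y = g y)
    (hf : SolvesLengthODE f (fun x y => (f x y : ℤ) + K.value x y (h x y) (f x y)))
    (x : ℕ) (y : Fin p → ℕ) :
    f x y < (g y + 1) * 2 ^ len x ∧ ∀ i, (f x y).testBit i = true ↔
      (i < len x ∧ StepBit g h K y (len x - 1 - i)) ∨
        (len x ≤ i ∧ (g y).testBit (i - len x) = true) := by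
  obtain ⟨G, hG, hG0, hGs⟩ := exists_of_len hf0 hf y
  have hval : ∀ k, K.value (2 ^ k - 1) y (h (2 ^ k - 1) y) (G k) =
      stepValue h K y (if 0 < G k then 1 else 0) k := fun k => by
    rw [SgPoly.value_eq_of_simpleCalls hK]
    split_ifs <;> rfl
  have h01 : ∀ k, stepValue h K y (if 0 < G k then 1 else 0) k = 0 ∨
      stepValue h K y (if 0 < G k then 1 else 0) k = 1 := fun k => by
    have := hK01 (2 ^ k - 1) y
    rwa [hG, len_two_pow_sub_one_eq, hval] at this
  -- Once positive, `G` stays positive, since doubling it and adding a nonnegative number does.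
  -- While it vanishes, the appended bit is the candidate for sign `0`, so the first positive
  -- candidate of this kind is where `G` becomes positive.
  have hpos : ∀ k, 0 < G k ↔ Positive g h K y k := by
    intro k
    induction k with
    | zero => rw [hG0]; simp [Positive]
    | succ k ih =>
      have h1 : Positive g h K y (k + 1) ↔ Positive g h K y k ∨ 0 < stepValue h K y 0 k := by
        unfold Positive
        constructor
        · rintro (h | ⟨j, hj, h⟩)
          · exact .inl (.inl h)
          · rcases Nat.lt_succ_iff_lt_or_eq.1 hj with hj | rfl
            · exact .inl (.inr ⟨j, hj, h⟩)
            · exact .inr h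
        · rintro ((h | ⟨j, hj, h⟩) | h)
          · exact .inl h
          · exact .inr ⟨j, by omega, h⟩
          · exact .inr ⟨k, by omega, h⟩
      have h2 := hGs k
      have h3 := h01 k
      rw [hval] at h2
      rw [h1, ← ih]
      by_cases hk : 0 < G k
      · rw [if_pos hk] at h2 h3
        omega
      · rw [if_neg hk] at h2 h3
        omega
  have hbit : ∀ k, G (k + 1) = 2 * G k + (decide (StepBit g h K y k)).toNat := by
    intro k
    have h2 := hGs k
    have h3 := h01 k
    rw [hval] at h2
    have h4 : StepBit g h K y k ↔ 0 < stepValue h K y (if 0 < G k then 1 else 0) k := by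
      rw [StepBit, ← hpos]
      split_ifs with hk <;> simp [hk]
    by_cases hb : StepBit g h K y k
    · have := h4.1 hb
      simp only [hb, decide_true, Bool.toNat_true]
      omega
    · have := mt h4.2 hb
      simp only [hb, decide_false, Bool.toNat_false]
      omega
  rw [hG]
  generalize len x = m
  induction m with
  | zero => simp [hG0]
  | succ m ih =>
    rw [hbit]
    have hle := Bool.toNat_le (decide (StepBit g h K y m))
    refine ⟨?_, fun i => ?_⟩
    · have h1 := ih.1
      have h2 : (g y + 1) * 2 ^ (m + 1) = 2 * ((g y + 1) * 2 ^ m) := by rw [pow_succ]; ring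
      rw [h2]
      omega
    · cases i with
      | zero =>
        rw [Nat.testBit_zero]
        cases hb : decide (StepBit g h K y m) with
        | false => simpa [Nat.add_mod] using hb
        | true => simpa [Nat.add_mod] using hb
      | succ i =>
        have h1 : (2 * G m + (decide (StepBit g h K y m)).toNat) / 2 = G m := by omega
        rw [Nat.testBit_succ, h1, ih.2, show m + 1 - 1 - (i + 1) = m - 1 - i by omega,
          Nat.add_sub_add_right]
        simp only [Nat.add_lt_add_iff_right, Nat.add_le_add_iff_right]

end Solution

section

/-- This is the shape of `StepBit` with a bounded quantifier: `P` stands for the positivity of `g`,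
and `Q` and `R` for that of the candidates for the signs `0` and `1`. -/
theorem CompN.append_bits {BS A₀ : Type} {𝔅 : Base BS A₀} [Inhabited A₀] {P : 𝔅.E → Prop}
    {Q R : 𝔅.E → ℕ → Prop} (hP : CompN 𝔅 (fun e (_ : Unit → ℕ) => P e))
    (hQ : CompN 𝔅 (fun e (v : Unit → ℕ) => Q e (v ())))
    (hR : CompN 𝔅 (fun e (v : Unit → ℕ) => R e (v ()))) :
    CompN 𝔅 (fun e (v : Unit → ℕ) =>
      ((P e ∨ ∃ j, j < 2 ^ 𝔅.N e ∧ j < v () ∧ Q e j) ∧ R e (v ())) ∨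
        (¬ (P e ∨ ∃ j, j < 2 ^ 𝔅.N e ∧ j < v () ∧ Q e j) ∧ Q e (v ()))) := by
  have h : CompN 𝔅 (fun e (v : Unit → ℕ) => P e ∨ ∃ j, j < 2 ^ 𝔅.N e ∧ j < v () ∧ Q e j) :=
    hP.or (CompN.ex (ι := Unit) (Q := fun e j v => j < v () ∧ Q e j)
      ((CompN.lt none (some ())).and (hQ.rename fun _ => none)))
  exact (h.and hR).or (h.not.and hQ)

open Calls (Input)

section Concatenation

variable {p : ℕ}

/-- The numbers of arguments of the called functions `g` (`false`) and `h` (`true`). -/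
def callArity (p : ℕ) (q : Bool) : ℕ := cond q (p + 1) p

def callFun (g : (Fin p → ℕ) → ℕ) (h : ℕ → (Fin p → ℕ) → ℕ) :
    ∀ q, (Fin (callArity p q) → ℕ) → ℕ
  | false => g
  | true => fun z : Fin (p + 1) → ℕ => h (z 0) (Fin.tail z)

/-- Input `0` of the circuit is `x`, so the parameter `y j` is input `j.succ`. The first argument of
`h` is no input but the number `2 ^ k - 1`, whence `none`. -/
def callPin (p : ℕ) : ∀ q, Fin (callArity p q) → Option (Fin (p + 1))
  | false => fun j : Fin p => some j.succ
  | true => (Fin.cons none fun j : Fin p => some j.succ : Fin (p + 1) → Option (Fin (p + 1)))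

/-- Calls of `g` and `h`, where words have length `(c + d) * (len n + 1)` and the values of the
functions have at most `2 ^ (c * (len n + 1))` bits. -/
theorem exists_calls {g : (Fin p → ℕ) → ℕ} {h : ℕ → (Fin p → ℕ) → ℕ} (hg : FNC1 g)
    (hh : FNC1 (fun z : Fin (p + 1) → ℕ => h (z 0) (Fin.tail z))) (d : ℕ) :
    ∃ (S : Calls (p + 1) Bool) (c : ℕ), 0 < c ∧ S.c = c + d ∧
      (CompN S.base fun e (v : Unit → ℕ) => (g (Fin.tail e.1.2)).testBit (v ()) = true) ∧
      (CompZ S.base fun e k => h (2 ^ min k e.1.1 - 1) (Fin.tail e.1.2)) ∧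
      (∀ e : Input (p + 1), g (Fin.tail e.1.2) < 2 ^ 2 ^ (c * (len e.1.1 + 1))) ∧
      ∀ (e : Input (p + 1)) (k : ℕ), h (2 ^ min k e.1.1 - 1) (Fin.tail e.1.2) <
        2 ^ 2 ^ (c * (len e.1.1 + 1)) := by
  have hF : ∀ q, FNC1 (callFun g h q) := by
    rintro (_ | _)
    · exact hg
    · exact hh
  obtain ⟨C, c, hc, hlen, hout, hdepth, hdec, hval⟩ := exists_circuits hF
  have hmono : ∀ n, c * (len n + 1) ≤ (c + d) * (len n + 1) := fun n =>
    Nat.mul_le_mul_right _ (Nat.le_add_right c d)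
  let S : Calls (p + 1) Bool :=
    { P := callArity p
      F := callFun g h
      C := C
      pin := callPin p
      c := c + d
      c_pos := by omega
      length_le := fun q n a ha => (hlen q n a ha).trans (hmono n)
      depth_le := fun q n => (hdepth q n).mono (hmono n)
      dec := hdec
      outputs := hval }
  have hlt : ∀ (e : Input (p + 1)) (q : Bool) (k : ℕ),
      S.F q (S.args e.1.2 q (min k e.1.1)) < 2 ^ 2 ^ (c * (len e.1.1 + 1)) := by
    intro e q k
    have h1 := hval q e.1.1 _ (S.len_args e q (k := min k e.1.1) (min_le_right _ _))
    exact h1.lt.trans_le (Nat.pow_le_pow_right (by norm_num) (hout q e.1.1))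
  have hh' : ∀ (e : Input (p + 1)) (k : ℕ), S.F true (S.args e.1.2 true (min k e.1.1)) =
      h (2 ^ min k e.1.1 - 1) (Fin.tail e.1.2) := fun _ _ => rfl
  refine ⟨S, c, hc, rfl, ?_, ?_, fun e => hlt e false 0, fun e k => ?_⟩
  · exact ((S.comp_call false).rename fun _ => ()).congr fun _ _ _ => Iff.rfl
  · refine (S.comp_call true).congr fun e v _ => ?_
    rw [zbit_natCast, ← hh']
  · rw [← hh']
    exact hlt e true k

theorem fnc1_solution
    {g : (Fin p → ℕ) → ℕ} {h f : ℕ → (Fin p → ℕ) → ℕ} {K : SgPoly (Term p)}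
    (hg : FNC1 g) (hh : FNC1 (fun z : Fin (p + 1) → ℕ => h (z 0) (Fin.tail z)))
    (hK : K.SimpleCalls)
    (hK01 : ∀ x y, K.value x y (h x y) (f x y) = 0 ∨ K.value x y (h x y) (f x y) = 1)
    (hf0 : ∀ y, f 0 y = g y)
    (hf : SolvesLengthODE f (fun x y => (f x y : ℤ) + K.value x y (h x y) (f x y))) :
    FNC1 (fun z : Fin (p + 1) → ℕ => f (z 0) (Fin.tail z)) := by
  -- `M` below bounds the lengths of the inputs and of the values of `g` and `h`. Lengthening the
  -- words by the factor `K.bound + 2` gives `M * (K.bound + 3) ≤ 2 ^ width`: room for every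
  -- subexpression of `K`, with the sign position, and for the bits of `f`.
  obtain ⟨S, c, hc, hSc, hgbit, hhz, hglt, hhlt⟩ := exists_calls hg hh (K.bound + 2)
  let M : Input (p + 1) → ℕ := fun e => 2 ^ (c * (len e.1.1 + 1))
  have hM1 : ∀ e, 1 ≤ M e := fun e => Nat.one_le_two_pow
  have hM : ∀ e : Input (p + 1), M e * (K.bound + 3) ≤ 2 ^ S.width e.1.1 := by
    intro e
    rw [Calls.width, hSc, Nat.add_mul, pow_add]
    refine Nat.mul_le_mul_left _ ?_
    have h1 : K.bound + 2 < 2 ^ (K.bound + 2) := Nat.lt_two_pow_self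
    exact Nat.succ_le_of_lt (h1.trans_le (Nat.pow_le_pow_right (by norm_num)
      (Nat.le_mul_of_pos_right _ (Nat.succ_pos _))))
  have hnM : ∀ e : Input (p + 1), e.1.1 ≤ M e := fun e =>
    (lt_two_pow_len e.1.1).le.trans (Nat.pow_le_pow_right (by norm_num)
      ((Nat.le_succ _).trans (Nat.le_mul_of_pos_left _ hc)))
  have hKM : ∀ e : Input (p + 1), K.bound * M e < 2 ^ S.width e.1.1 - 1 := by
    intro e
    have h1 := hM e
    have h2 := hM1 e
    rw [Nat.mul_add, Nat.mul_comm] at h1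
    omega
  have hlen : ∀ e : Input (p + 1), len (e.1.2 0) < 2 ^ S.width e.1.1 := fun e =>
    (e.2 0).trans_lt (S.lt_two_pow_width _)
  have hx := S.comp_input 0
  have hltlen := CompN.lt_len hx fun e => (hlen e).le
  -- Only `k < len x` matters, but the terms must be bounded by `2 ^ M` for every `k`. So `2 ^ k -
  -- 1` is replaced by `0` from `len x` on, and in the argument of `h` the exponent is capped at
  -- `n`; both agree with the original terms for `k < len x`.
  let ρ : ℕ → Input (p + 1) → ℕ → Term p → ℤ := fun s e k =>
    Term.val (if k < len (e.1.2 0) then 2 ^ k - 1 else 0) (Fin.tail e.1.2)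
      (h (2 ^ min k e.1.1 - 1) (Fin.tail e.1.2)) s
  have hρ : ∀ s t, CompZ S.base (fun e k => ρ s e k t) := by
    intro s t
    cases t with
    | x =>
      refine ((hltlen.rename fun _ => false).and (CompN.lt true false)).congr fun e v _ => ?_
      simp only [ρ, Term.val, zbit_natCast]
      split_ifs with hk
      · rw [Calls.testBit_two_pow_sub_one, and_iff_right hk]
      · simp [hk]
    | y j => exact S.comp_input j.succ
    | h => exact hhz
    | f => exact CompZ.const s
  have hρle : ∀ s, s ≤ 1 → ∀ e k t, |ρ s e k t| ≤ 2 ^ M e := by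
    intro s hs e k t
    have hpow : (2 : ℕ) ^ e.1.1 ≤ 2 ^ M e := Nat.pow_le_pow_right (by norm_num) (hnM e)
    have hin : ∀ j, e.1.2 j ≤ 2 ^ M e := fun j => (lt_two_pow_len _).le.trans
      ((Nat.pow_le_pow_right (by norm_num) (e.2 j)).trans hpow)
    have h1 : ∃ m : ℕ, ρ s e k t = m ∧ m ≤ 2 ^ M e := by
      cases t with
      | x =>
        refine ⟨_, rfl, ?_⟩
        split_ifs with hk
        · exact (Nat.sub_le _ _).trans ((Nat.pow_le_pow_right (by norm_num)
            (hk.le.trans (e.2 0))).trans hpow)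
        · exact Nat.zero_le _
      | y j => exact ⟨_, rfl, hin j.succ⟩
      | h => exact ⟨_, rfl, (hhlt e k).le⟩
      | f => exact ⟨_, rfl, hs.trans Nat.one_le_two_pow⟩
    obtain ⟨m, h1, h2⟩ := h1
    rw [h1, Nat.abs_cast]
    exact_mod_cast h2
  have hpos : ∀ s, s ≤ 1 → CompN S.base (fun e (v : Unit → ℕ) => 0 < K.eval (ρ s e (v ()))) := by
    intro s hs
    have := K.compZ (hρ s) M hM1 hKM (hρle s hs)
    exact this.1.pos this.2
  obtain ⟨Q, hQ, hstep⟩ : ∃ Q : ℕ → Input (p + 1) → ℕ → Prop,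
      (∀ s, s ≤ 1 → CompN S.base (fun e (v : Unit → ℕ) => Q s e (v ()))) ∧
        ∀ (s : ℕ) (e : Input (p + 1)) (k : ℕ), k < len (e.1.2 0) →
          (Q s e k ↔ 0 < stepValue h K (Fin.tail e.1.2) s k) := by
    refine ⟨fun s e k => 0 < K.eval (ρ s e k), hpos, fun s e k hk => ?_⟩
    simp only [ρ, hk, if_true, min_eq_left (hk.le.trans (e.2 0))]
    rfl
  have hg0 : CompN S.base (fun e (_ : Unit → ℕ) => 0 < g (Fin.tail e.1.2)) := by
    refine (CompN.ex (𝔅 := S.base) (ι := Unit) (Q := fun e i _ => (g (Fin.tail e.1.2)).testBit i = true)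
      (hgbit.rename fun _ => none)).congr fun e _ _ => ?_
    constructor
    · intro h0
      obtain ⟨i, hi⟩ := Nat.exists_testBit_of_ne_zero h0.ne'
      refine ⟨i, ?_, hi⟩
      have h1 := (Nat.ge_two_pow_of_testBit hi).trans_lt (hglt e)
      rw [Nat.pow_lt_pow_iff_right (by norm_num)] at h1
      exact h1.trans_le ((Nat.le_mul_of_pos_right _ (Nat.succ_pos _)).trans (hM e))
    · rintro ⟨i, -, hi⟩
      by_contra h0
      rw [Nat.eq_zero_of_not_pos h0] at hi
      simp at hi
  have hB := CompN.append_bits hg0 (hQ 0 (Nat.zero_le 1)) (hQ 1 le_rfl)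
  have hPos : ∀ (e : Input (p + 1)) (k : ℕ), k < len (e.1.2 0) →
      ((0 < g (Fin.tail e.1.2) ∨ ∃ j, j < 2 ^ S.base.N e ∧ j < k ∧ Q 0 e j) ↔
        Positive g h K (Fin.tail e.1.2) k) := by
    intro e k hk
    refine or_congr_right (exists_congr fun j => ?_)
    constructor
    · rintro ⟨-, h1, h2⟩
      exact ⟨h1, (hstep 0 e j (h1.trans hk)).1 h2⟩
    · rintro ⟨h1, h2⟩
      exact ⟨h1.trans (hk.trans (hlen e)), h1, (hstep 0 e j (h1.trans hk)).2 h2⟩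
  refine S.fnc1 _ (CompN.concat (B := fun e k =>
    ((0 < g (Fin.tail e.1.2) ∨ ∃ j, j < 2 ^ S.base.N e ∧ j < k ∧ Q 0 e j) ∧ Q 1 e k) ∨
      (¬ (0 < g (Fin.tail e.1.2) ∨ ∃ j, j < 2 ^ S.base.N e ∧ j < k ∧ Q 0 e j) ∧ Q 0 e k))
    (CompN.eq_len hx fun e => (hlen e).le) hlen hgbit hB fun e i => ?_) fun e => ?_
  · rw [(testBit_solution hK hK01 hf0 hf (e.1.2 0) (Fin.tail e.1.2)).2]
    refine or_congr_left (and_congr_right fun hi => ?_)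
    have hk : len (e.1.2 0) - 1 - i < len (e.1.2 0) := by omega
    rw [hPos e _ hk, hstep 0 e _ hk, hstep 1 e _ hk]
    rfl
  · refine (testBit_solution hK hK01 hf0 hf (e.1.2 0) (Fin.tail e.1.2)).1.trans_le ?_
    -- Both factors of the bound `(g y + 1) * 2 ^ len x` are at most `2 ^ M`, and `2 * M` is covered
    -- by the room reserved in `hM`.
    have h1 : (2 : ℕ) ^ len (e.1.2 0) ≤ 2 ^ M e :=
      Nat.pow_le_pow_right (by norm_num) ((e.2 0).trans (hnM e))
    refine (Nat.mul_le_mul (Nat.succ_le_of_lt (hglt e)) h1).trans ?_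
    show 2 ^ M e * 2 ^ M e ≤ _
    rw [← pow_add]
    refine Nat.pow_le_pow_right (by norm_num) (le_trans ?_ (hM e))
    nlinarith [Nat.zero_le (M e * K.bound)]

end Concatenation

end

end LengthODE

theorem mainTheorem10 (p : ℕ)
    (g : (Fin p → ℕ) → ℕ) (h : ℕ → (Fin p → ℕ) → ℕ) (f : ℕ → (Fin p → ℕ) → ℕ)
    (K : LengthODE.SgPoly (LengthODE.Term p))
    (hg : LengthODE.FNC1 g)
    (hh : LengthODE.FNC1 (fun z : Fin (p + 1) → ℕ => h (z 0) (Fin.tail z)))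
    (hK : K.SimpleCalls)
    (hK01 : ∀ x y, K.value x y (h x y) (f x y) = 0 ∨ K.value x y (h x y) (f x y) = 1)
    (hf0 : ∀ y, f 0 y = g y)
    (hf : LengthODE.SolvesLengthODE f
      (fun x y => (f x y : ℤ) + K.value x y (h x y) (f x y))) :
    LengthODE.FNC1 (fun z : Fin (p + 1) → ℕ => f (z 0) (Fin.tail z)) :=
  LengthODE.fnc1_solution hg hh hK hK01 hf0 hf
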